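/- Let $\mathbb T^2=\mathbb R^2/\mathbb Z^2$ with Lebesgue measure. For $0<\eta<1$ let $f:[0,1]\to[0,1]$ be $f(y)=y/(1-\eta)$ for $y\le 1-\eta$ and $f(y)=(1-y)/\eta$ for $y\ge 1-\eta$, and let $H=G\circ F:\mathbb T^2\to\mathbb T^2$ with $F(x,y)=(x+f(y),y)$ and $G(x,y)=(x,y+x)$. The map $H$ is differentiable off the singular set $S=\{y=0\}\cup\{y=1-\eta\}$, with Jacobian $DH_1=\begin{pmatrix}1&\frac1{1-\eta}\\1&1+\frac1{1-\eta}\end{pmatrix}$ for $0<y<1-\eta$ and $DH_0=\begin{pmatrix}1&-\frac1\eta\\1&1-\frac1\eta\end{pmatrix}$ for $1-\eta<y<1$. The Lyapunov exponent of $H^{\pm1}$ at $z$ in direction $v\neq0$ is $\limsup_{n\to\infty}\frac1n\log\|DH^{\pm n}_zv\|$. A local stable manifold $\gamma_s(z)$ of $H$ at $z$ is a line segment with $z$ in its interior, aligned with a direction whose Lyapunov exponent under $H$ is negative, such that $\mathrm{dist}(H^n\zeta,H^n\zeta')\to0$ as $n\to\infty$ for all $\zeta,\zeta'\in\gamma_s(z)$;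 a local unstable manifold $\gamma_u(z)$ of $H$ is a local stable manifold of $H^{-1}$. Let $X'$ be the set of $z\in\mathbb T^2$ such that $H^n(z)\notin S$ for all $n\in\mathbb Z$, all Lyapunov exponents of $H$ and of $H^{-1}$ at $z$ are non-zero, and $z$ has a local stable and a local unstable manifold. Let $\mathfrak M_1=DH_1^{-1}$, $\mathfrak M_2=DH_1^{-1}DH_0^{-1}$, $\mathfrak M_3=DH_1^{-1}DH_0^{-2}$, let $\mathcal C'$ be the cone of non-zero vectors whose gradient lies between those of the unstable eigenvectors of $\mathfrak M_1$ and $\mathfrak M_3$ (inclusive), and let $\mathcal K_i(\eta)=\inf_{v\in\mathcal C'}\|\mathfrak M_iv\|_\infty/\|v\|_\infty$. Let $\eta_1$ be the supremum of the $t\in(0,\frac13]$ such that $$\mathcal K_3(\eta)>\frac1{1-\frac1{\mathcal K_1(\eta)}-\frac1{\mathcal K_2(\eta)}}\qquad\text{for all }0<\eta<t.$$ Then $\eta_1\approx0.324$ (to three decimals, $|\eta_1-0.324|<0.0005$), and for every $0<\eta<\eta_1$ the set $X'$ has full Lebesgue measure and condition (M) holds for $H$: for all $z,z'\in X'$, every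 local unstable manifold $\gamma_u(z)$ at $z$ and every local stable manifold $\gamma_s(z')$ at $z'$, there are integers $m,n\ge0$ with $$H^m(\gamma_u(z))\cap H^{-n}(\gamma_s(z'))\neq\emptyset .$$ -/

import Mathlib

open MeasureTheory Filter Topology Set

namespace ToralShear

noncomputable section

/-- The two-torus `ℝ² / ℤ²`, with its Lebesgue (Haar) probability measure `volume`. -/
abbrev Torus : Type := UnitAddCircle × UnitAddCircle

/-- The representative in `[0, 1)` of a point of the circle. -/
def rep (y : UnitAddCircle) : ℝ := (AddCircle.equivIco (1 : ℝ) 0 y : ℝ)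

/-- The projection `ℝ² → 𝕋²`. -/
def proj (v : Fin 2 → ℝ) : Torus := ((v 0 : UnitAddCircle), (v 1 : UnitAddCircle))

/-- The non-monotonic shear profile on `[0, 1]`: it increases from `0` to `1` on `[0, 1 - η]` and
decreases from `1` to `0` on `[1 - η, 1]`. -/
def profile (η y : ℝ) : ℝ := if y ≤ 1 - η then y / (1 - η) else (1 - y) / η

/-- The horizontal shear `F (x, y) = (x + f y, y)`. -/
def shearF (η : ℝ) : Equiv.Perm Torus where
  toFun z := (z.1 + (profile η (rep z.2) : UnitAddCircle), z.2)
  invFun z := (z.1 - (profile η (rep z.2) : UnitAddCircle), z.2)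
  left_inv z := by simp
  right_inv z := by simp

/-- The vertical shear `G (x, y) = (x, y + x)`. -/
def shearG : Equiv.Perm Torus where
  toFun z := (z.1, z.2 + z.1)
  invFun z := (z.1, z.2 - z.1)
  left_inv z := by simp
  right_inv z := by simp

/-- The toral map `H = G ∘ F`. -/
def mapH (η : ℝ) : Equiv.Perm Torus := shearG * shearF η

/-- The Jacobian matrix of `H` on the strip `A = {0 < y < 1 - η}`. -/
def jacA (η : ℝ) : Matrix (Fin 2) (Fin 2) ℝ := !![1, 0; 1, 1] * !![1, 1 / (1 - η); 0, 1]

/-- The Jacobian matrix of `H` on the strip `{1 - η < y < 1}`. -/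
def jacB (η : ℝ) : Matrix (Fin 2) (Fin 2) ℝ := !![1, 0; 1, 1] * !![1, -(1 / η); 0, 1]

/-- The Jacobian matrix of `H` at `z`. It is the derivative of `H` off `singularSet η`; its value
on `singularSet η` is never used. -/
def jacH (η : ℝ) (z : Torus) : Matrix (Fin 2) (Fin 2) ℝ :=
  if rep z.2 < 1 - η then jacA η else jacB η

/-- The Jacobian matrix of `H⁻¹` at `z`. -/
def jacHinv (η : ℝ) (z : Torus) : Matrix (Fin 2) (Fin 2) ℝ := (jacH η ((mapH η)⁻¹ z))⁻¹

/-- The lines `y = 0` and `y = 1 - η`, where `H` fails to be differentiable. -/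
def singularSet (η : ℝ) : Set Torus :=
  {z | z.2 = 0 ∨ z.2 = ((1 - η : ℝ) : UnitAddCircle)}

/-! ### Lyapunov exponents and local stable manifolds of a toral map `T` with Jacobian `D` -/

/-- The Jacobian matrix of `T ^ n` at `z`, by the chain rule. -/
def cocycle (T : Equiv.Perm Torus) (D : Torus → Matrix (Fin 2) (Fin 2) ℝ) :
    ℕ → Torus → Matrix (Fin 2) (Fin 2) ℝ
  | 0, _ => 1
  | n + 1, z => D ((T ^ n) z) * cocycle T D n z

/-- The Lyapunov exponent of `T` at `z` in the direction `v`. -/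
def lyapunov (T : Equiv.Perm Torus) (D : Torus → Matrix (Fin 2) (Fin 2) ℝ)
    (z : Torus) (v : Fin 2 → ℝ) : ℝ :=
  limsup (fun n : ℕ => (1 / (n : ℝ)) * Real.log ‖(cocycle T D n z).mulVec v‖) atTop

/-- The segment on the torus through `z` in the direction `v`, from `z - a v` to `z + b v`. -/
def seg (z : Torus) (v : Fin 2 → ℝ) (a b : ℝ) : Set Torus :=
  (fun t : ℝ => z + proj (t • v)) '' Icc (-a) b

/-- `γ` is a local stable manifold of `T` at `z`: a line segment with `z` in its interior, aligned
with the stable direction at `z`, whose points are forward asymptotic to each other. -/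
def IsLocalStable (T : Equiv.Perm Torus) (D : Torus → Matrix (Fin 2) (Fin 2) ℝ)
    (z : Torus) (γ : Set Torus) : Prop :=
  (∃ (v : Fin 2 → ℝ) (a b : ℝ), v ≠ 0 ∧ lyapunov T D z v < 0 ∧ 0 < a ∧ 0 < b ∧
    γ = seg z v a b) ∧
  ∀ ζ ∈ γ, ∀ ζ' ∈ γ, Tendsto (fun n : ℕ => dist ((T ^ n) ζ) ((T ^ n) ζ')) atTop (𝓝 0)

/-- `γ = γ_s(z)` is a local stable manifold of `H` at `z`. -/
def IsStableManifold (η : ℝ) (z : Torus) (γ : Set Torus) : Prop :=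
  IsLocalStable (mapH η) (jacH η) z γ

/-- `γ = γ_u(z)` is a local unstable manifold of `H` at `z`: a local stable manifold of `H⁻¹`. -/
def IsUnstableManifold (η : ℝ) (z : Torus) (γ : Set Torus) : Prop :=
  IsLocalStable (mapH η)⁻¹ (jacHinv η) z γ

/-- The set `X'`: the full orbit of `z` avoids the singular set, all Lyapunov exponents at `z` (of
`H` and of `H⁻¹`) are non-zero, and there are local stable and unstable manifolds at `z`. -/
def regularSet (η : ℝ) : Set Torus :=
  {z | (∀ n : ℤ, (mapH η ^ n) z ∉ singularSet η) ∧
    (∀ v : Fin 2 → ℝ, v ≠ 0 → lyapunov (mapH η) (jacH η) z v ≠ 0 ∧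
      lyapunov (mapH η)⁻¹ (jacHinv η) z v ≠ 0) ∧
    (∃ γ, IsStableManifold η z γ) ∧ ∃ γ, IsUnstableManifold η z γ}

/-- Condition (M): some forward image of the local unstable manifold at `z` meets some backward
image of the local stable manifold at `z'`, for any `z, z' ∈ X'`. -/
def ConditionM (η : ℝ) : Prop :=
  ∀ z ∈ regularSet η, ∀ z' ∈ regularSet η, ∀ γu γs : Set Torus,
    IsUnstableManifold η z γu → IsStableManifold η z' γs →
    ∃ m n : ℕ, (((mapH η ^ m : Equiv.Perm Torus) '' γu) ∩
      (((mapH η)⁻¹ ^ n : Equiv.Perm Torus) '' γs)).Nonempty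

/-! ### The threshold `η₁` -/

/-- The Jacobian matrices of the return map under `H⁻¹`, for return times 1, 2 and 3. -/
def returnMatrix (η : ℝ) : Fin 3 → Matrix (Fin 2) (Fin 2) ℝ :=
  ![(jacA η)⁻¹, (jacA η)⁻¹ * (jacB η)⁻¹, (jacA η)⁻¹ * (jacB η)⁻¹ * (jacB η)⁻¹]

/-- `g` is the gradient of an unstable eigenvector of `M`. -/
def IsUnstableGradient (M : Matrix (Fin 2) (Fin 2) ℝ) (g : ℝ) : Prop :=
  ∃ μ : ℝ, 1 < |μ| ∧ M.mulVec ![1, g] = μ • ![1, g]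

/-- The cone of non-zero vectors bounded by (and containing) the unstable eigenvectors of the
return matrices for the return times 1 and 3. -/
def cone (η : ℝ) : Set (Fin 2 → ℝ) :=
  {v | ∃ g₁ g₃ g t : ℝ, IsUnstableGradient (returnMatrix η 0) g₁ ∧
    IsUnstableGradient (returnMatrix η 2) g₃ ∧ g₁ ≤ g ∧ g ≤ g₃ ∧ t ≠ 0 ∧ v = t • ![1, g]}

/-- The minimal expansion of the `i`-th return matrix on the cone, in the sup norm. -/
def minExpansion (η : ℝ) (i : Fin 3) : ℝ :=
  sInf ((fun v : Fin 2 → ℝ => ‖(returnMatrix η i).mulVec v‖ / ‖v‖) '' cone η)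

/-- The threshold: the largest `t ≤ 1/3` such that the expansion inequality holds on `(0, t)`. -/
def eta1 : ℝ :=
  sSup {t : ℝ | 0 < t ∧ t ≤ 1 / 3 ∧ ∀ η : ℝ, 0 < η → η < t →
    minExpansion η 2 > 1 / (1 - 1 / minExpansion η 0 - 1 / minExpansion η 1)}

end

end ToralShear

/-!
Put `s = y - x`. In the coordinates `(y, s)` the inverse map is the second-order recurrence
`(y, s) ↦ (s, 2 s + f s - y)`, the strip `A = {0 < y < 1 - η}` and its image under `H` meet in the
square `0 ≤ y, s ≤ 1 - η`, and the reversor `(y, s) ↦ (s, y)` conjugates `H` to `H⁻¹`.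

As long as no backward image of a segment with direction in the invariant cone crosses this square
from bottom to top, the segment splits into at most three pieces, one for each of the return maps
`A`, `AB`, `ABB`, named after the strips visited, `B` being the complement of `A`. The inverses of
the minimal expansions of these maps have sum less than one, which is the inequality defining `η₁`,
so the image of one of the pieces is longer than the segment by a fixed factor. As lengths in the
square are bounded, some backward image of a local stable manifold crosses it from bottom to top. By
reversibility some forward image of a local unstable manifold crosses it from left to right, and the
two must meet.

Regularity is a Borel–Cantelli argument: almost every orbit approaches the singular set more slowly
than the geometric rate at which the cone contracts, which leaves room for a local stable segment.
-/

namespace ToralShear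

/-! ### Cone data -/

/-- The constants attached to a parameter `η`, in the coordinates `(y, s)` with `s = y - x`. There
`H⁻¹` lifts to `(y, s) ↦ (s, (2 + a) s - y)` for `0 ≤ s ≤ 1 - η` and to `(y, s) ↦ (s, - t s - y)`
for `-η ≤ s ≤ 0`. The slopes `μ` and `r` are those of the unstable eigenvectors of the return
matrices for the return times 1 and 3, so that they bound the invariant cone, and `-κ` is the
gradient of the latter eigenvector in the coordinates `(x, y)`. The bound `η < 0.3245` is any bound
slightly above the threshold `eta1`. -/
structure ConeData (η : ℝ) where
  (a t μ r κ : ℝ)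
  pos : 0 < η
  lt : η < 0.3245
  a_mul : a * (1 - η) = 1
  t_mul : t * η = 1 - 2 * η
  one_lt_μ : 1 < μ
  μ_eq : μ ^ 2 + 1 = (2 + a) * μ
  r_eq : (r - (2 + a)) * ((t ^ 2 - 1) * r + t) = t * r + 1
  lt_r : 2 + a < r
  κ_mul : κ * (r - 1) = 1

namespace ConeData

variable {η : ℝ} (P : ConeData η)

/-- The least expansion on the cone of the return matrix for return time 1, in the sup norm. -/
def rateA : ℝ := 1 + P.a + P.a * P.κ

/-- The least expansion on the cone of the return matrix for return time 2, in the sup norm. -/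
def rateAB : ℝ := (1 + P.a) * P.t + 1 + ((1 + P.a) * (1 + P.t) + 1) * P.κ

/-- The least expansion on the cone of the return matrix for return time 3, in the sup norm. -/
def rateABB : ℝ :=
  P.t ^ 2 + P.t - 1 + P.a * (P.t ^ 2 - 1) +
    ((1 + P.a) * P.t ^ 2 + (2 + P.a) * P.t - P.a) * P.κ

lemma a_eq : P.a = 1 / (1 - η) :=
  eq_div_of_mul_eq (by linarith [P.lt]) P.a_mul

lemma t_eq : P.t = 1 / η - 2 := by
  have := P.t_mul
  field_simp [P.pos.ne']
  linarith

lemma one_lt_a : 1 < P.a := by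
  by_contra! h
  nlinarith [P.pos, P.lt, P.a_mul]

lemma a_lt : P.a < 1.481 := by
  by_contra! h
  nlinarith [P.pos, P.lt, P.a_mul]

lemma lt_t : 1.0816 < P.t := by
  by_contra! h
  nlinarith [P.pos, P.lt, P.t_mul]

lemma lt_μ : 2.6 < P.μ := by
  by_contra! h
  nlinarith [P.one_lt_a, P.one_lt_μ, P.μ_eq]

lemma μ_lt : P.μ < 3.17 := by
  by_contra! h
  nlinarith [P.a_lt, P.one_lt_μ, P.μ_eq]

lemma μ_lt_r : P.μ < P.r := by
  by_contra! h
  nlinarith [P.lt_r, P.one_lt_μ, P.μ_eq]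

lemma r_lt : P.r < 10 := by
  have ha := P.a_lt
  have ha₁ := P.one_lt_a
  have ht := P.lt_t
  by_contra! h
  have ht₂ : 0.157 * P.t ≤ P.t ^ 2 - 1 := by nlinarith
  have hden : 0 < (P.t ^ 2 - 1) * P.r + P.t := by
    linarith [mul_pos (show 0 < P.t ^ 2 - 1 by linarith) (show 0 < P.r by linarith)]
  have hlow : 6.519 * ((P.t ^ 2 - 1) * P.r + P.t) ≤ P.t * P.r + 1 := by
    rw [← P.r_eq]
    exact mul_le_mul_of_nonneg_right (by linarith) hden.le
  nlinarith [mul_le_mul_of_nonneg_right ht₂ (by linarith : (0 : ℝ) ≤ P.r)]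

lemma κ_pos : 0 < P.κ := by
  by_contra! h
  nlinarith [P.lt_r, P.κ_mul, P.one_lt_a]

end ConeData

/-! ### Families of segments closed under the lifted dynamics -/

/-- A family of oriented planar segments: `R y s y' s'` means that the segment from `(y, s)` to
`(y', s')` belongs to the family. -/
abbrev SegFamily : Type := ℝ → ℝ → ℝ → ℝ → Prop

/-- Closedness of a family under taking subsegments, integer translations and the two affine
branches of the lift of `H⁻¹`. The backward images of a curve on the torus form such a family. -/
structure SegClosed {η : ℝ} (P : ConeData η) (R : SegFamily) : Prop where
  sub : ∀ {y s y' s' u v : ℝ}, R y s y' s' → 0 ≤ u → u ≤ 1 → 0 ≤ v → v ≤ 1 →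
    R (y + u * (y' - y)) (s + u * (s' - s)) (y + v * (y' - y)) (s + v * (s' - s))
  shift : ∀ {y s y' s' : ℝ}, R y s y' s' → ∀ m n : ℤ, R (y + m) (s + n) (y' + m) (s' + n)
  stepA : ∀ {y s y' s' : ℝ}, R y s y' s' → 0 ≤ s → s ≤ 1 - η → 0 ≤ s' → s' ≤ 1 - η →
    R s ((2 + P.a) * s - y) s' ((2 + P.a) * s' - y')
  stepB : ∀ {y s y' s' : ℝ}, R y s y' s' → -η ≤ s → s ≤ 0 → -η ≤ s' → s' ≤ 0 →
    R s (-P.t * s - y) s' (-P.t * s' - y')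

/-- Some segment of the family crosses the square `[0, 1 - η]²` from bottom to top. -/
def Crosses (η : ℝ) (R : SegFamily) : Prop :=
  ∃ y₀ y₁, 0 ≤ y₀ ∧ y₀ ≤ y₁ ∧ y₁ ≤ 1 - η ∧ R y₀ 0 y₁ (1 - η)

/-- The image of a family under the central symmetry of the square `[0, 1 - η]²`, which commutes
with the dynamics modulo integer translations. -/
def SegFamily.flip (η : ℝ) (R : SegFamily) : SegFamily := fun y s y' s' =>
  R (1 - η - y) (1 - η - s) (1 - η - y') (1 - η - s')

lemma exists_add_mul_sub_eq {p q c : ℝ} (hp : p ≤ c) (hq : c ≤ q) :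
    ∃ u : ℝ, 0 ≤ u ∧ u ≤ 1 ∧ p + u * (q - p) = c := by
  rcases (hp.trans hq).eq_or_lt with rfl | hpq
  · exact ⟨0, le_rfl, zero_le_one, by linarith⟩
  · have hd : 0 < q - p := sub_pos.2 hpq
    exact ⟨(c - p) / (q - p), div_nonneg (by linarith) hd.le, (div_le_one hd).2 (by linarith),
      by field_simp; ring⟩

lemma exists_add_mul_eq {c m d e : ℝ} (hd : 0 ≤ d) (hc : c ≤ e) (he : e ≤ c + m * d) :
    ∃ w : ℝ, 0 ≤ w ∧ w ≤ d ∧ c + m * w = e := by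
  obtain ⟨u, hu₀, hu₁, hu⟩ := exists_add_mul_sub_eq hc he
  exact ⟨u * d, mul_nonneg hu₀ hd, mul_le_of_le_one_left hd hu₁, by linear_combination hu⟩

section SegClosed

variable {η : ℝ} {P : ConeData η} {R : SegFamily} {y s y' s' : ℝ}

lemma SegClosed.symm (hR : SegClosed P R) (h : R y s y' s') : R y' s' y s := by
  simpa using hR.sub h zero_le_one le_rfl le_rfl zero_le_one

lemma SegClosed.shift_snd (hR : SegClosed P R) (h : R y s y' s') (n : ℤ) :
    R y (s + n) y' (s' + n) := by
  simpa using hR.shift h 0 n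

lemma SegClosed.sub_dir (hR : SegClosed P R) {d ρ u v : ℝ}
    (h : R y s (y + d) (s + ρ * d)) (hu : 0 ≤ u) (hud : u ≤ d) (hv : 0 ≤ v) (hvd : v ≤ d) :
    R (y + u) (s + ρ * u) (y + v) (s + ρ * v) := by
  rcases (hu.trans hud).eq_or_lt with rfl | hd
  · simpa [le_antisymm hud hu, le_antisymm hvd hv] using h
  have hsub := hR.sub h (div_nonneg hu hd.le) ((div_le_one hd).2 hud) (div_nonneg hv hd.le)
    ((div_le_one hd).2 hvd)
  have hfst : ∀ w : ℝ, w / d * (y + d - y) = w := fun w => by field_simp; ring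
  have hsnd : ∀ w : ℝ, w / d * (s + ρ * d - s) = ρ * w := fun w => by field_simp; ring
  simpa only [hfst, hsnd] using hsub

lemma SegClosed.flip (hR : SegClosed P R) : SegClosed P (R.flip η) where
  sub h hu hu' hv hv' := by
    unfold SegFamily.flip
    convert hR.sub h hu hu' hv hv' using 1 <;> ring
  shift h m n := by
    unfold SegFamily.flip
    convert hR.shift h (-m) (-n) using 1 <;> push_cast <;> ring
  stepA h _ _ _ _ := by
    unfold SegFamily.flip
    convert hR.shift_snd
      (hR.stepA h (by linarith) (by linarith) (by linarith) (by linarith)) (-1) using 1 <;>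
      push_cast <;> linarith [P.a_mul]
  stepB h _ _ _ _ := by
    unfold SegFamily.flip
    convert hR.shift (hR.stepB (hR.shift_snd h (-1)) (by push_cast; linarith)
      (by push_cast; linarith) (by push_cast; linarith) (by push_cast; linarith)) 1 1 using 1 <;>
      push_cast <;> linarith [P.t_mul]

lemma SegClosed.crosses_of_flip (hR : SegClosed P R) (h : Crosses η (R.flip η)) :
    Crosses η R := by
  obtain ⟨y₀, y₁, h₀, h₀₁, h₁, hmem⟩ := h
  exact ⟨1 - η - y₁, 1 - η - y₀, by linarith, by linarith, by linarith,
    by simpa using hR.symm hmem⟩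

end SegClosed

/-! ### Segments crossing the unstable direction at the corner of the square -/

/-- The segment belongs to the family, lies over `[0, 1 - η]`, has slope at least one, and its end
points lie strictly on either side of the line `y = μ s`. -/
structure Straddles {η : ℝ} (P : ConeData η) (R : SegFamily) (y s y' s' : ℝ) : Prop where
  nonneg : 0 ≤ y
  lt : y < y'
  le : y' ≤ 1 - η
  slope : y' - y ≤ s' - s
  neg : P.μ * s - y < 0
  pos : 0 < P.μ * s' - y'
  mem : R y s y' s'

/-- The segment lies in the strip `0 ≤ s ≤ 1 - η`, and each of its end points lies on the boundary
of the strip or `δ`-far, on the expected side, from the line `y = μ s`. -/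
structure StretchedBy {η : ℝ} (P : ConeData η) (δ y s y' s' : ℝ) : Prop where
  nonneg : 0 ≤ s
  le : s' ≤ 1 - η
  low : s = 0 ∨ P.μ * s - y ≤ -δ
  high : s' = 1 - η ∨ δ ≤ P.μ * s' - y'

namespace Straddles

variable {η : ℝ} {P : ConeData η} {R : SegFamily} {y s y' s' δ : ℝ}

lemma clip_low (hR : SegClosed P R) (h : Straddles P R y s y' s') :
    ∃ y₁ s₁, Straddles P R y₁ s₁ y' s' ∧ 0 ≤ s₁ ∧ (s₁ = 0 ∨ y₁ = y ∧ s₁ = s) := by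
  obtain ⟨h₀, hlt, hle, hslope, hneg, hpos, hmem⟩ := h
  rcases le_or_gt 0 s with hs | hs
  · exact ⟨y, s, ⟨h₀, hlt, hle, hslope, hneg, hpos, hmem⟩, hs, Or.inr ⟨rfl, rfl⟩⟩
  have hs' : 0 < s' := by
    by_contra! hs'
    nlinarith
  obtain ⟨u, hu₀, hu₁, hu⟩ := exists_add_mul_sub_eq hs.le hs'.le
  have hu_pos : 0 < u := hu₀.lt_of_ne (by rintro rfl; linarith)
  have hu_lt : u < 1 := hu₁.lt_of_ne (by rintro rfl; linarith)
  refine ⟨y + u * (y' - y), 0, ⟨?_, ?_, hle, ?_, ?_, hpos, ?_⟩, le_rfl, Or.inl rfl⟩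
  · nlinarith
  · nlinarith
  · nlinarith
  · nlinarith
  · simpa [hu] using hR.sub hmem hu₀ hu₁ zero_le_one le_rfl

lemma clip_high (hR : SegClosed P R) (h : Straddles P R y s y' s') :
    ∃ y₁ s₁, Straddles P R y s y₁ s₁ ∧ s₁ ≤ 1 - η ∧ (s₁ = 1 - η ∨ y₁ = y' ∧ s₁ = s') := by
  obtain ⟨h₀, hlt, hle, hslope, hneg, hpos, hmem⟩ := h
  rcases le_or_gt s' (1 - η) with hs' | hs'
  · exact ⟨y', s', ⟨h₀, hlt, hle, hslope, hneg, hpos, hmem⟩, hs', Or.inr ⟨rfl, rfl⟩⟩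
  have hμ := P.one_lt_μ
  have hs : s < 1 - η := by
    by_contra! hs
    nlinarith
  obtain ⟨u, hu₀, hu₁, hu⟩ := exists_add_mul_sub_eq hs.le hs'.le
  have hu_pos : 0 < u := hu₀.lt_of_ne (by rintro rfl; linarith)
  have hu_lt : u < 1 := hu₁.lt_of_ne (by rintro rfl; linarith)
  have hy_lt : y + u * (y' - y) < y' := by nlinarith
  refine ⟨y + u * (y' - y), 1 - η, ⟨h₀, ?_, by linarith, ?_, hneg, ?_, ?_⟩, le_rfl, Or.inl rfl⟩
  · nlinarith
  · nlinarith
  · nlinarith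
  · simpa [hu] using hR.sub hmem le_rfl zero_le_one hu₀ hu₁

lemma clip (hR : SegClosed P R) (h : Straddles P R y s y' s') :
    ∃ y₁ s₁ y₂ s₂, Straddles P R y₁ s₁ y₂ s₂ ∧ 0 ≤ s₁ ∧ s₂ ≤ 1 - η ∧
      (s₁ = 0 ∨ y₁ = y ∧ s₁ = s) ∧ (s₂ = 1 - η ∨ y₂ = y' ∧ s₂ = s') := by
  obtain ⟨y₁, s₁, hlow, hs₁, hend₁⟩ := h.clip_low hR
  obtain ⟨y₂, s₂, hhigh, hs₂, hend₂⟩ := hlow.clip_high hR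
  exact ⟨y₁, s₁, y₂, s₂, hhigh, hs₁, hs₂, hend₁, hend₂⟩

lemma exists_stretchedBy (hR : SegClosed P R) (h : Straddles P R y s y' s')
    (hlow : P.μ * s - y ≤ -δ) (hhigh : δ ≤ P.μ * s' - y') :
    ∃ y₁ s₁ y₂ s₂, Straddles P R y₁ s₁ y₂ s₂ ∧ StretchedBy P δ y₁ s₁ y₂ s₂ := by
  obtain ⟨y₁, s₁, y₂, s₂, hS, hs₁, hs₂, hend₁, hend₂⟩ := h.clip hR
  refine ⟨y₁, s₁, y₂, s₂, hS, hs₁, hs₂, hend₁.imp_right ?_, hend₂.imp_right ?_⟩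
  · rintro ⟨rfl, rfl⟩
    exact hlow
  · rintro ⟨rfl, rfl⟩
    exact hhigh

end Straddles

lemma ConeData.μ_mul_stepA_sub {η : ℝ} (P : ConeData η) (y s : ℝ) :
    P.μ * ((2 + P.a) * s - y) - s = P.μ * (P.μ * s - y) := by
  linear_combination (-s) * P.μ_eq

namespace Straddles

variable {η : ℝ} {P : ConeData η} {R : SegFamily} {y s y' s' δ : ℝ}

lemma stepA (hR : SegClosed P R) (h : Straddles P R y s y' s') (hs : 0 ≤ s)
    (hs' : s' ≤ 1 - η) : Straddles P R s ((2 + P.a) * s - y) s' ((2 + P.a) * s' - y') := by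
  have ha := P.one_lt_a
  have hμ := P.one_lt_μ
  obtain ⟨-, hlt, -, hslope, hneg, hpos, hmem⟩ := h
  refine ⟨hs, by linarith, hs', ?_, ?_, ?_, hR.stepA hmem hs (by linarith) (by linarith) hs'⟩
  · nlinarith
  · rw [P.μ_mul_stepA_sub]
    nlinarith
  · rw [P.μ_mul_stepA_sub]
    nlinarith

lemma exists_stretchedBy_mul (hR : SegClosed P R) (h : Straddles P R y s y' s')
    (hδ : StretchedBy P δ y s y' s') :
    ∃ y₁ s₁ y₂ s₂, Straddles P R y₁ s₁ y₂ s₂ ∧ StretchedBy P (P.μ * δ) y₁ s₁ y₂ s₂ := by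
  have hμ := P.one_lt_μ
  obtain ⟨y₁, s₁, y₂, s₂, hS, hs₁, hs₂, hend₁, hend₂⟩ := (h.stepA hR hδ.nonneg hδ.le).clip hR
  refine ⟨y₁, s₁, y₂, s₂, hS, hs₁, hs₂, ?_, ?_⟩
  · refine hend₁.imp_right ?_
    rintro ⟨rfl, rfl⟩
    rcases hδ.low with rfl | hlow
    · linarith [h.neg]
    · rw [P.μ_mul_stepA_sub]
      nlinarith
  · refine hend₂.imp_right ?_
    rintro ⟨rfl, rfl⟩
    rcases hδ.high with rfl | hhigh
    · linarith [h.le, P.a_mul]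
    · rw [P.μ_mul_stepA_sub]
      nlinarith

lemma exists_stretchedBy_pow (hR : SegClosed P R) (h : Straddles P R y s y' s')
    (hlow : P.μ * s - y ≤ -δ) (hhigh : δ ≤ P.μ * s' - y') (n : ℕ) :
    ∃ y₁ s₁ y₂ s₂, Straddles P R y₁ s₁ y₂ s₂ ∧ StretchedBy P (P.μ ^ n * δ) y₁ s₁ y₂ s₂ := by
  induction n with
  | zero => simpa using h.exists_stretchedBy hR hlow hhigh
  | succ n ih =>
    obtain ⟨y₁, s₁, y₂, s₂, hS, hδ⟩ := ih
    simpa [pow_succ', mul_assoc] using hS.exists_stretchedBy_mul hR hδ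

/- The fixed point at the corner is hyperbolic with unstable eigenvalue `μ`, so the distances of the
end points from its stable line `y = μ s` grow until both ends reach the sides of the square. -/
lemma crosses (hR : SegClosed P R) (h : Straddles P R y s y' s') : Crosses η R := by
  have hμ := P.one_lt_μ
  have hη := P.lt
  set δ := min (y - P.μ * s) (P.μ * s' - y')
  have hδ : 0 < δ := lt_min (by linarith [h.neg]) h.pos
  obtain ⟨n, hn⟩ := pow_unbounded_of_one_lt (P.μ * (1 - η) / δ) hμ
  rw [div_lt_iff₀ hδ] at hn
  obtain ⟨y₁, s₁, y₂, s₂, hS, hstr⟩ := h.exists_stretchedBy_pow hR (δ := δ)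
    (by linarith [min_le_left (y - P.μ * s) (P.μ * s' - y')]) (min_le_right _ _) n
  have hs₁ : s₁ = 0 := hstr.low.resolve_right fun hlow => by
    nlinarith [hS.lt, hS.le, hstr.nonneg]
  have hs₂ : s₂ = 1 - η := hstr.high.resolve_right fun hhigh => by
    nlinarith [hS.nonneg, hS.lt, hstr.le]
  subst hs₁ hs₂
  exact ⟨y₁, y₂, hS.nonneg, hS.lt.le, hS.le, hS.mem⟩

end Straddles

/-! ### Segments traversing the region of return time three or the singular strip -/

section Traverse

variable {η : ℝ} {P : ConeData η} {R : SegFamily}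

lemma crosses_of_join_BB_sides_of_mul_lt_one (hR : SegClosed P R) {σ₀ σ₁ : ℝ} (h₀ : 0 ≤ σ₁)
    (h₀₁ : σ₁ ≤ σ₀) (h₁ : σ₀ ≤ η) (hlen : P.t * (σ₀ - σ₁) < η) (hμσ : P.μ * σ₀ < 1)
    (h : R (P.t * σ₀) (-σ₀) (P.t * σ₁ + η) (-σ₁)) : Crosses η R := by
  have hη := P.lt
  have hμ := P.lt_μ
  have ht := P.t_mul
  have ht₁ := P.lt_t
  have ha₁ := P.one_lt_a
  have ha₂ := P.a_lt
  have hBB := hR.stepB (hR.stepB h (by linarith) (by linarith) (by linarith) (by linarith))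
    (by linarith) (by linarith) (by linarith) (by linarith)
  have hfst : -P.t * (-P.t * -σ₀ - P.t * σ₀) - -σ₀ = σ₀ := by ring
  have hfst' : -P.t * (-P.t * -σ₁ - (P.t * σ₁ + η)) - -σ₁ = 1 - 2 * η + σ₁ := by
    linear_combination ht
  rw [hfst, hfst'] at hBB
  have hBBA := hR.shift_snd
    (hR.stepA hBB (by linarith) (by linarith) (by linarith) (by linarith)) (-1)
  refine Straddles.crosses hR ⟨by linarith, by linarith, by linarith, ?_, ?_, ?_, hBBA⟩
  · push_cast
    nlinarith
  · calc P.μ * ((2 + P.a) * σ₀ - (-P.t * -σ₀ - P.t * σ₀) + ((-1 : ℤ) : ℝ)) - σ₀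
        = P.μ * (P.μ * σ₀ - 1) := by
          push_cast
          linear_combination (-σ₀) * P.μ_eq
      _ < 0 := by nlinarith
  · have hsnd : 0.5 ≤ (2 + P.a) * (1 - 2 * η + σ₁) - (-P.t * -σ₁ - (P.t * σ₁ + η)) + -1 := by
      nlinarith [P.pos, P.a_mul]
    push_cast
    nlinarith

lemma crosses_of_join_BB_sides (hR : SegClosed P R) {σ₀ σ₁ : ℝ} (h₀ : 0 ≤ σ₁) (h₀₁ : σ₁ ≤ σ₀)
    (h₁ : σ₀ ≤ η) (hlen : P.t * (σ₀ - σ₁) < η)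
    (h : R (P.t * σ₀) (-σ₀) (P.t * σ₁ + η) (-σ₁)) : Crosses η R := by
  have hη := P.lt
  have ht := P.lt_t
  rcases lt_or_ge (P.μ * σ₀) 1 with hμσ | hμσ
  · exact crosses_of_join_BB_sides_of_mul_lt_one hR h₀ h₀₁ h₁ hlen hμσ h
  refine hR.crosses_of_flip (crosses_of_join_BB_sides_of_mul_lt_one hR.flip
    (σ₀ := η - σ₁) (σ₁ := η - σ₀) (by linarith) (by linarith) (by linarith) (by linarith) ?_ ?_)
  · nlinarith [P.lt_μ, P.μ_lt]
  · unfold SegFamily.flip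
    convert hR.shift_snd (hR.symm h) 1 using 1 <;> push_cast <;> linarith [P.t_mul]

lemma crosses_of_traverse_BB (hR : SegClosed P R) {y s y' s' : ℝ} (hs : -η ≤ s) (hss : s < s')
    (hs' : s' ≤ 0) (hy : y < y') (hlow : y + P.t * s ≤ 0) (hhigh : η ≤ y' + P.t * s')
    (h : R y s y' s') : Crosses η R := by
  have hη := P.pos
  obtain ⟨u, hu₀, hu₁, hu⟩ := exists_add_mul_sub_eq hlow (hη.le.trans hhigh)
  obtain ⟨v, hv₀, hv₁, hv⟩ := exists_add_mul_sub_eq (hlow.trans hη.le) hhigh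
  have huv : u < v := by
    by_contra! hvu
    nlinarith
  have hsub := hR.sub h hu₀ hu₁ hv₀ hv₁
  refine crosses_of_join_BB_sides hR (σ₀ := -(s + u * (s' - s))) (σ₁ := -(s + v * (s' - s)))
    ?_ ?_ ?_ ?_ ?_
  · nlinarith
  · nlinarith
  · nlinarith
  · calc P.t * (-(s + u * (s' - s)) - -(s + v * (s' - s)))
        = η - (v - u) * (y' - y) := by linear_combination hv - hu
      _ < η := by nlinarith
  · convert hsub using 1
    · linear_combination -hu
    · ring
    · linear_combination -hv
    · ring

lemma exists_subsegment_of_traverse_strip (hR : SegClosed P R) {y₀ y₁ : ℝ} (h₀ : 0 ≤ y₀)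
    (hlen : η ≤ 10 * (y₁ - y₀)) (h₁ : y₁ ≤ η) (h : R y₀ (-η) y₁ 0) :
    ∃ σ, 0 ≤ σ ∧ σ ≤ η ∧ P.t * σ ≤ η ∧ R y₀ (-η) (P.t * σ) (-σ) := by
  have hη := P.pos
  have hη₁ := P.lt
  have ht := P.t_mul
  obtain ⟨v, hv₀, hv₁, hv⟩ := exists_add_mul_sub_eq (p := y₀ - P.t * η) (q := y₁) (c := 0)
    (by linarith) (by linarith)
  have hend : y₀ + v * (y₁ - y₀) = P.t * (η - v * η) := by linear_combination hv
  refine ⟨η - v * η, by nlinarith, by nlinarith, by rw [← hend]; nlinarith, ?_⟩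
  convert hR.sub h le_rfl zero_le_one hv₀ hv₁ using 1
  · ring
  · ring
  · exact hend.symm
  · ring

/- The left side is a quadratic in `μ`; its discriminant is negative. -/
lemma ConeData.quadratic_pos (P : ConeData η) {Y : ℝ} (hY : 1 - 3 * η + η / 10 ≤ Y) :
    0 < P.μ ^ 2 * Y - P.μ * (1 - 2 * η) + (1 - η) := by
  have hη := P.pos
  have hη₁ := P.lt
  have hdisc : (1 - 2 * η) ^ 2 < 4 * Y * (1 - η) :=
    calc (1 - 2 * η) ^ 2 < 4 * (1 - 3 * η + η / 10) * (1 - η) := by nlinarith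
      _ ≤ 4 * Y * (1 - η) := mul_le_mul_of_nonneg_right (by linarith) (by linarith)
  refine (mul_pos_iff_of_pos_left (show 0 < 4 * Y by linarith)).1 ?_
  calc 0 < (2 * Y * P.μ - (1 - 2 * η)) ^ 2 + (4 * Y * (1 - η) - (1 - 2 * η) ^ 2) := by
        linarith [sq_nonneg (2 * Y * P.μ - (1 - 2 * η))]
    _ = 4 * Y * (P.μ ^ 2 * Y - P.μ * (1 - 2 * η) + (1 - η)) := by ring

lemma crosses_of_traverse_strip_of_le (hR : SegClosed P R) {y₀ y₁ : ℝ} (h₀ : 0 ≤ y₀)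
    (hlen : η ≤ 10 * (y₁ - y₀)) (h₁ : y₁ ≤ η) (h : R y₀ (-η) y₁ 0) : Crosses η R := by
  have hη := P.pos
  have hη₁ := P.lt
  have ht := P.t_mul
  have ha := P.one_lt_a
  obtain ⟨σ, hσ₀, hσ₁, hσ₂, hsub⟩ := exists_subsegment_of_traverse_strip hR h₀ hlen h₁ h
  have hσ : σ ≤ 0.301 := by nlinarith [P.lt_t]
  have hB := hR.stepB hsub (by linarith) (by linarith) (by linarith) (by linarith)
  obtain ⟨Y, hY⟩ : ∃ Y, -P.t * -η - y₀ = Y := ⟨_, rfl⟩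
  rw [hY, show -P.t * -σ - P.t * σ = 0 by ring] at hB
  have hY₁ : 1 - 3 * η + η / 10 ≤ Y := by linarith
  have hBA := hR.stepA hB (by linarith) (by linarith) (by linarith) (by linarith)
  refine hR.crosses_of_flip (Straddles.crosses hR.flip
    (y := 1 - η - Y) (s := 1 - η - ((2 + P.a) * Y - -η))
    (y' := 1 - η - 0) (s' := 1 - η - ((2 + P.a) * 0 - -σ))
    ⟨by linarith, by linarith, by linarith, ?_, ?_, ?_, ?_⟩)
  · linarith [mul_pos (show 0 < P.a by linarith) (show 0 < Y by linarith)]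
  · calc P.μ * (1 - η - ((2 + P.a) * Y - -η)) - (1 - η - Y)
        = -(P.μ ^ 2 * Y - P.μ * (1 - 2 * η) + (1 - η)) := by linear_combination Y * P.μ_eq
      _ < 0 := neg_lt_zero.2 (P.quadratic_pos hY₁)
  · linarith [mul_le_mul_of_nonneg_right P.lt_μ.le (show 0 ≤ 1 - η - σ by linarith)]
  · simpa [SegFamily.flip] using hBA

lemma crosses_of_traverse_strip (hR : SegClosed P R) {y₀ y₁ : ℝ} (h₀ : 0 ≤ y₀)
    (hlen : η ≤ 10 * (y₁ - y₀)) (h₁ : y₁ ≤ 1 - η) (h : R y₀ (-η) y₁ 0) : Crosses η R := by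
  have hη := P.pos
  have ht := P.t_mul
  rcases le_or_gt y₁ η with hy₁ | hy₁
  · exact crosses_of_traverse_strip_of_le hR h₀ hlen hy₁ h
  rcases le_or_gt (1 - 2 * η) y₀ with hy₀ | hy₀
  · refine hR.crosses_of_flip (crosses_of_traverse_strip_of_le hR.flip
      (y₀ := 1 - η - y₁) (y₁ := 1 - η - y₀) (by linarith) (by linarith) (by linarith) ?_)
    unfold SegFamily.flip
    convert hR.shift_snd (hR.symm h) 1 using 1 <;> push_cast <;> linarith
  · exact crosses_of_traverse_BB hR le_rfl (by linarith) le_rfl (by linarith) (by linarith)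
      (by linarith) h

end Traverse

/-! ### Growth of segments in the cone -/

namespace ConeData

variable {η ρ : ℝ} (P : ConeData η)

lemma sq_t_sub_one_pos : 0 < P.t ^ 2 - 1 := by
  nlinarith [P.lt_t]

lemma slopeA_mem_Icc (hρ : P.μ ≤ ρ) : 2 + P.a - 1 / ρ ∈ Icc P.μ P.r := by
  have hμ := P.one_lt_μ
  have hfix : P.μ = 2 + P.a - 1 / P.μ := by
    field_simp
    linarith [P.μ_eq]
  have hle : 1 / ρ ≤ 1 / P.μ := one_div_le_one_div_of_le (by linarith) hρ
  have hpos : 0 < 1 / ρ := one_div_pos.2 (by linarith)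
  constructor <;> linarith [P.lt_r]

lemma slopeAB_mem_Icc (hρ : P.μ ≤ ρ) (hρ' : ρ ≤ P.r) :
    2 + P.a + ρ / (P.t * ρ + 1) ∈ Icc P.μ P.r := by
  have ht := P.lt_t
  have ht₂ := P.sq_t_sub_one_pos
  have hρ₀ : 0 < ρ := by linarith [P.one_lt_μ]
  have hr₀ : 0 < P.r := hρ₀.trans_le hρ'
  have hden : 0 < (P.t ^ 2 - 1) * P.r + P.t := by positivity
  have hle : ρ / (P.t * ρ + 1) ≤ P.r - (2 + P.a) := by
    rw [div_le_iff₀ (by positivity)]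
    refine le_of_mul_le_mul_right ?_ hden
    calc ρ * ((P.t ^ 2 - 1) * P.r + P.t) ≤ (P.t * P.r + 1) * (P.t * ρ + 1) := by nlinarith
      _ = (P.r - (2 + P.a)) * (P.t * ρ + 1) * ((P.t ^ 2 - 1) * P.r + P.t) := by
        rw [← P.r_eq]
        ring
  have hpos : 0 < ρ / (P.t * ρ + 1) := by positivity
  have hinv : 0 < 1 / ρ := one_div_pos.2 hρ₀
  exact ⟨by linarith [(P.slopeA_mem_Icc hρ).1], by linarith⟩

lemma slopeABB_mem_Icc (hρ : P.μ ≤ ρ) (hρ' : ρ ≤ P.r) :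
    2 + P.a + (P.t * ρ + 1) / ((P.t ^ 2 - 1) * ρ + P.t) ∈ Icc P.μ P.r := by
  have ht := P.lt_t
  have ht₂ := P.sq_t_sub_one_pos
  have hρ₀ : 0 < ρ := by linarith [P.one_lt_μ]
  have hr₀ : 0 < P.r := hρ₀.trans_le hρ'
  have hden : 0 < (P.t ^ 2 - 1) * P.r + P.t := by positivity
  have hle : (P.t * ρ + 1) / ((P.t ^ 2 - 1) * ρ + P.t) ≤ P.r - (2 + P.a) := by
    rw [div_le_iff₀ (by positivity)]
    refine le_of_mul_le_mul_right ?_ hden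
    calc (P.t * ρ + 1) * ((P.t ^ 2 - 1) * P.r + P.t)
        ≤ (P.t * P.r + 1) * ((P.t ^ 2 - 1) * ρ + P.t) := by nlinarith
      _ = (P.r - (2 + P.a)) * ((P.t ^ 2 - 1) * ρ + P.t) * ((P.t ^ 2 - 1) * P.r + P.t) := by
        rw [← P.r_eq]
        ring
  have hpos : 0 < (P.t * ρ + 1) / ((P.t ^ 2 - 1) * ρ + P.t) := by positivity
  have hinv : 0 < 1 / ρ := one_div_pos.2 hρ₀
  exact ⟨by linarith [(P.slopeA_mem_Icc hρ).1], by linarith⟩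

lemma κ_mul_sub_one_le (hρ : ρ ≤ P.r) : P.κ * (ρ - 1) ≤ 1 := by
  have hle := mul_le_mul_of_nonneg_left (show ρ - 1 ≤ P.r - 1 by linarith) P.κ_pos.le
  rwa [P.κ_mul] at hle

lemma rateA_mul_le (hρ : ρ ≤ P.r) : P.rateA * (ρ - 1) ≤ (1 + P.a) * ρ - 1 := by
  have ha := P.one_lt_a
  unfold rateA
  nlinarith [mul_le_mul_of_nonneg_left (P.κ_mul_sub_one_le hρ) (by linarith : 0 ≤ P.a)]

lemma rateAB_mul_le (hρ : ρ ≤ P.r) :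
    P.rateAB * (ρ - 1) ≤ (1 + P.a) * (1 + P.t * ρ) + ρ := by
  have ha := P.one_lt_a
  have ht := P.lt_t
  unfold rateAB
  have hcoef : 0 ≤ (1 + P.a) * (1 + P.t) + 1 := by positivity
  linarith [mul_le_mul_of_nonneg_left (P.κ_mul_sub_one_le hρ) hcoef]

lemma rateABB_coeff_pos : 0 < (1 + P.a) * P.t ^ 2 + (2 + P.a) * P.t - P.a := by
  nlinarith [P.one_lt_a, P.lt_t]

lemma rateABB_mul_le (hρ : ρ ≤ P.r) :
    P.rateABB * (ρ - 1) ≤ (1 + P.a) * ((P.t ^ 2 - 1) * ρ + P.t) + 1 + P.t * ρ := by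
  unfold rateABB
  linarith [mul_le_mul_of_nonneg_left (P.κ_mul_sub_one_le hρ) P.rateABB_coeff_pos.le]

lemma rateA_pos : 0 < P.rateA := by
  have ha := P.one_lt_a
  have hκ := P.κ_pos
  unfold rateA
  positivity

lemma rateAB_pos : 0 < P.rateAB := by
  have ha := P.one_lt_a
  have hκ := P.κ_pos
  have ht := P.lt_t
  unfold rateAB
  positivity

lemma rateABB_pos : 0 < P.rateABB := by
  have ha := P.one_lt_a
  have hκ := P.κ_pos
  have ht₂ := P.sq_t_sub_one_pos
  have hcoef := P.rateABB_coeff_pos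
  have hconst : 0 < P.t ^ 2 + P.t - 1 := by linarith [P.lt_t]
  unfold rateABB
  positivity

end ConeData

/-- The segment from `(y, s)` to `(y + d, s + ρ d)` belongs to the family, lies over `[0, 1 - η]`,
and its slope `ρ` is in the invariant cone. -/
structure ConeSegment {η : ℝ} (P : ConeData η) (R : SegFamily) (y s d ρ : ℝ) : Prop where
  width_nonneg : 0 ≤ d
  μ_le : P.μ ≤ ρ
  le_r : ρ ≤ P.r
  nonneg : 0 ≤ y
  le : y + d ≤ 1 - η
  mem : R y s (y + d) (s + ρ * d)

/-- A cone segment in the singular strip `-η ≤ s ≤ 0`. -/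
structure StripSegment {η : ℝ} (P : ConeData η) (R : SegFamily) (y s d ρ : ℝ) : Prop
    extends ConeSegment P R y s d ρ where
  le_low : -η ≤ s
  high_le : s + ρ * d ≤ 0

/-- The family contains a cone segment of horizontal extent at least `L`. The horizontal coordinate
being `s - y` up to sign, the extent of a cone segment is `(ρ - 1) d`. -/
def HasLength {η : ℝ} (P : ConeData η) (R : SegFamily) (L : ℝ) : Prop :=
  ∃ y s d ρ, ConeSegment P R y s d ρ ∧ L ≤ (ρ - 1) * d

section Growth

variable {η : ℝ} {P : ConeData η} {R : SegFamily} {y s d ρ : ℝ}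

lemma HasLength.mono {L L' : ℝ} (h : HasLength P R L) (hL : L' ≤ L) : HasLength P R L' := by
  obtain ⟨y, s, d, ρ, hseg, hlen⟩ := h
  exact ⟨y, s, d, ρ, hseg, hL.trans hlen⟩

namespace ConeSegment

lemma ρ_pos (h : ConeSegment P R y s d ρ) : 0 < ρ := by
  linarith [P.one_lt_μ, h.μ_le]

lemma hasLength_zero (h : ConeSegment P R y s d ρ) : HasLength P R 0 :=
  ⟨y, s, d, ρ, h, mul_nonneg (by linarith [P.one_lt_μ, h.μ_le]) h.width_nonneg⟩

lemma shift_snd (hR : SegClosed P R) (h : ConeSegment P R y s d ρ) (n : ℤ) :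
    ConeSegment P R y (s + n) d ρ where
  __ := h
  mem := by
    convert hR.shift_snd h.mem n using 1
    ring

lemma sub (hR : SegClosed P R) (h : ConeSegment P R y s d ρ) {u v : ℝ} (hu : 0 ≤ u)
    (huv : u ≤ v) (hv : v ≤ d) : ConeSegment P R (y + u) (s + ρ * u) (v - u) ρ where
  __ := h
  width_nonneg := sub_nonneg.2 huv
  nonneg := add_nonneg h.nonneg hu
  le := by linarith [h.le]
  mem := by
    convert hR.sub_dir h.mem hu (huv.trans hv) (hu.trans huv) hv using 1 <;> ring

lemma left (hR : SegClosed P R) (h : ConeSegment P R y s d ρ) {w : ℝ} (hw : 0 ≤ w)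
    (hwd : w ≤ d) : ConeSegment P R y s w ρ := by
  simpa using h.sub hR le_rfl hw hwd

lemma right (hR : SegClosed P R) (h : ConeSegment P R y s d ρ) {w : ℝ} (hw : 0 ≤ w)
    (hwd : w ≤ d) : ConeSegment P R (y + w) (s + ρ * w) (d - w) ρ :=
  h.sub hR hw hwd le_rfl

lemma hasLength_of_A (hR : SegClosed P R) (h : ConeSegment P R y s d ρ) (hs : 0 ≤ s)
    (hs' : s + ρ * d ≤ 1 - η) : HasLength P R (P.rateA * ((ρ - 1) * d)) := by
  have hρ := h.ρ_pos
  have hρd : 0 ≤ ρ * d := mul_nonneg hρ.le h.width_nonneg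
  have hslope := P.slopeA_mem_Icc h.μ_le
  refine ⟨s, (2 + P.a) * s - y, ρ * d, 2 + P.a - 1 / ρ,
    ⟨hρd, hslope.1, hslope.2, hs, hs', ?_⟩, ?_⟩
  · convert hR.stepA h.mem hs (by linarith) (by linarith) hs' using 1
    field_simp
    ring
  · calc P.rateA * ((ρ - 1) * d) = P.rateA * (ρ - 1) * d := by ring
      _ ≤ ((1 + P.a) * ρ - 1) * d :=
        mul_le_mul_of_nonneg_right (P.rateA_mul_le h.le_r) h.width_nonneg
      _ = (2 + P.a - 1 / ρ - 1) * (ρ * d) := by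
        field_simp
        ring

end ConeSegment

namespace StripSegment

lemma sub (hR : SegClosed P R) (h : StripSegment P R y s d ρ) {u v : ℝ} (hu : 0 ≤ u)
    (huv : u ≤ v) (hv : v ≤ d) : StripSegment P R (y + u) (s + ρ * u) (v - u) ρ where
  __ := h.toConeSegment.sub hR hu huv hv
  le_low := by linarith [h.le_low, mul_nonneg h.ρ_pos.le hu]
  high_le := by linarith [h.high_le, mul_le_mul_of_nonneg_left hv h.ρ_pos.le]

lemma left (hR : SegClosed P R) (h : StripSegment P R y s d ρ) {w : ℝ} (hw : 0 ≤ w)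
    (hwd : w ≤ d) : StripSegment P R y s w ρ := by
  simpa using h.sub hR le_rfl hw hwd

lemma right (hR : SegClosed P R) (h : StripSegment P R y s d ρ) {w : ℝ} (hw : 0 ≤ w)
    (hwd : w ≤ d) : StripSegment P R (y + w) (s + ρ * w) (d - w) ρ :=
  h.sub hR hw hwd le_rfl

lemma hasLength_of_AB (hR : SegClosed P R) (h : StripSegment P R y s d ρ) (k : ℤ)
    (hk : 0 ≤ k - (y + d + P.t * (s + ρ * d))) (hk' : k - (y + P.t * s) ≤ 1 - η) :
    HasLength P R (P.rateAB * ((ρ - 1) * d)) := by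
  have ht := P.lt_t
  have hd := h.width_nonneg
  have hρ := h.ρ_pos
  have hρd : 0 ≤ ρ * d := by positivity
  have htd : 0 ≤ P.t * (ρ * d) := by positivity
  have hslope := P.slopeAB_mem_Icc h.μ_le h.le_r
  have hB := hR.shift_snd (hR.stepB h.mem h.le_low (by linarith [h.high_le])
    (by linarith [h.le_low]) h.high_le) k
  have hBA := hR.symm (hR.stepA hB (by linarith) (by linarith) (by linarith) (by linarith))
  refine ⟨k - (y + d + P.t * (s + ρ * d)),
    (2 + P.a) * (k - (y + d + P.t * (s + ρ * d))) - (s + ρ * d), (1 + P.t * ρ) * d,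
    2 + P.a + ρ / (P.t * ρ + 1), ⟨by positivity, hslope.1, hslope.2, hk, by linarith, ?_⟩, ?_⟩
  · convert hBA using 1
    · ring
    · ring
    · ring
    · field_simp
      ring
  · calc P.rateAB * ((ρ - 1) * d) = P.rateAB * (ρ - 1) * d := by ring
      _ ≤ ((1 + P.a) * (1 + P.t * ρ) + ρ) * d :=
        mul_le_mul_of_nonneg_right (P.rateAB_mul_le h.le_r) hd
      _ = (2 + P.a + ρ / (P.t * ρ + 1) - 1) * ((1 + P.t * ρ) * d) := by
        field_simp
        ring

lemma t_mul_le (h : StripSegment P R y s d ρ) :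
    P.t * -η ≤ P.t * s ∧ P.t * s ≤ P.t * (s + ρ * d) ∧ P.t * (s + ρ * d) ≤ 0 := by
  have ht : 0 ≤ P.t := by linarith [P.lt_t]
  have hρd := mul_nonneg h.ρ_pos.le h.width_nonneg
  exact ⟨mul_le_mul_of_nonneg_left h.le_low ht, mul_le_mul_of_nonneg_left (by linarith) ht,
    mul_nonpos_of_nonneg_of_nonpos ht h.high_le⟩

lemma hasLength_of_AB_low (hR : SegClosed P R) (h : StripSegment P R y s d ρ)
    (hlow : y + d + P.t * (s + ρ * d) ≤ 0) : HasLength P R (P.rateAB * ((ρ - 1) * d)) := by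
  refine h.hasLength_of_AB hR 0 ?_ ?_ <;> push_cast <;>
    linarith [h.t_mul_le.1, P.t_mul, h.nonneg, P.pos]

lemma hasLength_of_AB_high (hR : SegClosed P R) (h : StripSegment P R y s d ρ)
    (hhigh : η ≤ y + P.t * s) : HasLength P R (P.rateAB * ((ρ - 1) * d)) := by
  refine h.hasLength_of_AB hR 1 ?_ ?_ <;> push_cast <;>
    linarith [h.t_mul_le.2.2, h.le, P.pos]

lemma mem_ABB (hR : SegClosed P R) (h : StripSegment P R y s d ρ) {c c' : ℝ}
    (hc : y + P.t * s = c) (hc' : y + d + P.t * (s + ρ * d) = c') (h₀ : 0 ≤ c) (h₁ : c' ≤ η) :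
    R (P.t * c - s) ((2 + P.a) * (P.t * c - s) + c) (P.t * c' - (s + ρ * d))
        ((2 + P.a) * (P.t * c' - (s + ρ * d)) + c') ∧
      0 ≤ P.t * c - s ∧ P.t * c' - (s + ρ * d) ≤ 1 - η := by
  have ht := P.lt_t
  have hη := P.t_mul
  have hlow := h.le_low
  have hhigh := h.high_le
  have hd := h.width_nonneg
  have hρd : 0 ≤ ρ * d := mul_nonneg h.ρ_pos.le hd
  have hcc : c ≤ c' := by linarith [h.t_mul_le.2.1]
  have htc : 0 ≤ P.t * c := mul_nonneg (by linarith) h₀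
  have htc' : P.t * c' ≤ P.t * η := mul_le_mul_of_nonneg_left h₁ (by linarith)
  have htcc : P.t * c ≤ P.t * c' := mul_le_mul_of_nonneg_left hcc (by linarith)
  have hB := hR.stepB h.mem hlow (by linarith) (by linarith) hhigh
  rw [show -P.t * s - y = -c by linarith, show -P.t * (s + ρ * d) - (y + d) = -c' by linarith]
    at hB
  have hBB := hR.stepB hB (by linarith) (by linarith) (by linarith) (by linarith)
  have hBBA := hR.stepA hBB (by linarith) (by linarith) (by linarith) (by linarith)
  refine ⟨?_, by linarith, by linarith⟩
  convert hBBA using 1 <;> ring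

lemma hasLength_of_ABB (hR : SegClosed P R) (h : StripSegment P R y s d ρ)
    (h₀ : 0 ≤ y + P.t * s) (h₁ : y + d + P.t * (s + ρ * d) ≤ η) :
    HasLength P R (P.rateABB * ((ρ - 1) * d)) := by
  have ht := P.lt_t
  have ht₂ := P.sq_t_sub_one_pos
  have hd := h.width_nonneg
  have hρ := h.ρ_pos
  have hslope := P.slopeABB_mem_Icc h.μ_le h.le_r
  have hden : (P.t ^ 2 - 1) * ρ + P.t ≠ 0 := by positivity
  obtain ⟨hmem, hnonneg, hle⟩ := h.mem_ABB hR rfl rfl h₀ h₁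
  refine ⟨P.t * (y + P.t * s) - s, (2 + P.a) * (P.t * (y + P.t * s) - s) + (y + P.t * s),
    ((P.t ^ 2 - 1) * ρ + P.t) * d, 2 + P.a + (P.t * ρ + 1) / ((P.t ^ 2 - 1) * ρ + P.t),
    ⟨by positivity, hslope.1, hslope.2, hnonneg, by linarith, ?_⟩, ?_⟩
  · convert hmem using 1
    · ring
    · field_simp
      ring
  · calc P.rateABB * ((ρ - 1) * d) = P.rateABB * (ρ - 1) * d := by ring
      _ ≤ ((1 + P.a) * ((P.t ^ 2 - 1) * ρ + P.t) + 1 + P.t * ρ) * d :=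
        mul_le_mul_of_nonneg_right (P.rateABB_mul_le h.le_r) hd
      _ = (2 + P.a + (P.t * ρ + 1) / ((P.t ^ 2 - 1) * ρ + P.t) - 1) *
          (((P.t ^ 2 - 1) * ρ + P.t) * d) := by
        field_simp
        ring

lemma exists_cut (h : StripSegment P R y s d ρ) {e : ℝ} (he : y + P.t * s ≤ e)
    (he' : e ≤ y + d + P.t * (s + ρ * d)) :
    ∃ w, 0 ≤ w ∧ w ≤ d ∧ y + w + P.t * (s + ρ * w) = e := by
  obtain ⟨w, hw₀, hw, hwe⟩ := exists_add_mul_eq (m := 1 + P.t * ρ) h.width_nonneg he (by linarith)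
  exact ⟨w, hw₀, hw, by linarith⟩

lemma exists_hasLength_of_le (hR : SegClosed P R) (h : StripSegment P R y s d ρ)
    (hle : y + d + P.t * (s + ρ * d) ≤ η) :
    ∃ ℓ₂ ℓ₃, ℓ₂ + ℓ₃ = (ρ - 1) * d ∧ HasLength P R (P.rateAB * ℓ₂) ∧
      HasLength P R (P.rateABB * ℓ₃) := by
  rcases le_total (y + d + P.t * (s + ρ * d)) 0 with hlow | hlow
  · exact ⟨(ρ - 1) * d, 0, by ring, h.hasLength_of_AB_low hR hlow, by simpa using h.hasLength_zero⟩
  rcases le_total 0 (y + P.t * s) with hnonneg | hneg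
  · exact ⟨0, (ρ - 1) * d, by ring, by simpa using h.hasLength_zero,
      h.hasLength_of_ABB hR hnonneg hle⟩
  obtain ⟨w, hw₀, hw, hwe⟩ := h.exists_cut hneg hlow
  exact ⟨(ρ - 1) * w, (ρ - 1) * (d - w), by ring, (h.left hR hw₀ hw).hasLength_of_AB_low hR hwe.le,
    (h.right hR hw₀ hw).hasLength_of_ABB hR hwe.ge (by linarith)⟩

lemma exists_hasLength_of_nonneg (hR : SegClosed P R) (h : StripSegment P R y s d ρ)
    (hnonneg : 0 ≤ y + P.t * s) :
    ∃ ℓ₂ ℓ₃, ℓ₂ + ℓ₃ = (ρ - 1) * d ∧ HasLength P R (P.rateAB * ℓ₂) ∧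
      HasLength P R (P.rateABB * ℓ₃) := by
  rcases le_total (y + d + P.t * (s + ρ * d)) η with hle | hle
  · exact h.exists_hasLength_of_le hR hle
  rcases le_total η (y + P.t * s) with hhigh | hhigh
  · exact ⟨(ρ - 1) * d, 0, by ring, h.hasLength_of_AB_high hR hhigh,
      by simpa using h.hasLength_zero⟩
  obtain ⟨w, hw₀, hw, hwe⟩ := h.exists_cut hhigh hle
  exact ⟨(ρ - 1) * (d - w), (ρ - 1) * w, by ring,
    (h.right hR hw₀ hw).hasLength_of_AB_high hR (by linarith),
    (h.left hR hw₀ hw).hasLength_of_ABB hR hnonneg hwe.le⟩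

lemma exists_hasLength (hR : SegClosed P R) (hX : ¬ Crosses η R) (h : StripSegment P R y s d ρ) :
    ∃ ℓ₂ ℓ₃, ℓ₂ + ℓ₃ = (ρ - 1) * d ∧ HasLength P R (P.rateAB * ℓ₂) ∧
      HasLength P R (P.rateABB * ℓ₃) := by
  rcases le_total (y + d + P.t * (s + ρ * d)) η with hle | hle
  · exact h.exists_hasLength_of_le hR hle
  rcases le_total 0 (y + P.t * s) with hnonneg | hneg
  · exact h.exists_hasLength_of_nonneg hR hnonneg
  have hd : 0 < d := h.width_nonneg.lt_of_ne (by rintro rfl; linarith [P.pos])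
  exact absurd (crosses_of_traverse_BB hR h.le_low (by linarith [mul_pos h.ρ_pos hd]) h.high_le
    (by linarith) hneg hle h.mem) hX

end StripSegment

namespace ConeSegment

lemma exists_hasLength_of_neg (hR : SegClosed P R) (hX : ¬ Crosses η R)
    (h : ConeSegment P R y s d ρ) (hs : -η ≤ s) (hs₀ : s ≤ 0) :
    ∃ ℓ₁ ℓ₂ ℓ₃, ℓ₁ + ℓ₂ + ℓ₃ = (ρ - 1) * d ∧ HasLength P R (P.rateA * ℓ₁) ∧
      HasLength P R (P.rateAB * ℓ₂) ∧ HasLength P R (P.rateABB * ℓ₃) := by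
  rcases le_total (s + ρ * d) 0 with hs' | hs'
  · obtain ⟨ℓ₂, ℓ₃, hsum, h₂, h₃⟩ := StripSegment.exists_hasLength hR hX ⟨h, hs, hs'⟩
    exact ⟨0, ℓ₂, ℓ₃, by linarith, by simpa using h.hasLength_zero, h₂, h₃⟩
  obtain ⟨w, hw₀, hw, hwe⟩ := exists_add_mul_eq h.width_nonneg hs₀ hs'
  have htop : s + ρ * d ≤ 1 - η := by
    by_contra! htop
    obtain ⟨w', hw'₀, hw', hwe'⟩ :=
      exists_add_mul_eq h.width_nonneg (show s ≤ 1 - η by linarith [P.lt]) htop.le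
    have hww' : w ≤ w' := by
      by_contra! hlt
      linarith [mul_lt_mul_of_pos_left hlt h.ρ_pos, P.lt]
    have hsub := hR.sub_dir h.mem hw₀ hw hw'₀ hw'
    rw [hwe, hwe'] at hsub
    exact hX ⟨y + w, y + w', by linarith [h.nonneg], by linarith, by linarith [h.le], hsub⟩
  obtain ⟨ℓ₂, ℓ₃, hsum, h₂, h₃⟩ :=
    StripSegment.exists_hasLength hR hX ⟨h.left hR hw₀ hw, hs, hwe.le⟩
  exact ⟨(ρ - 1) * (d - w), ℓ₂, ℓ₃, by linarith,
    (h.right hR hw₀ hw).hasLength_of_A hR hwe.ge (by linarith), h₂, h₃⟩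

lemma exists_hasLength_of_nonneg (hR : SegClosed P R) (hX : ¬ Crosses η R)
    (h : ConeSegment P R y s d ρ) (hs : 0 ≤ s) (hs₁ : s ≤ 1 - η) :
    ∃ ℓ₁ ℓ₂ ℓ₃, ℓ₁ + ℓ₂ + ℓ₃ = (ρ - 1) * d ∧ HasLength P R (P.rateA * ℓ₁) ∧
      HasLength P R (P.rateAB * ℓ₂) ∧ HasLength P R (P.rateABB * ℓ₃) := by
  rcases le_total (s + ρ * d) (1 - η) with hs' | hs'
  · exact ⟨(ρ - 1) * d, 0, 0, by ring, h.hasLength_of_A hR hs hs',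
      by simpa using h.hasLength_zero, by simpa using h.hasLength_zero⟩
  obtain ⟨w, hw₀, hw, hwe⟩ := exists_add_mul_eq h.width_nonneg hs₁ hs'
  have htop : s + ρ * d ≤ 1 := by
    by_contra! htop
    obtain ⟨w', hw'₀, hw', hwe'⟩ :=
      exists_add_mul_eq h.width_nonneg (show s ≤ 1 by linarith [P.pos]) htop.le
    have hsub := hR.shift_snd (hR.sub_dir h.mem hw₀ hw hw'₀ hw') (-1)
    rw [hwe, hwe', show 1 - η + ((-1 : ℤ) : ℝ) = -η by push_cast; ring,
      show (1 : ℝ) + ((-1 : ℤ) : ℝ) = 0 by push_cast; ring] at hsub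
    refine hX (crosses_of_traverse_strip hR (by linarith [h.nonneg]) ?_ (by linarith [h.le]) hsub)
    nlinarith [h.ρ_pos, h.le_r, P.r_lt, P.pos]
  have hstrip := (h.right hR hw₀ hw).shift_snd hR (-1)
  obtain ⟨ℓ₂, ℓ₃, hsum, h₂, h₃⟩ := StripSegment.exists_hasLength hR hX
    ⟨hstrip, by push_cast; linarith, by push_cast; linarith⟩
  exact ⟨(ρ - 1) * w, ℓ₂, ℓ₃, by linarith, (h.left hR hw₀ hw).hasLength_of_A hR hs hwe.le, h₂, h₃⟩

lemma exists_hasLength (hR : SegClosed P R) (hX : ¬ Crosses η R) (h : ConeSegment P R y s d ρ) :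
    ∃ ℓ₁ ℓ₂ ℓ₃, ℓ₁ + ℓ₂ + ℓ₃ = (ρ - 1) * d ∧ HasLength P R (P.rateA * ℓ₁) ∧
      HasLength P R (P.rateAB * ℓ₂) ∧ HasLength P R (P.rateABB * ℓ₃) := by
  have hlow := Int.floor_le (s + η)
  have hhigh := Int.lt_floor_add_one (s + η)
  have hshift := h.shift_snd hR (-⌊s + η⌋)
  rcases le_total (s + ((-⌊s + η⌋ : ℤ) : ℝ)) 0 with hs | hs
  · exact hshift.exists_hasLength_of_neg hR hX (by push_cast; linarith) hs
  · exact hshift.exists_hasLength_of_nonneg hR hX hs (by push_cast; linarith)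

end ConeSegment

lemma exists_inv_sum_mul_le {K₁ K₂ K₃ : ℝ} (h₁ : 0 < K₁) (h₂ : 0 < K₂) (h₃ : 0 < K₃)
    (ℓ₁ ℓ₂ ℓ₃ : ℝ) :
    (1 / K₁ + 1 / K₂ + 1 / K₃)⁻¹ * (ℓ₁ + ℓ₂ + ℓ₃) ≤ K₁ * ℓ₁ ∨
      (1 / K₁ + 1 / K₂ + 1 / K₃)⁻¹ * (ℓ₁ + ℓ₂ + ℓ₃) ≤ K₂ * ℓ₂ ∨
      (1 / K₁ + 1 / K₂ + 1 / K₃)⁻¹ * (ℓ₁ + ℓ₂ + ℓ₃) ≤ K₃ * ℓ₃ := by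
  set M := (1 / K₁ + 1 / K₂ + 1 / K₃)⁻¹ * (ℓ₁ + ℓ₂ + ℓ₃) with hM
  by_contra! hlt
  have hdiv : ∀ {K ℓ : ℝ}, 0 < K → K * ℓ < M → ℓ < M * (1 / K) := fun hK hKℓ => by
    rw [mul_one_div, lt_div_iff₀ hK]
    linarith
  have hsum : M * (1 / K₁) + M * (1 / K₂) + M * (1 / K₃) = ℓ₁ + ℓ₂ + ℓ₃ := by
    rw [hM, ← mul_add, ← mul_add, mul_right_comm, inv_mul_cancel₀ (by positivity), one_mul]
  linarith [hdiv h₁ hlt.1, hdiv h₂ hlt.2.1, hdiv h₃ hlt.2.2]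

namespace HasLength

variable {L : ℝ}

lemma grow (hR : SegClosed P R) (hX : ¬ Crosses η R) (h : HasLength P R L) :
    HasLength P R ((1 / P.rateA + 1 / P.rateAB + 1 / P.rateABB)⁻¹ * L) := by
  obtain ⟨y, s, d, ρ, hseg, hlen⟩ := h
  obtain ⟨ℓ₁, ℓ₂, ℓ₃, hsum, h₁, h₂, h₃⟩ := hseg.exists_hasLength hR hX
  have hA := P.rateA_pos
  have hAB := P.rateAB_pos
  have hABB := P.rateABB_pos
  have hle : (1 / P.rateA + 1 / P.rateAB + 1 / P.rateABB)⁻¹ * L ≤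
      (1 / P.rateA + 1 / P.rateAB + 1 / P.rateABB)⁻¹ * (ℓ₁ + ℓ₂ + ℓ₃) :=
    mul_le_mul_of_nonneg_left (hlen.trans hsum.ge) (by positivity)
  rcases exists_inv_sum_mul_le hA hAB hABB ℓ₁ ℓ₂ ℓ₃ with hmax | hmax | hmax
  · exact h₁.mono (hle.trans hmax)
  · exact h₂.mono (hle.trans hmax)
  · exact h₃.mono (hle.trans hmax)

lemma crosses (hR : SegClosed P R) (hK : 1 / P.rateA + 1 / P.rateAB + 1 / P.rateABB < 1)
    (hL : 0 < L) (h : HasLength P R L) : Crosses η R := by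
  by_contra hX
  have hA := P.rateA_pos
  have hAB := P.rateAB_pos
  have hABB := P.rateABB_pos
  set S := 1 / P.rateA + 1 / P.rateAB + 1 / P.rateABB
  have hgrow : ∀ n : ℕ, HasLength P R (S⁻¹ ^ n * L) := by
    intro n
    induction n with
    | zero => simpa using h
    | succ n ih =>
      rw [pow_succ', mul_assoc]
      exact ih.grow hR hX
  obtain ⟨n, hn⟩ := pow_unbounded_of_one_lt (P.r / L)
    ((one_lt_inv₀ (by positivity)).2 hK)
  rw [div_lt_iff₀ hL] at hn
  obtain ⟨y, s, d, ρ, hseg, hlen⟩ := hgrow n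
  nlinarith [hseg.width_nonneg, hseg.μ_le, hseg.le_r, hseg.nonneg, hseg.le, P.pos, P.one_lt_μ]

end HasLength

end Growth

/-! ### The return matrices and the threshold -/

lemma jacA_eq (η : ℝ) : jacA η = !![1, 1 / (1 - η); 1, 1 + 1 / (1 - η)] := by
  simp [jacA, add_comm]

lemma jacB_eq (η : ℝ) : jacB η = !![1, -(1 / η); 1, 1 - 1 / η] := by
  simp [jacB, neg_add_eq_sub]

lemma jacA_inv (η : ℝ) : (jacA η)⁻¹ = !![1 + 1 / (1 - η), -(1 / (1 - η)); -1, 1] := by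
  refine Matrix.inv_eq_left_inv ?_
  simp [jacA_eq, Matrix.one_fin_two, mul_comm]

lemma jacB_inv (η : ℝ) : (jacB η)⁻¹ = !![1 - 1 / η, 1 / η; -1, 1] := by
  refine Matrix.inv_eq_left_inv ?_
  simp [jacB_eq, Matrix.one_fin_two, mul_comm]

lemma mulVec_one_cons (p q u v g : ℝ) :
    !![p, q; u, v].mulVec ![1, g] = ![p + q * g, u + v * g] := by
  ext i
  fin_cases i <;> simp [Matrix.mulVec]

lemma isUnstableGradient_iff_eq {p q u v g g₀ : ℝ} (hdet : p * v - q * u = 1)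
    (hg₀ : u + v * g₀ = (p + q * g₀) * g₀) (hexp : 1 < p + q * g₀) :
    IsUnstableGradient !![p, q; u, v] g ↔ g = g₀ := by
  constructor
  · rintro ⟨μ, hμ, heig⟩
    rw [mulVec_one_cons] at heig
    obtain ⟨rfl, heig₁⟩ : p + q * g = μ ∧ u + v * g = μ * g := by simpa using heig
    by_contra hne
    have hsum : q * (g + g₀) = v - p :=
      mul_left_cancel₀ (sub_ne_zero.2 hne) (by linear_combination hg₀ - heig₁)
    have hprod : (p + q * g) * (p + q * g₀) = 1 := by
      linear_combination (p + q * g₀) * hsum + q * hg₀ + hdet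
    have habs : |p + q * g| * (p + q * g₀) = 1 := by
      rw [← abs_of_pos (one_pos.trans hexp), ← abs_mul, hprod, abs_one]
    nlinarith
  · rintro rfl
    refine ⟨_, hexp.trans_le (le_abs_self _), ?_⟩
    rw [mulVec_one_cons, hg₀]
    simp

lemma norm_fin_two (v : Fin 2 → ℝ) : ‖v‖ = max |v 0| |v 1| := by
  refine le_antisymm ((pi_norm_le_iff_of_nonneg (by positivity)).2 ?_)
    (max_le (norm_le_pi_norm v 0) (norm_le_pi_norm v 1))
  exact Fin.forall_fin_two.2 ⟨le_max_left _ _, le_max_right _ _⟩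

namespace ConeData

variable {η : ℝ} (P : ConeData η)

lemma returnMatrix_zero : returnMatrix η 0 = !![1 + P.a, -P.a; -1, 1] := by
  rw [P.a_eq]
  exact jacA_inv η

lemma returnMatrix_one : returnMatrix η 1 =
    !![-((1 + P.a) * P.t + 1), (1 + P.a) * (1 + P.t) + 1; P.t, -(1 + P.t)] := by
  change (jacA η)⁻¹ * (jacB η)⁻¹ = _
  rw [jacA_inv, jacB_inv, Matrix.mul_fin_two, P.a_eq, P.t_eq]
  ring_nf

lemma returnMatrix_two : returnMatrix η 2 =
    !![P.t ^ 2 + P.t - 1 + P.a * (P.t ^ 2 - 1),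
      -((1 + P.a) * P.t ^ 2 + (2 + P.a) * P.t - P.a);
      1 - P.t ^ 2, P.t ^ 2 + P.t - 1] := by
  change (jacA η)⁻¹ * (jacB η)⁻¹ * (jacB η)⁻¹ = _
  rw [jacA_inv, jacB_inv, Matrix.mul_fin_two, Matrix.mul_fin_two, P.a_eq, P.t_eq]
  ring_nf

lemma isUnstableGradient_returnMatrix_zero_iff {g : ℝ} :
    IsUnstableGradient (returnMatrix η 0) g ↔ g = -(1 / (P.μ - 1)) := by
  have hμ : P.μ - 1 ≠ 0 := by linarith [P.one_lt_μ]
  have heig : 1 + P.a + -P.a * -(1 / (P.μ - 1)) = P.μ := by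
    field_simp
    linear_combination -P.μ_eq
  rw [P.returnMatrix_zero]
  refine isUnstableGradient_iff_eq (by ring) ?_
    (heig.symm ▸ P.one_lt_μ)
  rw [heig]
  field_simp
  ring

lemma κ_quadratic : ((1 + P.a) * P.t ^ 2 + (2 + P.a) * P.t - P.a) * P.κ ^ 2 +
    P.a * (P.t ^ 2 - 1) * P.κ = P.t ^ 2 - 1 := by
  have hr : P.κ * P.r = 1 + P.κ := by linear_combination P.κ_mul
  have hscaled : (P.κ * P.r - (2 + P.a) * P.κ) * ((P.t ^ 2 - 1) * (P.κ * P.r) + P.t * P.κ) =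
      P.t * P.κ * (P.κ * P.r) + P.κ ^ 2 := by
    linear_combination P.κ ^ 2 * P.r_eq
  rw [hr] at hscaled
  linear_combination -hscaled

lemma one_lt_rateABB : 1 < P.rateABB := by
  unfold rateABB
  have hprod : 0 < P.a * (P.t ^ 2 - 1) := mul_pos (by linarith [P.one_lt_a]) P.sq_t_sub_one_pos
  linarith [mul_pos P.rateABB_coeff_pos P.κ_pos, P.lt_t, P.sq_t_sub_one_pos]

lemma isUnstableGradient_returnMatrix_two_iff {g : ℝ} :
    IsUnstableGradient (returnMatrix η 2) g ↔ g = -P.κ := by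
  have hexp := P.one_lt_rateABB
  unfold rateABB at hexp
  rw [P.returnMatrix_two]
  refine isUnstableGradient_iff_eq (by ring) ?_ (by linarith)
  linear_combination P.κ_quadratic

lemma mem_cone_iff {w : Fin 2 → ℝ} : w ∈ cone η ↔
    ∃ g c : ℝ, -(1 / (P.μ - 1)) ≤ g ∧ g ≤ -P.κ ∧ c ≠ 0 ∧ w = c • ![1, g] := by
  constructor
  · rintro ⟨g₁, g₃, g, c, h₁, h₃, hg⟩
    rw [P.isUnstableGradient_returnMatrix_zero_iff] at h₁
    rw [P.isUnstableGradient_returnMatrix_two_iff] at h₃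
    subst h₁ h₃
    exact ⟨g, c, hg⟩
  · rintro ⟨g, c, hg⟩
    exact ⟨_, _, g, c, P.isUnstableGradient_returnMatrix_zero_iff.2 rfl,
      P.isUnstableGradient_returnMatrix_two_iff.2 rfl, hg⟩

lemma κ_eq : P.κ = 1 / (P.r - 1) :=
  eq_div_of_mul_eq (by linarith [P.lt_r, P.one_lt_a]) P.κ_mul

/-- Under the sign condition `p q ≤ 0`, the first coordinate of the image dominates and is
least at the gradient `-κ`. -/
lemma minExpansion_eq_abs {p q u v : ℝ} {i : Fin 3} (hM : returnMatrix η i = !![p, q; u, v])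
    (hpq : p * q ≤ 0) (hdom : |u - v * P.κ| ≤ |p - q * P.κ|) :
    minExpansion η i = |p - q * P.κ| := by
  have hκ := P.κ_pos
  have hκγ : P.κ ≤ 1 / (P.μ - 1) := by
    rw [P.κ_eq]
    exact one_div_le_one_div_of_le (by linarith [P.one_lt_μ]) (by linarith [P.μ_lt_r])
  have hγ : 1 / (P.μ - 1) ≤ 1 := by
    rw [div_le_one (by linarith [P.lt_μ])]
    linarith [P.lt_μ]
  have hnorm {g : ℝ} (hg : -(1 / (P.μ - 1)) ≤ g) (hg' : g ≤ -P.κ) :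
      ‖(![1, g] : Fin 2 → ℝ)‖ = 1 := by
    simpa [norm_fin_two] using abs_le.2 (⟨by linarith, by linarith⟩ : -1 ≤ g ∧ g ≤ 1)
  have hmono {g : ℝ} (hg : g ≤ -P.κ) : |p - q * P.κ| ≤ |p + q * g| := by
    refine sq_le_sq.1 ?_
    nlinarith [mul_nonneg_of_nonpos_of_nonpos hpq (by linarith : g + P.κ ≤ 0),
      mul_nonneg (sq_nonneg q)
        (mul_nonneg (by linarith : 0 ≤ -P.κ - g) (by linarith : 0 ≤ P.κ - g))]
  refine IsLeast.csInf_eq ⟨⟨![1, -P.κ], P.mem_cone_iff.2 ⟨-P.κ, 1, by linarith, le_rfl,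
    one_ne_zero, (one_smul _ _).symm⟩, ?_⟩, ?_⟩
  · have himage : ‖(![p + q * -P.κ, u + v * -P.κ] : Fin 2 → ℝ)‖ = |p - q * P.κ| := by
      simpa [norm_fin_two, ← sub_eq_add_neg] using hdom
    simp only [hM, mulVec_one_cons, hnorm (by linarith) le_rfl, himage, div_one]
  · rintro _ ⟨w, hw, rfl⟩
    obtain ⟨g, c, hg, hg', hc, rfl⟩ := P.mem_cone_iff.1 hw
    simp only [hM, Matrix.mulVec_smul, mulVec_one_cons, norm_smul, hnorm hg hg', mul_one,
      mul_div_cancel_left₀ _ (norm_ne_zero_iff.2 hc), norm_fin_two]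
    exact (hmono hg').trans (le_max_left _ _)

lemma minExpansion_zero : minExpansion η 0 = P.rateA := by
  have ha := P.one_lt_a
  have hκ := P.κ_pos
  have hrate : |1 + P.a - -P.a * P.κ| = P.rateA := by
    rw [abs_of_pos (by nlinarith)]
    unfold rateA
    ring
  rw [P.minExpansion_eq_abs P.returnMatrix_zero (by nlinarith) ?_, hrate]
  rw [hrate, rateA, abs_le]
  constructor <;> nlinarith

lemma minExpansion_one : minExpansion η 1 = P.rateAB := by
  have ha := P.one_lt_a
  have ht := P.lt_t
  have hκ := P.κ_pos
  have haκ : 0 < P.a * P.κ := by positivity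
  have hat : 0 < P.a * P.t := by positivity
  have htκ : 0 < P.t * P.κ := by positivity
  have hatκ : 0 < P.a * P.t * P.κ := by positivity
  have hrate : |-((1 + P.a) * P.t + 1) - ((1 + P.a) * (1 + P.t) + 1) * P.κ| = P.rateAB := by
    rw [abs_of_neg (by linarith)]
    unfold rateAB
    ring
  rw [P.minExpansion_eq_abs P.returnMatrix_one ?_ ?_, hrate]
  · exact mul_nonpos_of_nonpos_of_nonneg (by linarith) (by positivity)
  · rw [hrate, rateAB, abs_le]
    constructor <;> linarith

lemma minExpansion_two : minExpansion η 2 = P.rateABB := by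
  have ha := P.one_lt_a
  have ht := P.lt_t
  have hκ := P.κ_pos
  have hcoef := P.rateABB_coeff_pos
  have haC : 0 < P.a * (P.t ^ 2 - 1) := mul_pos (by linarith) P.sq_t_sub_one_pos
  have hcoefκ := mul_pos hcoef hκ
  have hrate : |P.t ^ 2 + P.t - 1 + P.a * (P.t ^ 2 - 1) -
      -((1 + P.a) * P.t ^ 2 + (2 + P.a) * P.t - P.a) * P.κ| = P.rateABB := by
    rw [abs_of_pos (by nlinarith)]
    unfold rateABB
    ring
  rw [P.minExpansion_eq_abs P.returnMatrix_two ?_ ?_, hrate]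
  · exact mul_nonpos_of_nonneg_of_nonpos (by nlinarith) (by linarith)
  · have hmκ : 0 < (P.t ^ 2 + P.t - 1) * P.κ := mul_pos (by nlinarith) hκ
    have hle : (P.t ^ 2 + P.t - 1) * P.κ ≤
        ((1 + P.a) * P.t ^ 2 + (2 + P.a) * P.t - P.a) * P.κ :=
      mul_le_mul_of_nonneg_right (by nlinarith) hκ.le
    rw [hrate, rateABB, abs_le]
    constructor <;> nlinarith

lemma rateABB_sq_add_one :
    P.rateABB ^ 2 + 1 =
      (2 * (P.t ^ 2 + P.t - 1) + P.a * (P.t ^ 2 - 1)) * P.rateABB := by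
  unfold rateABB
  linear_combination ((1 + P.a) * P.t ^ 2 + (2 + P.a) * P.t - P.a) * P.κ_quadratic

/-- The rate is the larger root of its characteristic equation, whose trace increases in `a` and
`t`. -/
lemma le_rateABB {α τ k : ℝ} (hα : α ≤ P.a) (hτ : τ ≤ P.t) (hτ₁ : 1 ≤ τ) (hk : 1 ≤ k)
    (hle : k ^ 2 + 1 ≤ (2 * (τ ^ 2 + τ - 1) + α * (τ ^ 2 - 1)) * k) : k ≤ P.rateABB := by
  have heig := P.rateABB_sq_add_one
  have hone := P.one_lt_rateABB
  have htrace : 2 * (τ ^ 2 + τ - 1) + α * (τ ^ 2 - 1) ≤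
      2 * (P.t ^ 2 + P.t - 1) + P.a * (P.t ^ 2 - 1) := by
    have hsq : τ ^ 2 ≤ P.t ^ 2 := pow_le_pow_left₀ (by linarith) hτ 2
    have hprod : α * (τ ^ 2 - 1) ≤ P.a * (P.t ^ 2 - 1) :=
      mul_le_mul hα (by linarith) (by nlinarith) (by linarith [P.one_lt_a])
    linarith
  have hk' := hle.trans (mul_le_mul_of_nonneg_right htrace (by linarith))
  generalize 2 * (P.t ^ 2 + P.t - 1) + P.a * (P.t ^ 2 - 1) = T at *
  by_contra! hlt
  have hmul := mul_le_mul_of_nonneg_left hk' (by linarith : 0 ≤ P.rateABB)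
  have hpos : 0 < (k - P.rateABB) * (k * P.rateABB - 1) := mul_pos (by linarith) (by nlinarith)
  nlinarith

lemma le_κ (hη : η ≤ 0.3236) : 0.1646 ≤ P.κ := by
  have ha₁ := P.one_lt_a
  have ha : P.a ≤ 1.47842 := by
    by_contra! h
    nlinarith [P.a_mul]
  have ht : 1.09023 ≤ P.t := by
    by_contra! h
    nlinarith [P.t_mul, P.pos]
  have ht₂ := P.sq_t_sub_one_pos
  by_contra! hlt
  have hsq := mul_le_mul_of_nonneg_left
    (pow_le_pow_left₀ P.κ_pos.le hlt.le 2) P.rateABB_coeff_pos.le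
  have hlin : P.a * (P.t ^ 2 - 1) * P.κ < P.a * (P.t ^ 2 - 1) * 0.1646 :=
    mul_lt_mul_of_pos_left hlt (by positivity)
  have hslack : 0 ≤ (1.47842 - P.a) *
      (0.1646 * (P.t ^ 2 - 1) + 0.1646 ^ 2 * (P.t ^ 2 + P.t - 1)) :=
    mul_nonneg (by linarith) (by linarith)
  nlinarith [P.κ_quadratic]

lemma sum_one_div_rate_lt_one_of_le (hη : η ≤ 0.3236) {α τ k : ℝ} (hα : 1 ≤ α)
    (hαa : α ≤ P.a) (hτ : 1 ≤ τ) (hτt : τ ≤ P.t) (hk : 1 ≤ k)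
    (hkle : k ^ 2 + 1 ≤ (2 * (τ ^ 2 + τ - 1) + α * (τ ^ 2 - 1)) * k)
    (hsum : 1 / (1 + α * 1.1646) + 1 / ((1 + α) * (τ + (1 + τ) * 0.1646) + 1.1646) + 1 / k < 1) :
    1 / P.rateA + 1 / P.rateAB + 1 / P.rateABB < 1 := by
  have hκ := P.le_κ hη
  have hA : 1 + α * 1.1646 ≤ P.rateA := by
    unfold rateA
    nlinarith
  have hAB : (1 + α) * (τ + (1 + τ) * 0.1646) + 1.1646 ≤ P.rateAB := by
    have hτκ : (1 + τ) * 0.1646 ≤ (1 + P.t) * P.κ :=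
      mul_le_mul (by linarith) hκ (by norm_num) (by linarith)
    have hprod : (1 + α) * (τ + (1 + τ) * 0.1646) ≤ (1 + P.a) * (P.t + (1 + P.t) * P.κ) :=
      mul_le_mul (by linarith) (by linarith) (by linarith) (by linarith)
    unfold rateAB
    linarith
  have hA' := one_div_le_one_div_of_le (by linarith) hA
  have hAB' := one_div_le_one_div_of_le (by nlinarith) hAB
  have hABB' := one_div_le_one_div_of_le (by linarith) (P.le_rateABB hαa hτt hτ hk hkle)
  linarith

lemma sum_one_div_rate_lt_one (hη : η ≤ 0.3236) :
    1 / P.rateA + 1 / P.rateAB + 1 / P.rateABB < 1 := by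
  have hη₀ := P.pos
  have ha {α β : ℝ} (hβ : β ≤ η) (hαβ : α * (1 - β) ≤ 1) (hα : 0 ≤ α) : α ≤ P.a := by
    rw [P.a_eq, le_div_iff₀ (by linarith)]
    exact (mul_le_mul_of_nonneg_left (by linarith) hα).trans hαβ
  have ht {τ β : ℝ} (hβ : η ≤ β) (hτβ : (τ + 2) * β ≤ 1) (hτ : 0 ≤ τ) : τ ≤ P.t := by
    rw [P.t_eq, le_sub_iff_add_le, le_div_iff₀ hη₀]
    exact (mul_le_mul_of_nonneg_left hβ (by linarith)).trans hτβ
  rcases le_total η 0.31 with h₁ | h₁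
  · exact P.sum_one_div_rate_lt_one_of_le (α := 1) (τ := 1.2258) (k := 3.6) hη le_rfl
      P.one_lt_a.le (by norm_num) (ht h₁ (by norm_num) (by norm_num)) (by norm_num) (by norm_num)
      (by norm_num)
  rcases le_total η 0.318 with h₂ | h₂
  · exact P.sum_one_div_rate_lt_one_of_le (α := 1.449) (τ := 1.1446) (k := 3) hη (by norm_num)
      (ha h₁ (by norm_num) (by norm_num)) (by norm_num) (ht h₂ (by norm_num) (by norm_num))
      (by norm_num) (by norm_num) (by norm_num)
  · exact P.sum_one_div_rate_lt_one_of_le (α := 1.466) (τ := 1.0902) (k := 2.42) hη (by norm_num)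
      (ha h₂ (by norm_num) (by norm_num)) (by norm_num) (ht hη (by norm_num) (by norm_num))
      (by norm_num) (by norm_num) (by norm_num)

lemma two_lt_rateA : 2 < P.rateA := by
  unfold rateA
  linarith [P.one_lt_a, mul_pos (one_pos.trans P.one_lt_a) P.κ_pos]

lemma three_lt_rateAB : 3 < P.rateAB := by
  have ha := P.one_lt_a
  have ht := P.lt_t
  have hκ := P.κ_pos
  have hcoef : 0 < ((1 + P.a) * (1 + P.t) + 1) * P.κ := by positivity
  unfold rateAB
  nlinarith

lemma one_div_one_sub_lt_rateABB_iff :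
    1 / (1 - 1 / P.rateA - 1 / P.rateAB) < P.rateABB ↔
      1 / P.rateA + 1 / P.rateAB + 1 / P.rateABB < 1 := by
  have hA : 1 / P.rateA < 1 / 2 := one_div_lt_one_div_of_lt two_pos P.two_lt_rateA
  have hAB : 1 / P.rateAB < 1 / 3 := one_div_lt_one_div_of_lt three_pos P.three_lt_rateAB
  rw [one_div_lt (by linarith) (by linarith [P.one_lt_rateABB]), lt_sub_iff_add_lt,
    lt_sub_iff_add_lt]
  ring_nf

lemma κ_le (P : ConeData 0.3244) : P.κ ≤ 0.16 := by
  by_contra! hlt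
  have hsq : 5.19 * 0.16 ^ 2 ≤
      ((1 + P.a) * P.t ^ 2 + (2 + P.a) * P.t - P.a) * P.κ ^ 2 := by
    refine mul_le_mul ?_ (pow_le_pow_left₀ (by norm_num) hlt.le 2) (by norm_num)
      P.rateABB_coeff_pos.le
    rw [P.a_eq, P.t_eq]
    norm_num
  have hlin : 0.254 * 0.16 ≤ P.a * (P.t ^ 2 - 1) * P.κ := by
    rw [P.a_eq, P.t_eq]
    refine mul_le_mul ?_ hlt.le (by norm_num) ?_ <;> norm_num
  have hconst : P.t ^ 2 - 1 ≤ 0.1721 := by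
    rw [P.t_eq]
    norm_num
  linarith [P.κ_quadratic]

lemma one_le_sum_one_div_rate (P : ConeData 0.3244) :
    1 ≤ 1 / P.rateA + 1 / P.rateAB + 1 / P.rateABB := by
  have hκ := P.κ_le
  have hA : P.rateA ≤ 2.718 := by
    rw [rateA, P.a_eq]
    linarith
  have hAB : P.rateAB ≤ 4.68 := by
    rw [rateAB, P.a_eq, P.t_eq]
    linarith
  have hABB : P.rateABB ≤ 2.345 := by
    rw [rateABB, P.a_eq, P.t_eq]
    linarith
  have hA' := one_div_le_one_div_of_le P.rateA_pos hA
  have hAB' := one_div_le_one_div_of_le P.rateAB_pos hAB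
  have hABB' := one_div_le_one_div_of_le P.rateABB_pos hABB
  linarith

end ConeData

lemma exists_κ_quadratic_eq {a t : ℝ} (ha : 1 < a) (ht : 1 < t) :
    ∃ κ, 0 < κ ∧ ((1 + a) * t ^ 2 + (2 + a) * t - a) * κ ^ 2 + a * (t ^ 2 - 1) * κ =
      t ^ 2 - 1 := by
  have hC : 0 < t ^ 2 - 1 := by nlinarith
  have hB : 0 < a * (t ^ 2 - 1) := by positivity
  let q : ℝ → ℝ := fun κ => ((1 + a) * t ^ 2 + (2 + a) * t - a) * κ ^ 2 + a * (t ^ 2 - 1) * κ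
  have hq₀ : q 0 = 0 := by simp [q]
  have hq₁ : t ^ 2 - 1 ≤ q 1 := by
    simp only [q]
    nlinarith
  obtain ⟨κ, hκ, hqκ⟩ := intermediate_value_Icc zero_le_one
    (by fun_prop : Continuous q).continuousOn ⟨hq₀.trans_le hC.le, hq₁⟩
  refine ⟨κ, hκ.1.lt_of_ne ?_, hqκ⟩
  rintro rfl
  exact hC.ne (hq₀.symm.trans hqκ)

lemma nonempty_coneData {η : ℝ} (hη₀ : 0 < η) (hη : η < 0.3245) : Nonempty (ConeData η) := by
  have ha_mul : 1 / (1 - η) * (1 - η) = 1 := div_mul_cancel₀ _ (by linarith)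
  have ht_mul : (1 / η - 2) * η = 1 - 2 * η := by field_simp
  have ha : 1 < 1 / (1 - η) := by
    rw [lt_div_iff₀ (by linarith)]
    linarith
  have ht : 1 < 1 / η - 2 := by
    rw [lt_sub_iff_add_lt, lt_div_iff₀ hη₀]
    linarith
  generalize 1 / (1 - η) = a at *
  generalize 1 / η - 2 = t at *
  obtain ⟨κ, hκ, hquad⟩ := exists_κ_quadratic_eq ha ht
  have hdisc := Real.sq_sqrt (show 0 ≤ a ^ 2 + 4 * a by positivity)
  have hκa : (1 + a) * κ < 1 := by
    by_contra! hle
    have hC : 0 < t ^ 2 - 1 := by nlinarith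
    nlinarith [mul_le_mul_of_nonneg_left hle hC.le,
      mul_le_mul_of_nonneg_left hle (mul_pos hC hκ).le,
      (by positivity : 0 < ((2 + a) * t + 1) * κ ^ 2)]
  refine ⟨⟨a, t, (2 + a + √(a ^ 2 + 4 * a)) / 2, 1 + 1 / κ, κ, hη₀, hη, ha_mul, ht_mul, ?_, ?_, ?_,
    ?_, ?_⟩⟩
  · linarith [Real.sqrt_nonneg (a ^ 2 + 4 * a)]
  · linear_combination hdisc / 4
  · field_simp
    linear_combination -hquad
  · linarith [(lt_div_iff₀ hκ).2 hκa]
  · field_simp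
    ring

lemma ConeData.expansion_iff {η : ℝ} (P : ConeData η) :
    minExpansion η 2 > 1 / (1 - 1 / minExpansion η 0 - 1 / minExpansion η 1) ↔
      1 / P.rateA + 1 / P.rateAB + 1 / P.rateABB < 1 := by
  rw [P.minExpansion_zero, P.minExpansion_one, P.minExpansion_two, gt_iff_lt,
    P.one_div_one_sub_lt_rateABB_iff]

lemma mem_and_mem_upperBounds_eta1_set :
    let T := {t : ℝ | 0 < t ∧ t ≤ 1 / 3 ∧ ∀ η : ℝ, 0 < η → η < t →
      minExpansion η 2 > 1 / (1 - 1 / minExpansion η 0 - 1 / minExpansion η 1)}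
    0.3236 ∈ T ∧ 0.3244 ∈ upperBounds T := by
  refine ⟨⟨by norm_num, by norm_num, fun η hη₀ hη => ?_⟩, ?_⟩
  · obtain ⟨P⟩ := nonempty_coneData hη₀ (hη.trans (by norm_num))
    exact P.expansion_iff.2 (P.sum_one_div_rate_lt_one hη.le)
  · rintro x ⟨-, -, hx⟩
    by_contra! hlt
    obtain ⟨P⟩ := nonempty_coneData (η := 0.3244) (by norm_num) (by norm_num)
    exact P.one_le_sum_one_div_rate.not_gt (P.expansion_iff.1 (hx _ (by norm_num) hlt))

lemma eta1_bounds : 0.3236 ≤ eta1 ∧ eta1 ≤ 0.3244 :=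
  ⟨le_csSup ⟨_, mem_and_mem_upperBounds_eta1_set.2⟩ mem_and_mem_upperBounds_eta1_set.1,
    csSup_le ⟨_, mem_and_mem_upperBounds_eta1_set.1⟩ mem_and_mem_upperBounds_eta1_set.2⟩

/-- Cone data for which the return map of `H⁻¹` expands enough: the pieces into which a return cuts
a cone segment cannot all be shorter after the return than the segment. -/
structure ExpandingCone (η : ℝ) extends ConeData η where
  sum_lt_one : 1 / toConeData.rateA + 1 / toConeData.rateAB + 1 / toConeData.rateABB < 1

lemma nonempty_expandingCone {η : ℝ} (hη₀ : 0 < η) (hη : η < eta1) :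
    Nonempty (ExpandingCone η) := by
  obtain ⟨P⟩ := nonempty_coneData hη₀ ((hη.trans_le eta1_bounds.2).trans (by norm_num))
  obtain ⟨x, ⟨-, -, hx⟩, hηx⟩ := exists_lt_of_lt_csSup ⟨_, mem_and_mem_upperBounds_eta1_set.1⟩ hη
  exact ⟨P, P.expansion_iff.1 (hx η hη₀ hηx)⟩

/-! ### The map in the coordinates `(y, s)` -/

/-- The point of the torus with coordinates `(x, y) = (y - s, y)`. In the coordinates `(y, s)` the
map acts like a second order recurrence, `H (y, s) = (φ y - s, y)` for a piecewise affine `φ`. -/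
def pt (y s : ℝ) : Torus := (((y - s : ℝ) : UnitAddCircle), (y : UnitAddCircle))

lemma rep_coe (y : ℝ) : rep (y : UnitAddCircle) = Int.fract y := by
  rw [rep, AddCircle.coe_equivIco_mk_apply]
  simp

lemma coe_rep (c : UnitAddCircle) : ((rep c : ℝ) : UnitAddCircle) = c :=
  (AddCircle.equivIco (1 : ℝ) 0).symm_apply_apply c

lemma rep_nonneg (c : UnitAddCircle) : 0 ≤ rep c := (AddCircle.equivIco (1 : ℝ) 0 c).2.1

lemma rep_lt_one (c : UnitAddCircle) : rep c < 1 :=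
  (AddCircle.equivIco (1 : ℝ) 0 c).2.2.trans_eq (zero_add 1)

lemma coe_add_int (y : ℝ) (m : ℤ) : ((y + m : ℝ) : UnitAddCircle) = y := by
  have hm : ((m : ℝ) : UnitAddCircle) = 0 := (AddCircle.coe_eq_zero_iff (1 : ℝ)).2 ⟨m, by simp⟩
  rw [AddCircle.coe_add, hm, add_zero]

lemma pt_add_int (y s : ℝ) (m n : ℤ) : pt (y + m) (s + n) = pt y s := by
  have h : y + (m : ℝ) - (s + n) = y - s + ((m - n : ℤ) : ℝ) := by push_cast; ring
  rw [pt, pt, h, coe_add_int, coe_add_int]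

lemma pt_add_proj (y s : ℝ) (v : Fin 2 → ℝ) :
    pt y s + proj v = pt (y + v 1) (s + (v 1 - v 0)) := by
  ext
  · simp only [pt, proj, Prod.fst_add, ← AddCircle.coe_add]
    congr 1; ring
  · simp only [pt, proj, Prod.snd_add, ← AddCircle.coe_add]

lemma eq_pt_of_snd {z : Torus} {y s : ℝ} (hy : z.2 = (y : UnitAddCircle))
    (hs : z.2 - z.1 = (s : UnitAddCircle)) : z = pt y s := by
  ext
  · rw [pt, AddCircle.coe_sub, ← hy, ← hs, sub_sub_cancel]
  · exact hy

lemma exists_eq_pt_of_snd {z : Torus} {y : ℝ} (hy : z.2 = (y : UnitAddCircle)) :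
    ∃ s, z = pt y s :=
  ⟨_, eq_pt_of_snd hy (coe_rep _).symm⟩

lemma exists_eq_pt (z : Torus) : ∃ y s, z = pt y s :=
  ⟨_, exists_eq_pt_of_snd (coe_rep _).symm⟩

/-- The periodic extension of the shear profile to the line. -/
noncomputable def liftProfile (η y : ℝ) : ℝ := profile η (Int.fract y)

lemma mapH_pt (η y s : ℝ) : mapH η (pt y s) = pt (2 * y - s + liftProfile η y) y := by
  change shearG (shearF η (pt y s)) = _
  ext <;> simp only [shearG, shearF, pt, liftProfile, Equiv.coe_fn_mk, rep_coe,
    ← AddCircle.coe_add] <;> congr 1 <;> ring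

lemma mapH_inv_pt (η y s : ℝ) : (mapH η)⁻¹ (pt y s) = pt s (2 * s - y + liftProfile η s) := by
  rw [Equiv.Perm.inv_eq_iff_eq, mapH_pt]
  congr 1; ring

lemma mapH_inv_snd (η : ℝ) (z : Torus) : ((mapH η)⁻¹ z).2 = z.2 - z.1 := by
  obtain ⟨y, s, rfl⟩ := exists_eq_pt z
  rw [mapH_inv_pt]
  simp only [pt, AddCircle.coe_sub, sub_sub_cancel]

lemma liftProfile_of_nonneg {η y : ℝ} (hη : 0 < η) (hy₀ : 0 ≤ y) (hy₁ : y ≤ 1 - η) :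
    liftProfile η y = 1 / (1 - η) * y := by
  rw [liftProfile, profile, Int.fract_eq_self.2 ⟨hy₀, by linarith⟩, if_pos hy₁]
  ring

lemma liftProfile_of_nonpos {η y : ℝ} (hη : 0 < η) (hη₁ : η < 1) (hy₀ : -η ≤ y) (hy₁ : y ≤ 0) :
    liftProfile η y = -(1 / η) * y := by
  rcases hy₁.lt_or_eq with hy₁ | rfl
  · have hfract : Int.fract y = y + 1 := by
      rw [← Int.fract_add_one]
      exact Int.fract_eq_self.2 ⟨by linarith, by linarith⟩
    rw [liftProfile, profile, hfract]
    split_ifs with h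
    · obtain rfl : y = -η := by linarith
      field_simp [show (1 : ℝ) - η ≠ 0 by linarith]
      ring
    · field_simp; ring
  · simp [liftProfile, profile, hη₁.le]

lemma mapH_pt_of_nonneg {η y : ℝ} (hη : 0 < η) (hy₀ : 0 ≤ y) (hy₁ : y ≤ 1 - η) (s : ℝ) :
    mapH η (pt y s) = pt ((2 + 1 / (1 - η)) * y - s) y := by
  rw [mapH_pt, liftProfile_of_nonneg hη hy₀ hy₁]
  congr 1; ring

lemma mapH_pt_of_nonpos {η y : ℝ} (hη : 0 < η) (hη₁ : η < 1) (hy₀ : -η ≤ y) (hy₁ : y ≤ 0)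
    (s : ℝ) : mapH η (pt y s) = pt (-(1 / η - 2) * y - s) y := by
  rw [mapH_pt, liftProfile_of_nonpos hη hη₁ hy₀ hy₁]
  congr 1; ring

/-! ### Segments contained in the backward images of a set -/

/-- The segment on the torus with the given end points in the coordinates `(y, s)`. -/
def segSet (y s y' s' : ℝ) : Set Torus :=
  (fun u : ℝ => pt (y + u * (y' - y)) (s + u * (s' - s))) '' Icc 0 1

/-- The family of the segments contained in some backward image of `γ`, to which the growth
argument is applied. -/
def InBackward (η : ℝ) (γ : Set Torus) : SegFamily := fun y s y' s' =>
  ∃ n : ℕ, segSet y s y' s' ⊆ ((mapH η)⁻¹ ^ n : Equiv.Perm Torus) '' γ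

lemma InBackward.mono {η : ℝ} {γ : Set Torus} {y s y' s' x q x' q' : ℝ}
    (h : InBackward η γ y s y' s') (hsub : segSet x q x' q' ⊆ segSet y s y' s') :
    InBackward η γ x q x' q' :=
  h.imp fun _ hn => hsub.trans hn

lemma InBackward.map_inv {η b : ℝ} {γ : Set Torus} {y s y' s' : ℝ}
    (h : InBackward η γ y s y' s')
    (hb : ∀ u ∈ Icc (0 : ℝ) 1, liftProfile η (s + u * (s' - s)) = (b - 2) * (s + u * (s' - s))) :
    InBackward η γ s (b * s - y) s' (b * s' - y') := by
  obtain ⟨n, hn⟩ := h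
  refine ⟨n + 1, ?_⟩
  rintro _ ⟨u, hu, rfl⟩
  obtain ⟨z, hz, hzu⟩ := hn ⟨u, hu, rfl⟩
  refine ⟨z, hz, ?_⟩
  rw [pow_succ', Equiv.Perm.mul_apply, hzu]
  beta_reduce
  rw [mapH_inv_pt, hb u hu]
  congr 1; ring

lemma segClosed_inBackward {η : ℝ} (P : ConeData η) (γ : Set Torus) :
    SegClosed P (InBackward η γ) where
  sub {y s y' s' u v} h hu hu' hv hv' := by
    refine h.mono ?_
    rintro _ ⟨w, hw, rfl⟩
    refine ⟨u + w * (v - u), ⟨by nlinarith [hw.1, hw.2], by nlinarith [hw.1, hw.2]⟩, ?_⟩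
    beta_reduce
    congr 1 <;> ring
  shift {y s y' s'} h m k := by
    refine h.mono ?_
    rintro _ ⟨w, hw, rfl⟩
    refine ⟨w, hw, ?_⟩
    beta_reduce
    rw [← pt_add_int _ _ m k]
    congr 1 <;> ring
  stepA h hs hs₁ hs' hs₁' := h.map_inv fun u hu => by
    rw [liftProfile_of_nonneg P.pos (by nlinarith [hu.1, hu.2]) (by nlinarith [hu.1, hu.2]), P.a_eq]
    ring
  stepB h hs hs₁ hs' hs₁' := h.map_inv fun u hu => by
    rw [liftProfile_of_nonpos P.pos (by linarith [P.lt]) (by nlinarith [hu.1, hu.2])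
      (by nlinarith [hu.1, hu.2]), P.t_eq]
    ring

/-! ### Orbits off the singular set -/

/-- The full orbit of `z` avoids the singular set. -/
def OffSingular (η : ℝ) (z : Torus) : Prop := ∀ n : ℤ, (mapH η ^ n) z ∉ singularSet η

/-- `z` lies in the strip `A = {0 ≤ y < 1 - η}`, where the Jacobian matrix is `jacA η`. -/
def InA (η : ℝ) (z : Torus) : Prop := rep z.2 < 1 - η

lemma OffSingular.zpow {η : ℝ} {z : Torus} (h : OffSingular η z) (k : ℤ) :
    OffSingular η ((mapH η ^ k) z) := fun n => by
  rw [← Equiv.Perm.mul_apply, ← zpow_add]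
  exact h _

lemma OffSingular.pow {η : ℝ} {z : Torus} (h : OffSingular η z) (k : ℕ) :
    OffSingular η ((mapH η ^ k) z) := by
  simpa using h.zpow k

lemma OffSingular.map {η : ℝ} {z : Torus} (h : OffSingular η z) : OffSingular η (mapH η z) := by
  simpa using h.zpow 1

lemma OffSingular.notMem {η : ℝ} {z : Torus} (h : OffSingular η z) : z ∉ singularSet η := by
  simpa using h 0

lemma InA.exists_lift {η : ℝ} {z : Torus} (h : InA η z) (hz : z ∉ singularSet η) :
    ∃ y : ℝ, z.2 = y ∧ 0 < y ∧ y < 1 - η := by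
  refine ⟨rep z.2, (coe_rep _).symm, (rep_nonneg _).lt_of_ne fun h₀ => hz (Or.inl ?_), h⟩
  rw [← coe_rep z.2, ← h₀]
  exact AddCircle.coe_zero (1 : ℝ)

lemma exists_lift_of_not_inA {η : ℝ} {z : Torus} (h : ¬ InA η z) (hz : z ∉ singularSet η) :
    ∃ y : ℝ, z.2 = y ∧ -η < y ∧ y < 0 := by
  have hlt : 1 - η < rep z.2 := (not_lt.1 h).lt_of_ne fun h₀ => hz (Or.inr (by rw [h₀, coe_rep]))
  refine ⟨rep z.2 - 1, ?_, by linarith, by linarith [rep_lt_one z.2]⟩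
  rw [← coe_add_int (rep z.2 - 1) 1, Int.cast_one, sub_add_cancel, coe_rep]

lemma OffSingular.inA_map_map {η : ℝ} {z : Torus} (hη : 0 < η) (hη₁ : η < 1 / 2)
    (hz : OffSingular η z) (h₀ : ¬ InA η z) (h₁ : ¬ InA η (mapH η z)) :
    InA η (mapH η (mapH η z)) := by
  obtain ⟨y₀, hy₀, hy₀_gt, hy₀_lt⟩ := exists_lift_of_not_inA h₀ hz.notMem
  obtain ⟨y₁, hy₁, hy₁_gt, hy₁_lt⟩ := exists_lift_of_not_inA h₁ hz.map.notMem
  have hmap : mapH η z = pt y₁ y₀ := by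
    refine eq_pt_of_snd hy₁ ?_
    simpa only [← mapH_inv_snd η, Equiv.Perm.inv_def, Equiv.symm_apply_apply] using hy₀
  have ht_mul : (1 / η - 2) * η = 1 - 2 * η := by field_simp
  have hlt : -(1 / η - 2) * y₁ - y₀ < 1 - η := by nlinarith
  have hpos : 0 < -(1 / η - 2) * y₁ - y₀ := by nlinarith
  rw [hmap, mapH_pt_of_nonpos hη (by linarith) hy₁_gt.le hy₁_lt.le]
  rwa [InA, pt, rep_coe, Int.fract_eq_self.2 ⟨hpos.le, by linarith⟩]

lemma OffSingular.exists_inA_pow {η : ℝ} {z : Torus} (hη : 0 < η) (hη₁ : η < 1 / 2)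
    (hz : OffSingular η z) : ∃ k ≤ 2, InA η ((mapH η ^ k) z) := by
  by_cases h₀ : InA η z
  · exact ⟨0, by norm_num, h₀⟩
  by_cases h₁ : InA η (mapH η z)
  · exact ⟨1, by norm_num, by simpa using h₁⟩
  · exact ⟨2, le_rfl, by simpa [sq] using hz.inA_map_map hη hη₁ h₀ h₁⟩

lemma OffSingular.exists_inA {η : ℝ} {z : Torus} (hη : 0 < η) (hη₁ : η < 1 / 2)
    (hz : OffSingular η z) :
    ∃ (j : ℕ) (z' : Torus), (mapH η ^ j) z' = z ∧ InA η z' ∧ OffSingular η z' := by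
  obtain ⟨k, hk, hA⟩ := (hz.zpow (-2)).exists_inA_pow hη hη₁
  refine ⟨2 - k, _, ?_, hA, (hz.zpow (-2)).pow k⟩
  simp only [← Equiv.Perm.mul_apply, ← zpow_natCast, ← zpow_add]
  rw [show ((2 - k : ℕ) : ℤ) + (k + -2) = 0 by omega, zpow_zero, Equiv.Perm.one_apply]

/-! ### Bounded unimodular cocycles -/

section Wedge

/-- The oriented area of the parallelogram spanned by two plane vectors. -/
def wedge (v w : Fin 2 → ℝ) : ℝ := v 0 * w 1 - v 1 * w 0

lemma wedge_mulVec (A : Matrix (Fin 2) (Fin 2) ℝ) (v w : Fin 2 → ℝ) :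
    wedge (A.mulVec v) (A.mulVec w) = A.det * wedge v w := by
  simp only [wedge, Matrix.det_fin_two, Matrix.mulVec, dotProduct, Fin.sum_univ_two]
  ring

lemma abs_wedge_le (v w : Fin 2 → ℝ) : |wedge v w| ≤ 2 * ‖v‖ * ‖w‖ := by
  have hv := norm_le_pi_norm v
  have hw := norm_le_pi_norm w
  calc |wedge v w| ≤ |v 0 * w 1| + |v 1 * w 0| := abs_sub _ _
    _ = ‖v 0‖ * ‖w 1‖ + ‖v 1‖ * ‖w 0‖ := by simp only [abs_mul, Real.norm_eq_abs]
    _ ≤ ‖v‖ * ‖w‖ + ‖v‖ * ‖w‖ := by gcongr <;> apply_assumption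
    _ = 2 * ‖v‖ * ‖w‖ := by ring

lemma exists_norm_le_one_abs_wedge_eq (v : Fin 2 → ℝ) :
    ∃ w : Fin 2 → ℝ, ‖w‖ ≤ 1 ∧ |wedge v w| = ‖v‖ := by
  rw [norm_fin_two v]
  rcases le_total |v 0| |v 1| with h | h
  · exact ⟨![1, 0], by simp [norm_fin_two], by simp [wedge, h]⟩
  · exact ⟨![0, 1], by simp [norm_fin_two], by simp [wedge, h]⟩

lemma exists_eq_smul_of_wedge_eq_zero {v w : Fin 2 → ℝ} (hw : w ≠ 0) (h : wedge v w = 0) :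
    ∃ b : ℝ, v = b • w := by
  have hcross : v 0 * w 1 = v 1 * w 0 := sub_eq_zero.1 h
  by_cases hw₀ : w 0 = 0
  · have hw₁ : w 1 ≠ 0 := fun hw₁ => hw (by ext i; fin_cases i <;> assumption)
    have hv₀ : v 0 = 0 := by simpa [hw₀, hw₁] using hcross
    refine ⟨v 1 / w 1, ?_⟩
    ext i
    fin_cases i
    · simp [hw₀, hv₀]
    · simp [hw₁]
  · refine ⟨v 0 / w 0, ?_⟩
    ext i
    fin_cases i
    · simp [hw₀]
    · simp only [Fin.mk_one, Pi.smul_apply, smul_eq_mul]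
      field_simp
      exact hcross.symm

end Wedge

section Cocycle

variable {T : Equiv.Perm Torus} {D : Torus → Matrix (Fin 2) (Fin 2) ℝ} {M : ℝ}

lemma cocycle_one (z : Torus) : cocycle T D 1 z = D z := by
  simp [cocycle]

lemma cocycle_add (m k : ℕ) (z : Torus) :
    cocycle T D (m + k) z = cocycle T D k ((T ^ m) z) * cocycle T D m z := by
  induction k with
  | zero => simp [cocycle]
  | succ k ih =>
    rw [← add_assoc, cocycle, ih, cocycle, Matrix.mul_assoc, ← Equiv.Perm.mul_apply, ← pow_add,
      add_comm k m]

lemma cocycle_add_mulVec (m k : ℕ) (z : Torus) (v : Fin 2 → ℝ) :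
    (cocycle T D (m + k) z).mulVec v =
      (cocycle T D k ((T ^ m) z)).mulVec ((cocycle T D m z).mulVec v) := by
  rw [cocycle_add, Matrix.mulVec_mulVec]

/-- The matrices `D z` have determinant one, and `M ≥ 1` bounds their norms. -/
structure UnimodularBound (D : Torus → Matrix (Fin 2) (Fin 2) ℝ) (M : ℝ) : Prop where
  one_le : 1 ≤ M
  det_eq_one : ∀ z, (D z).det = 1
  norm_le : ∀ z v, ‖(D z).mulVec v‖ ≤ M * ‖v‖

namespace UnimodularBound

variable (hD : UnimodularBound D M)
include hD

lemma det_cocycle (n : ℕ) (z : Torus) : (cocycle T D n z).det = 1 := by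
  induction n with
  | zero => simp [cocycle]
  | succ n ih => rw [cocycle, Matrix.det_mul, ih, hD.det_eq_one, one_mul]

lemma wedge_cocycle (n : ℕ) (z : Torus) (v w : Fin 2 → ℝ) :
    wedge ((cocycle T D n z).mulVec v) ((cocycle T D n z).mulVec w) = wedge v w := by
  rw [wedge_mulVec, hD.det_cocycle, one_mul]

lemma norm_cocycle_le (n : ℕ) (z : Torus) (v : Fin 2 → ℝ) :
    ‖(cocycle T D n z).mulVec v‖ ≤ M ^ n * ‖v‖ := by
  have hM := hD.one_le
  induction n with
  | zero => simp [cocycle]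
  | succ n ih =>
    rw [cocycle, ← Matrix.mulVec_mulVec, pow_succ', mul_assoc]
    exact (hD.norm_le _ _).trans (by gcongr)

/- The image of a unit vector grows at most like `M ^ n`, so that preservation of areas bounds the
contraction of the transversal vectors. -/
lemma norm_le_cocycle (n : ℕ) (z : Torus) (v : Fin 2 → ℝ) :
    ‖v‖ ≤ 2 * M ^ n * ‖(cocycle T D n z).mulVec v‖ := by
  have hM := hD.one_le
  obtain ⟨w, hw, hvw⟩ := exists_norm_le_one_abs_wedge_eq v
  calc ‖v‖ = |wedge ((cocycle T D n z).mulVec v) ((cocycle T D n z).mulVec w)| := by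
        rw [hD.wedge_cocycle, hvw]
    _ ≤ 2 * ‖(cocycle T D n z).mulVec v‖ * ‖(cocycle T D n z).mulVec w‖ := abs_wedge_le _ _
    _ ≤ 2 * ‖(cocycle T D n z).mulVec v‖ * (M ^ n * 1) := by
        gcongr
        exact (hD.norm_cocycle_le n z w).trans (by gcongr)
    _ = 2 * M ^ n * ‖(cocycle T D n z).mulVec v‖ := by ring

lemma cocycle_mulVec_ne_zero (n : ℕ) (z : Torus) {v : Fin 2 → ℝ} (hv : v ≠ 0) :
    (cocycle T D n z).mulVec v ≠ 0 := fun h =>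
  hv (norm_le_zero_iff.1 (by simpa [h] using hD.norm_le_cocycle (T := T) n z v))

end UnimodularBound

end Cocycle

/-! ### The Jacobian matrices -/

section Jacobian

variable {η : ℝ} {z : Torus}

lemma exists_one_le_norm_mulVec_le (A : Matrix (Fin 2) (Fin 2) ℝ) :
    ∃ M : ℝ, 1 ≤ M ∧ ∀ v, ‖A.mulVec v‖ ≤ M * ‖v‖ := by
  let L := A.mulVecLin.toContinuousLinearMap
  exact ⟨max 1 ‖L‖, le_max_left _ _, fun v => L.le_of_opNorm_le (le_max_right _ _) v⟩

lemma exists_unimodularBound_jacH (η : ℝ) : ∃ M, UnimodularBound (jacH η) M := by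
  obtain ⟨MA, hMA, hA⟩ := exists_one_le_norm_mulVec_le (jacA η)
  obtain ⟨MB, -, hB⟩ := exists_one_le_norm_mulVec_le (jacB η)
  refine ⟨max MA MB, le_max_of_le_left hMA, fun z => ?_, fun z v => ?_⟩ <;> unfold jacH <;>
    split_ifs
  · rw [jacA_eq, Matrix.det_fin_two_of]; ring
  · rw [jacB_eq, Matrix.det_fin_two_of]; ring
  · exact (hA v).trans (by gcongr; exact le_max_left _ _)
  · exact (hB v).trans (by gcongr; exact le_max_right _ _)

lemma jacH_mulVec_of_inA (h : InA η z) (v : Fin 2 → ℝ) :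
    (jacH η z).mulVec v = ![v 0 + 1 / (1 - η) * v 1, v 0 + (1 + 1 / (1 - η)) * v 1] := by
  rw [jacH, if_pos (show rep z.2 < 1 - η from h), jacA_eq]
  ext i
  fin_cases i <;> simp [Matrix.mulVec, dotProduct, Fin.sum_univ_two]

lemma jacH_mulVec_of_not_inA (h : ¬ InA η z) (v : Fin 2 → ℝ) :
    (jacH η z).mulVec v = ![v 0 + -(1 / η) * v 1, v 0 + (1 + -(1 / η)) * v 1] := by
  rw [jacH, if_neg (show ¬ rep z.2 < 1 - η from h), jacB_eq]
  ext i
  fin_cases i <;> simp [Matrix.mulVec, dotProduct, Fin.sum_univ_two, sub_eq_add_neg]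

lemma jacH_mulVec_sub (z : Torus) (v : Fin 2 → ℝ) :
    (jacH η z).mulVec v 1 - (jacH η z).mulVec v 0 = v 1 := by
  by_cases h : InA η z
  · simp only [jacH_mulVec_of_inA h, Matrix.cons_val_zero, Matrix.cons_val_one]
    ring
  · simp only [jacH_mulVec_of_not_inA h, Matrix.cons_val_zero, Matrix.cons_val_one]
    ring

lemma jacH_mulVec_snd_of_inA (h : InA η z) (v : Fin 2 → ℝ) :
    (jacH η z).mulVec v 1 = (2 + 1 / (1 - η)) * v 1 - (v 1 - v 0) := by
  simp only [jacH_mulVec_of_inA h, Matrix.cons_val_one, Matrix.cons_val_zero]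
  ring

lemma jacH_mulVec_snd_of_not_inA (h : ¬ InA η z) (v : Fin 2 → ℝ) :
    (jacH η z).mulVec v 1 = -(1 / η - 2) * v 1 - (v 1 - v 0) := by
  simp only [jacH_mulVec_of_not_inA h, Matrix.cons_val_one, Matrix.cons_val_zero]
  ring

end Jacobian

/-! ### The backward invariant cone -/

namespace ConeData

variable {η : ℝ} (P : ConeData η)

/-- The vector with coordinates `(y, s)` has slope between `μ` and `r`. -/
def HasSlope (y s : ℝ) : Prop := ∃ ρ ∈ Icc P.μ P.r, s = ρ * y

/-- The invariant cone of `H⁻¹`, as a set of tangent vectors in the coordinates `(x, y)`. It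
contains the zero vector. -/
def InCone (v : Fin 2 → ℝ) : Prop := P.HasSlope (v 1) (v 1 - v 0)

variable {P}

lemma InCone.smul {v : Fin 2 → ℝ} (h : P.InCone v) (c : ℝ) : P.InCone (c • v) := by
  obtain ⟨ρ, hρ, hv⟩ := h
  refine ⟨ρ, hρ, ?_⟩
  simp only [Pi.smul_apply, smul_eq_mul]
  linear_combination c * hv

lemma InCone.snd_ne_zero {v : Fin 2 → ℝ} (h : P.InCone v) (hv : v ≠ 0) : v 1 ≠ 0 := by
  obtain ⟨ρ, -, hvρ⟩ := h
  intro hv₁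
  have hv₀ : v 0 = 0 := by simpa [hv₁] using hvρ
  exact hv (by ext i; fin_cases i <;> assumption)

lemma InCone.norm_eq {v : Fin 2 → ℝ} (h : P.InCone v) : ‖v‖ = |v 0| := by
  obtain ⟨ρ, hρ, hv⟩ := h
  have hρ₂ : 2 ≤ ρ := by linarith [P.lt_μ, hρ.1]
  have hv₀ : |v 0| = (ρ - 1) * |v 1| := by
    rw [show v 0 = -((ρ - 1) * v 1) by linarith, abs_neg, abs_mul,
      abs_of_nonneg (show 0 ≤ ρ - 1 by linarith)]
  rw [norm_fin_two, max_eq_left]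
  nlinarith [abs_nonneg (v 1)]

lemma mul_abs_sub_mul_le {K E ρ x y : ℝ} (hρ : 1 ≤ ρ) (hKE : K * (ρ - 1) ≤ E)
    (hx : |x| = |E * y|) : K * |y - ρ * y| ≤ |x| := by
  calc K * |y - ρ * y| = K * (ρ - 1) * |y| := by
        rw [show y - ρ * y = -((ρ - 1) * y) by ring, abs_neg, abs_mul,
          abs_of_nonneg (show 0 ≤ ρ - 1 by linarith), mul_assoc]
    _ ≤ |E| * |y| := by gcongr; exact hKE.trans (le_abs_self E)
    _ = |x| := by rw [hx, abs_mul]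

lemma HasSlope.back_A {y s : ℝ} (h : P.HasSlope ((2 + P.a) * y - s) y) :
    P.HasSlope y s ∧ P.rateA * |(2 + P.a) * y - s - y| ≤ |y - s| := by
  obtain ⟨ρ, hρ, hy⟩ := h
  have hρ₁ : 1 < ρ := P.one_lt_μ.trans_le hρ.1
  set y₁ := (2 + P.a) * y - s
  have hs : s = (2 + P.a) * y - y₁ := by linarith
  refine ⟨⟨_, P.slopeA_mem_Icc hρ.1, ?_⟩, ?_⟩
  · rw [hs, hy]
    field_simp
  · rw [hy]
    refine mul_abs_sub_mul_le hρ₁.le (P.rateA_mul_le hρ.2) ?_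
    rw [hs, hy, ← abs_neg]
    congr 1; ring

lemma HasSlope.back_AB {y s y₁ y₂ : ℝ} (hy₁ : y₁ = (2 + P.a) * y - s)
    (hy₂ : y₂ = -P.t * y₁ - y) (h : P.HasSlope y₂ y₁) :
    P.HasSlope y s ∧ P.rateAB * |y₂ - y₁| ≤ |y - s| := by
  obtain ⟨ρ, hρ, rfl⟩ := h
  have ht := P.lt_t
  have hρ₁ : 1 < ρ := P.one_lt_μ.trans_le hρ.1
  have hden : P.t * ρ + 1 ≠ 0 := by positivity
  have hy : y = -(P.t * ρ + 1) * y₂ := by linarith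
  have hs : s = (2 + P.a) * y - ρ * y₂ := by linarith
  refine ⟨⟨_, P.slopeAB_mem_Icc hρ.1 hρ.2, ?_⟩, ?_⟩
  · rw [hs, hy]
    field_simp
    ring
  · refine mul_abs_sub_mul_le hρ₁.le (P.rateAB_mul_le hρ.2) ?_
    rw [hs, hy]
    congr 1; ring

lemma HasSlope.back_ABB {y s y₁ y₂ y₃ : ℝ} (hy₁ : y₁ = (2 + P.a) * y - s)
    (hy₂ : y₂ = -P.t * y₁ - y) (hy₃ : y₃ = -P.t * y₂ - y₁) (h : P.HasSlope y₃ y₂) :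
    P.HasSlope y s ∧ P.rateABB * |y₃ - y₂| ≤ |y - s| := by
  obtain ⟨ρ, hρ, rfl⟩ := h
  have ht := P.lt_t
  have ht₂ := P.sq_t_sub_one_pos
  have hρ₁ : 1 < ρ := P.one_lt_μ.trans_le hρ.1
  have hden : (P.t ^ 2 - 1) * ρ + P.t ≠ 0 := by positivity
  have hy₁' : y₁ = -(P.t * ρ + 1) * y₃ := by linarith
  have hy : y = ((P.t ^ 2 - 1) * ρ + P.t) * y₃ := by
    rw [hy₁'] at hy₂
    linarith
  have hs : s = (2 + P.a) * y + (P.t * ρ + 1) * y₃ := by linarith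
  refine ⟨⟨_, P.slopeABB_mem_Icc hρ.1 hρ.2, ?_⟩, ?_⟩
  · rw [hs, hy]
    field_simp
  · refine mul_abs_sub_mul_le hρ₁.le (P.rateABB_mul_le hρ.2) ?_
    rw [hs, hy, ← abs_neg]
    congr 1; ring

variable (P)

/-- The rate of expansion of the cone per iterate of `H⁻¹`: a return takes at most three iterates,
which leads to the cube root of the worst return rate. -/
noncomputable def θ : ℝ := (min P.rateA (min P.rateAB P.rateABB)) ^ ((3 : ℕ) : ℝ)⁻¹

lemma one_lt_min_rate : 1 < min P.rateA (min P.rateAB P.rateABB) :=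
  lt_min (one_lt_two.trans P.two_lt_rateA)
    (lt_min (lt_trans (by norm_num) P.three_lt_rateAB) P.one_lt_rateABB)

lemma one_lt_θ : 1 < P.θ := Real.one_lt_rpow P.one_lt_min_rate (by positivity)

lemma θ_pow_three : P.θ ^ 3 = min P.rateA (min P.rateAB P.rateABB) :=
  Real.rpow_inv_natCast_pow (zero_le_one.trans P.one_lt_min_rate.le) three_ne_zero

/-- The inverse of the `n`-th derivative of `H` at `z` maps the cone into itself and expands it at
rate `θ`. -/
def BackExpands (z : Torus) (n : ℕ) : Prop :=
  ∀ v, P.InCone ((cocycle (mapH η) (jacH η) n z).mulVec v) →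
    P.InCone v ∧ P.θ ^ n * ‖(cocycle (mapH η) (jacH η) n z).mulVec v‖ ≤ ‖v‖

variable {P} {z : Torus}

lemma backExpands_zero : P.BackExpands z 0 := fun v hv => by
  simpa [cocycle] using hv

lemma BackExpands.add {m k : ℕ} (hm : P.BackExpands z m)
    (hk : P.BackExpands ((mapH η ^ m) z) k) : P.BackExpands z (m + k) := fun v hv => by
  have hθ := P.one_lt_θ
  rw [cocycle_add_mulVec] at hv ⊢
  obtain ⟨hw, hw_le⟩ := hk _ hv
  obtain ⟨hv, hv_le⟩ := hm _ hw
  refine ⟨hv, ?_⟩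
  rw [pow_add, mul_assoc]
  exact (mul_le_mul_of_nonneg_left hw_le (by positivity)).trans hv_le

lemma θ_pow_mul_norm_le {v w : Fin 2 → ℝ} {K : ℝ} {n : ℕ} (hn : n ≤ 3) (hK : P.θ ^ 3 ≤ K)
    (hw : P.InCone w) (hv : P.InCone v)
    (hle : K * |w 1 - (w 1 - w 0)| ≤ |v 1 - (v 1 - v 0)|) : P.θ ^ n * ‖w‖ ≤ ‖v‖ := by
  simp only [sub_sub_cancel] at hle
  rw [hw.norm_eq, hv.norm_eq]
  exact le_trans (by gcongr; exact (pow_le_pow_right₀ P.one_lt_θ.le hn).trans hK) hle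

lemma backExpands_one (hA : InA η z) : P.BackExpands z 1 := fun v hw => by
  rw [cocycle_one] at hw ⊢
  set v₁ := (jacH η z).mulVec v
  have hs₁ : v₁ 1 - v₁ 0 = v 1 := jacH_mulVec_sub z v
  have hy₁ : v₁ 1 = (2 + P.a) * v 1 - (v 1 - v 0) := by
    rw [P.a_eq]
    exact jacH_mulVec_snd_of_inA hA v
  obtain ⟨hv, hle⟩ := HasSlope.back_A (by rwa [← hy₁, ← hs₁])
  refine ⟨hv, θ_pow_mul_norm_le (by norm_num) (P.θ_pow_three.trans_le (min_le_left _ _)) hw hv ?_⟩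
  rwa [hs₁, hy₁]

lemma jacH_mulVec_snd (hA : ¬ InA η z) (v : Fin 2 → ℝ) :
    (jacH η z).mulVec v 1 = -P.t * v 1 - (v 1 - v 0) := by
  rw [P.t_eq]
  exact jacH_mulVec_snd_of_not_inA hA v

lemma backExpands_two (hA : InA η z) (hB : ¬ InA η (mapH η z)) : P.BackExpands z 2 :=
    fun v hw => by
  have hcocycle : (cocycle (mapH η) (jacH η) 2 z).mulVec v =
      (jacH η (mapH η z)).mulVec ((jacH η z).mulVec v) := by
    simp only [cocycle, pow_zero, pow_one, Equiv.Perm.one_apply, mul_one, Matrix.mulVec_mulVec]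
  rw [hcocycle] at hw ⊢
  set v₁ := (jacH η z).mulVec v
  set v₂ := (jacH η (mapH η z)).mulVec v₁
  have hs₁ : v₁ 1 - v₁ 0 = v 1 := jacH_mulVec_sub z v
  have hs₂ : v₂ 1 - v₂ 0 = v₁ 1 := jacH_mulVec_sub _ v₁
  have hy₁ : v₁ 1 = (2 + P.a) * v 1 - (v 1 - v 0) := by
    rw [P.a_eq]
    exact jacH_mulVec_snd_of_inA hA v
  have hy₂ : v₂ 1 = -P.t * v₁ 1 - v 1 := by
    rw [← hs₁, ← jacH_mulVec_snd hB]
  obtain ⟨hv, hle⟩ := HasSlope.back_AB hy₁ hy₂ (by rwa [← hs₂])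
  have hθ : P.θ ^ 3 ≤ P.rateAB :=
    P.θ_pow_three.trans_le ((min_le_right _ _).trans (min_le_left _ _))
  exact ⟨hv, θ_pow_mul_norm_le (by norm_num) hθ hw hv (by rwa [hs₂])⟩

lemma backExpands_three (hA : InA η z) (hB₁ : ¬ InA η (mapH η z))
    (hB₂ : ¬ InA η (mapH η (mapH η z))) : P.BackExpands z 3 := fun v hw => by
  have hcocycle : (cocycle (mapH η) (jacH η) 3 z).mulVec v =
      (jacH η (mapH η (mapH η z))).mulVec
        ((jacH η (mapH η z)).mulVec ((jacH η z).mulVec v)) := by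
    simp only [cocycle, pow_zero, pow_one, sq, Equiv.Perm.one_apply, Equiv.Perm.mul_apply,
      mul_one, Matrix.mulVec_mulVec]
  rw [hcocycle] at hw ⊢
  set v₁ := (jacH η z).mulVec v
  set v₂ := (jacH η (mapH η z)).mulVec v₁
  set v₃ := (jacH η (mapH η (mapH η z))).mulVec v₂
  have hs₁ : v₁ 1 - v₁ 0 = v 1 := jacH_mulVec_sub z v
  have hs₂ : v₂ 1 - v₂ 0 = v₁ 1 := jacH_mulVec_sub _ v₁
  have hs₃ : v₃ 1 - v₃ 0 = v₂ 1 := jacH_mulVec_sub _ v₂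
  have hy₁ : v₁ 1 = (2 + P.a) * v 1 - (v 1 - v 0) := by
    rw [P.a_eq]
    exact jacH_mulVec_snd_of_inA hA v
  have hy₂ : v₂ 1 = -P.t * v₁ 1 - v 1 := by
    rw [← hs₁, ← jacH_mulVec_snd hB₁]
  have hy₃ : v₃ 1 = -P.t * v₂ 1 - v₁ 1 := by
    rw [← hs₂, ← jacH_mulVec_snd hB₂]
  obtain ⟨hv, hle⟩ := HasSlope.back_ABB hy₁ hy₂ hy₃ (by rwa [← hs₃])
  have hθ : P.θ ^ 3 ≤ P.rateABB :=
    P.θ_pow_three.trans_le ((min_le_right _ _).trans (min_le_right _ _))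
  exact ⟨hv, θ_pow_mul_norm_le le_rfl hθ hw hv (by rwa [hs₃])⟩

lemma backExpands {n : ℕ} (hz : OffSingular η z) (hA : InA η z)
    (hn : InA η ((mapH η ^ n) z)) : P.BackExpands z n := by
  induction n using Nat.strong_induction_on generalizing z with
  | _ n ih =>
  rcases n.eq_zero_or_pos with rfl | hn_pos
  · exact backExpands_zero
  have hreturn : ∀ j, 1 ≤ j → j ≤ n → InA η ((mapH η ^ j) z) → P.BackExpands z j →
      P.BackExpands z n := by
    intro j hj hjn hAj hback
    obtain ⟨k, rfl⟩ := Nat.exists_eq_add_of_le hjn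
    refine hback.add (ih k (by omega) (hz.pow j) hAj ?_)
    rwa [← Equiv.Perm.mul_apply, ← pow_add, add_comm k j]
  by_cases hA₁ : InA η (mapH η z)
  · exact hreturn 1 le_rfl hn_pos hA₁ (backExpands_one hA)
  have hn₁ : n ≠ 1 := by
    rintro rfl
    exact hA₁ hn
  by_cases hA₂ : InA η (mapH η (mapH η z))
  · exact hreturn 2 one_le_two (by omega) hA₂ (backExpands_two hA hA₁)
  have hn₂ : n ≠ 2 := by
    rintro rfl
    exact hA₂ hn
  exact hreturn 3 (by norm_num) (by omega)
    (hz.map.inA_map_map P.pos (by linarith [P.lt]) hA₁ hA₂) (backExpands_three hA hA₁ hA₂)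

end ConeData

/-! ### Contracted directions -/

/-- The derivatives of the iterates of `T` at `z` contract the vector `w` at the rate `ℓ`. -/
def Contracts (T : Equiv.Perm Torus) (D : Torus → Matrix (Fin 2) (Fin 2) ℝ) (ℓ : ℝ) (z : Torus)
    (w : Fin 2 → ℝ) : Prop :=
  ∃ C > 0, ∀ n, ‖(cocycle T D n z).mulVec w‖ ≤ C * ℓ ^ n

section Contracts

variable {T : Equiv.Perm Torus} {D : Torus → Matrix (Fin 2) (Fin 2) ℝ} {ℓ : ℝ} {z : Torus}
  {w : Fin 2 → ℝ}

lemma Contracts.along_orbit (h : Contracts T D ℓ z w) (hℓ : 0 < ℓ) (j : ℕ) :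
    Contracts T D ℓ ((T ^ j) z) ((cocycle T D j z).mulVec w) := by
  obtain ⟨C, hC, hle⟩ := h
  refine ⟨C * ℓ ^ j, by positivity, fun n => ?_⟩
  rw [← cocycle_add_mulVec, mul_assoc, ← pow_add]
  exact hle _

end Contracts

namespace ConeData

variable {η : ℝ} (P : ConeData η) {z : Torus}

lemma hasSlope_iff (y s : ℝ) : P.HasSlope y s ↔ 0 ≤ (s - P.μ * y) * (P.r * y - s) := by
  have hμr := P.μ_lt_r
  constructor
  · rintro ⟨ρ, ⟨hμ, hr⟩, rfl⟩
    calc 0 ≤ (ρ - P.μ) * (P.r - ρ) * y ^ 2 :=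
          mul_nonneg (mul_nonneg (sub_nonneg.2 hμ) (sub_nonneg.2 hr)) (sq_nonneg y)
      _ = (ρ * y - P.μ * y) * (P.r * y - ρ * y) := by ring
  · intro h
    rcases eq_or_ne y 0 with rfl | hy
    · have hs : s = 0 := by nlinarith
      exact ⟨P.μ, ⟨le_rfl, hμr.le⟩, by simp [hs]⟩
    · have hprod : 0 ≤ (s / y - P.μ) * (P.r - s / y) := by
        rw [show (s - P.μ * y) * (P.r * y - s) = (s / y - P.μ) * (P.r - s / y) * y ^ 2 by
          field_simp] at h
        exact nonneg_of_mul_nonneg_left h (by positivity)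
      exact ⟨s / y, ⟨by nlinarith, by nlinarith⟩, by field_simp⟩

lemma isClosed_setOf_inCone : IsClosed {v | P.InCone v} := by
  simp only [InCone, hasSlope_iff]
  exact isClosed_le continuous_const (by fun_prop)

variable {P} in
lemma InCone.exists_slope {v : Fin 2 → ℝ} (h : P.InCone v) (hv : v ≠ 0) :
    ∃ ρ ∈ Icc P.μ P.r, (![1 - ρ, 1] : Fin 2 → ℝ) = (v 1)⁻¹ • v := by
  have hv₁ := h.snd_ne_zero hv
  obtain ⟨ρ, hρ, hslope⟩ := h
  refine ⟨ρ, hρ, ?_⟩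
  ext i
  fin_cases i
  · simp only [Fin.zero_eta, Matrix.cons_val_zero, Pi.smul_apply, smul_eq_mul]
    field_simp
    linarith
  · simp [hv₁]

lemma exists_slope_inCone {n : ℕ} (hz : OffSingular η z) (hA : InA η z)
    (hn : InA η ((mapH η ^ n) z)) :
    ∃ ρ ∈ Icc P.μ P.r, ∀ m ≤ n, InA η ((mapH η ^ m) z) →
      P.InCone ((cocycle (mapH η) (jacH η) m z).mulVec ![1 - ρ, 1]) := by
  obtain ⟨M, hM⟩ := exists_unimodularBound_jacH η
  obtain ⟨v, hv⟩ : ∃ v, (cocycle (mapH η) (jacH η) n z).mulVec v = ![1 - P.μ, 1] := by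
    refine ⟨(cocycle (mapH η) (jacH η) n z)⁻¹.mulVec ![1 - P.μ, 1], ?_⟩
    rw [Matrix.mulVec_mulVec, Matrix.mul_nonsing_inv _ (by simp [hM.det_cocycle]),
      Matrix.one_mulVec]
  have hcone : ∀ m ≤ n, InA η ((mapH η ^ m) z) →
      P.InCone ((cocycle (mapH η) (jacH η) m z).mulVec v) := by
    intro m hm hmA
    obtain ⟨k, rfl⟩ := Nat.exists_eq_add_of_le hm
    rw [add_comm, pow_add, Equiv.Perm.mul_apply] at hn
    refine (backExpands (hz.pow m) hmA hn _ ?_).1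
    rw [← cocycle_add_mulVec, hv]
    exact ⟨P.μ, ⟨le_rfl, P.μ_lt_r.le⟩, by simp⟩
  have hv_ne : v ≠ 0 := by
    rintro rfl
    simpa using congrFun hv 1
  have hv_cone : P.InCone v := by simpa [cocycle] using hcone 0 n.zero_le hA
  obtain ⟨ρ, hρ, heq⟩ := hv_cone.exists_slope hv_ne
  refine ⟨ρ, hρ, fun m hm hmA => ?_⟩
  rw [heq, Matrix.mulVec_smul]
  exact (hcone m hm hmA).smul _

lemma exists_inCone_forever (hz : OffSingular η z) (hA : InA η z) :
    ∃ w ≠ 0, ∀ n, InA η ((mapH η ^ n) z) →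
      P.InCone ((cocycle (mapH η) (jacH η) n z).mulVec w) := by
  let S (N : ℕ) : Set ℝ := {ρ | ρ ∈ Icc P.μ P.r ∧ ∀ n ≤ N, InA η ((mapH η ^ n) z) →
    P.InCone ((cocycle (mapH η) (jacH η) n z).mulVec ![1 - ρ, 1])}
  have hclosed : ∀ N, IsClosed (S N) := by
    intro N
    simp only [S, ofPred_and, ofPred_forall]
    refine isClosed_Icc.inter <| isClosed_iInter fun n => isClosed_iInter fun _ =>
      isClosed_iInter fun _ => P.isClosed_setOf_inCone.preimage ?_
    fun_prop
  have hnonempty : ∀ N, (S N).Nonempty := by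
    intro N
    obtain ⟨k, -, hk⟩ := (hz.pow N).exists_inA_pow P.pos (by linarith [P.lt])
    rw [← Equiv.Perm.mul_apply, ← pow_add] at hk
    obtain ⟨ρ, hρ, hcone⟩ := P.exists_slope_inCone hz hA hk
    exact ⟨ρ, hρ, fun n hn => hcone n (by omega)⟩
  obtain ⟨ρ, hρ⟩ := IsCompact.nonempty_iInter_of_sequence_nonempty_isCompact_isClosed S
    (fun N ρ h => ⟨h.1, fun n hn => h.2 n (hn.trans N.le_succ)⟩) hnonempty
    (isCompact_Icc.of_isClosed_subset (hclosed 0) fun ρ h => h.1) hclosed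
  refine ⟨![1 - ρ, 1], fun h => ?_, fun n hn => (mem_iInter.1 hρ n).2 n le_rfl hn⟩
  simpa using congrFun h 1

lemma exists_inCone_contracts (hz : OffSingular η z) (hA : InA η z) :
    ∃ w ≠ 0, P.InCone w ∧ Contracts (mapH η) (jacH η) P.θ⁻¹ z w := by
  obtain ⟨w, hw, hcone⟩ := P.exists_inCone_forever hz hA
  obtain ⟨M, hM⟩ := exists_unimodularBound_jacH η
  have hM₁ := hM.one_le
  have hθ := P.one_lt_θ
  have hvisit : ∀ n, InA η ((mapH η ^ n) z) →
      ‖(cocycle (mapH η) (jacH η) n z).mulVec w‖ ≤ ‖w‖ * P.θ⁻¹ ^ n := by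
    intro n hn
    rw [inv_pow, ← div_eq_mul_inv, le_div_iff₀' (by positivity)]
    exact (backExpands hz hA hn w (hcone n hn)).2
  refine ⟨w, hw, by simpa [cocycle] using hcone 0 hA, 2 * M ^ 2 * ‖w‖, by positivity,
    fun n => ?_⟩
  obtain ⟨k, hk, hkA⟩ := (hz.pow n).exists_inA_pow P.pos (by linarith [P.lt])
  rw [← Equiv.Perm.mul_apply, ← pow_add, add_comm k n] at hkA
  calc ‖(cocycle (mapH η) (jacH η) n z).mulVec w‖
      ≤ 2 * M ^ k * ‖(cocycle (mapH η) (jacH η) (n + k) z).mulVec w‖ := by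
        rw [cocycle_add_mulVec]
        exact hM.norm_le_cocycle k _ _
    _ ≤ 2 * M ^ 2 * (‖w‖ * P.θ⁻¹ ^ n) := by
        gcongr ?_ * ?_
        · gcongr
        · refine (hvisit _ hkA).trans ?_
          gcongr ?_ * ?_
          exact pow_le_pow_of_le_one (by positivity) (inv_le_one_of_one_le₀ hθ.le) (by omega)
    _ = 2 * M ^ 2 * ‖w‖ * P.θ⁻¹ ^ n := by ring

lemma exists_contracts (hz : OffSingular η z) :
    ∃ w ≠ 0, Contracts (mapH η) (jacH η) P.θ⁻¹ z w := by
  obtain ⟨M, hM⟩ := exists_unimodularBound_jacH η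
  obtain ⟨j, z', rfl, hA, hz'⟩ := hz.exists_inA P.pos (by linarith [P.lt])
  obtain ⟨w, hw, -, hcontr⟩ := P.exists_inCone_contracts hz' hA
  exact ⟨_, hM.cocycle_mulVec_ne_zero j z' hw,
    hcontr.along_orbit (inv_pos.2 (one_pos.trans P.one_lt_θ)) j⟩

end ConeData

/-! ### Lyapunov exponents -/

section GrowthRate

/-- The exponential growth rate `log (u n) / n`, with the value `0` at `n = 0`. -/
noncomputable def growthRate (u : ℕ → ℝ) (n : ℕ) : ℝ := (1 / (n : ℝ)) * Real.log (u n)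

variable {u v : ℕ → ℝ} {C m : ℝ}

lemma tendsto_growthRate_const (C : ℝ) : Tendsto (growthRate fun _ => C) atTop (𝓝 0) := by
  rw [← zero_mul (Real.log C)]
  exact (tendsto_one_div_atTop_nhds_zero_nat (𝕜 := ℝ)).mul_const (Real.log C)

lemma growthRate_mul (hu : ∀ n, 0 < u n) (hv : ∀ n, 0 < v n) :
    growthRate (fun n => u n * v n) = growthRate u + growthRate v := by
  ext n
  simp only [growthRate, Pi.add_apply]
  rw [Real.log_mul (hu n).ne' (hv n).ne', mul_add]

lemma tendsto_growthRate_const_mul_pow (hC : 0 < C) (hm : 0 < m) :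
    Tendsto (growthRate fun n => C * m ^ n) atTop (𝓝 (Real.log m)) := by
  rw [growthRate_mul (fun _ => hC) fun n => pow_pos hm n, ← zero_add (Real.log m)]
  refine (tendsto_growthRate_const C).add (tendsto_const_nhds.congr' ?_)
  filter_upwards [eventually_ne_atTop 0] with n hn
  rw [growthRate, Real.log_pow]
  field_simp

lemma growthRate_le (hu : ∀ n, 0 < u n) (h : ∀ n, u n ≤ v n) : growthRate u ≤ growthRate v :=
  fun n => mul_le_mul_of_nonneg_left (Real.log_le_log (hu n) (h n)) (by positivity)

lemma isBoundedUnder_le_growthRate (hC : 0 < C) (hm : 0 < m) (hu : ∀ n, 0 < u n)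
    (h : ∀ n, u n ≤ C * m ^ n) : IsBoundedUnder (· ≤ ·) atTop (growthRate u) :=
  (tendsto_growthRate_const_mul_pow hC hm).isBoundedUnder_le.mono_le
    (Eventually.of_forall (growthRate_le hu h))

lemma isBoundedUnder_ge_growthRate (hC : 0 < C) (hm : 0 < m) (h : ∀ n, C * m ^ n ≤ u n) :
    IsBoundedUnder (· ≥ ·) atTop (growthRate u) :=
  (tendsto_growthRate_const_mul_pow hC hm).isBoundedUnder_ge.mono_ge
    (Eventually.of_forall (growthRate_le (fun _ => by positivity) h))

lemma limsup_growthRate_le (hC : 0 < C) (hm : 0 < m) (h : ∀ n, u n ≤ C * m ^ n)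
    (hu : ∀ n, 0 < u n) (hu_ge : IsBoundedUnder (· ≥ ·) atTop (growthRate u)) :
    limsup (growthRate u) atTop ≤ Real.log m := by
  have hlim := tendsto_growthRate_const_mul_pow hC hm
  rw [← hlim.limsup_eq]
  exact limsup_le_limsup (Eventually.of_forall (growthRate_le hu h)) hu_ge.isCoboundedUnder_le
    hlim.isBoundedUnder_le

lemma le_limsup_growthRate (hC : 0 < C) (hm : 0 < m) (h : ∀ n, C * m ^ n ≤ u n)
    (hu_le : IsBoundedUnder (· ≤ ·) atTop (growthRate u)) :
    Real.log m ≤ limsup (growthRate u) atTop := by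
  have hlim := tendsto_growthRate_const_mul_pow hC hm
  rw [← hlim.limsup_eq]
  exact limsup_le_limsup (Eventually.of_forall (growthRate_le (fun _ => by positivity) h))
    hlim.isCoboundedUnder_le hu_le

lemma limsup_add_of_tendsto_zero {d : ℕ → ℝ} (hu_le : IsBoundedUnder (· ≤ ·) atTop u)
    (hu_ge : IsBoundedUnder (· ≥ ·) atTop u) (hd : Tendsto d atTop (𝓝 0)) :
    limsup (u + d) atTop = limsup u atTop := by
  refine le_antisymm ?_ ?_
  · simpa only [hd.limsup_eq, add_zero] using limsup_add_le hu_ge hu_le hd.isCoboundedUnder_le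
      hd.isBoundedUnder_le
  · simpa only [hd.liminf_eq, add_zero] using le_limsup_add hu_le hu_ge.isCoboundedUnder_le
      hd.isBoundedUnder_le hd.isBoundedUnder_ge

lemma limsup_growthRate_congr {K : ℝ} (hK : 0 < K) (hu : ∀ n, 0 < u n) (hv : ∀ n, 0 < v n)
    (huv : ∀ n, u n ≤ K * v n) (hvu : ∀ n, v n ≤ K * u n)
    (hv_le : IsBoundedUnder (· ≤ ·) atTop (growthRate v))
    (hv_ge : IsBoundedUnder (· ≥ ·) atTop (growthRate v)) :
    limsup (growthRate u) atTop = limsup (growthRate v) atTop := by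
  have hconst := tendsto_growthRate_const K
  have hle : growthRate u ≤ growthRate (fun _ => K) + growthRate v := by
    rw [← growthRate_mul (fun _ => hK) hv]
    exact growthRate_le hu huv
  have hge : growthRate v ≤ growthRate (fun _ => K) + growthRate u := by
    rw [← growthRate_mul (fun _ => hK) hu]
    exact growthRate_le hv hvu
  have hdiff : Tendsto (growthRate u - growthRate v) atTop (𝓝 0) := by
    refine tendsto_of_tendsto_of_tendsto_of_le_of_le (by simpa using hconst.neg) hconst
      (fun n => ?_) fun n => ?_
    · exact neg_le_sub_iff_le_add.2 (by simpa [add_comm] using hge n)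
    · exact sub_le_iff_le_add.2 (hle n)
  rw [← limsup_add_of_tendsto_zero hv_le hv_ge hdiff, add_sub_cancel]

end GrowthRate

namespace UnimodularBound

variable {T : Equiv.Perm Torus} {D : Torus → Matrix (Fin 2) (Fin 2) ℝ} {M ℓ : ℝ}
  (hD : UnimodularBound D M) (z : Torus) {v w : Fin 2 → ℝ}
include hD

lemma norm_cocycle_pos (hv : v ≠ 0) (n : ℕ) : 0 < ‖(cocycle T D n z).mulVec v‖ :=
  norm_pos_iff.2 (hD.cocycle_mulVec_ne_zero n z hv)

lemma isBoundedUnder_le_growthRate_cocycle (hv : v ≠ 0) :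
    IsBoundedUnder (· ≤ ·) atTop (growthRate fun n => ‖(cocycle T D n z).mulVec v‖) :=
  isBoundedUnder_le_growthRate (norm_pos_iff.2 hv) (one_pos.trans_le hD.one_le)
    (hD.norm_cocycle_pos z hv) fun n => (hD.norm_cocycle_le n z v).trans_eq (mul_comm _ _)

lemma isBoundedUnder_ge_growthRate_cocycle (hv : v ≠ 0) :
    IsBoundedUnder (· ≥ ·) atTop (growthRate fun n => ‖(cocycle T D n z).mulVec v‖) := by
  have hM := hD.one_le
  refine isBoundedUnder_ge_growthRate (C := ‖v‖ / 2) (m := M⁻¹) (by positivity) (by positivity)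
    fun n => ?_
  rw [inv_pow, ← div_eq_mul_inv, div_div, div_le_iff₀' (by positivity)]
  exact hD.norm_le_cocycle n z v

lemma lyapunov_neg (hv : v ≠ 0) (hℓ₀ : 0 < ℓ) (hℓ₁ : ℓ < 1) (h : Contracts T D ℓ z v) :
    lyapunov T D z v < 0 := by
  obtain ⟨C, hC, hle⟩ := h
  exact (limsup_growthRate_le hC hℓ₀ hle (hD.norm_cocycle_pos z hv)
    (hD.isBoundedUnder_ge_growthRate_cocycle z hv)).trans_lt (Real.log_neg hℓ₀ hℓ₁)

/- Areas are preserved, so that a vector transversal to a contracted one is expanded. -/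
lemma lyapunov_pos (hℓ₀ : 0 < ℓ) (hℓ₁ : ℓ < 1) (h : Contracts T D ℓ z w) (hv : wedge v w ≠ 0) :
    0 < lyapunov T D z v := by
  obtain ⟨C, hC, hle⟩ := h
  have hv₀ : v ≠ 0 := by
    rintro rfl
    simp [wedge] at hv
  have hgrow : ∀ n, |wedge v w| / (2 * C) * ℓ⁻¹ ^ n ≤ ‖(cocycle T D n z).mulVec v‖ := by
    intro n
    rw [inv_pow, ← div_eq_mul_inv, div_div, div_le_iff₀ (by positivity)]
    calc |wedge v w|
        = |wedge ((cocycle T D n z).mulVec v) ((cocycle T D n z).mulVec w)| := by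
          rw [hD.wedge_cocycle]
      _ ≤ 2 * ‖(cocycle T D n z).mulVec v‖ * ‖(cocycle T D n z).mulVec w‖ := abs_wedge_le _ _
      _ ≤ 2 * ‖(cocycle T D n z).mulVec v‖ * (C * ℓ ^ n) := by gcongr; exact hle n
      _ = ‖(cocycle T D n z).mulVec v‖ * (2 * C * ℓ ^ n) := by ring
  exact (Real.log_pos (one_lt_inv₀ hℓ₀ |>.2 hℓ₁)).trans_le
    (le_limsup_growthRate (by positivity) (inv_pos.2 hℓ₀) hgrow
      (hD.isBoundedUnder_le_growthRate_cocycle z hv₀))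

variable (hw : w ≠ 0) (hℓ₀ : 0 < ℓ) (hℓ₁ : ℓ < 1) (h : Contracts T D ℓ z w) (hv : v ≠ 0)
include hℓ₀ hℓ₁ h hw hv

lemma lyapunov_ne_zero : lyapunov T D z v ≠ 0 := by
  by_cases hvw : wedge v w = 0
  · obtain ⟨b, rfl⟩ := exists_eq_smul_of_wedge_eq_zero hw hvw
    obtain ⟨C, hC, hle⟩ := h
    have hb : 0 < |b| := abs_pos.2 (left_ne_zero_of_smul hv)
    refine (hD.lyapunov_neg z hv hℓ₀ hℓ₁ ⟨|b| * C, by positivity, fun n => ?_⟩).ne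
    rw [Matrix.mulVec_smul, norm_smul, Real.norm_eq_abs, mul_assoc]
    gcongr
    exact hle n
  · exact (hD.lyapunov_pos z hℓ₀ hℓ₁ h hvw).ne'

omit hv in
lemma exists_eq_smul_of_lyapunov_neg (hneg : lyapunov T D z v < 0) : ∃ b : ℝ, v = b • w :=
  exists_eq_smul_of_wedge_eq_zero hw <| by
    by_contra hvw
    exact hneg.not_gt (hD.lyapunov_pos z hℓ₀ hℓ₁ h hvw)

end UnimodularBound

namespace ConeData

variable {η : ℝ} (P : ConeData η)

lemma inv_θ_pos : 0 < P.θ⁻¹ := inv_pos.2 (one_pos.trans P.one_lt_θ)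

lemma inv_θ_lt_one : P.θ⁻¹ < 1 := inv_lt_one_of_one_lt₀ P.one_lt_θ

include P in
lemma lyapunov_ne_zero {z : Torus} {v : Fin 2 → ℝ} (hz : OffSingular η z) (hv : v ≠ 0) :
    lyapunov (mapH η) (jacH η) z v ≠ 0 := by
  obtain ⟨M, hM⟩ := exists_unimodularBound_jacH η
  obtain ⟨w, hw, hcontr⟩ := P.exists_contracts hz
  exact hM.lyapunov_ne_zero z hw P.inv_θ_pos P.inv_θ_lt_one hcontr hv

end ConeData

/-! ### Reversibility -/

section Reversibility

/-- The linear involution `(x, y) ↦ (-x, y - x)`, which conjugates `H` to its inverse. -/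
def revT : Equiv.Perm Torus where
  toFun z := (-z.1, z.2 - z.1)
  invFun z := (-z.1, z.2 - z.1)
  left_inv z := by ext <;> simp
  right_inv z := by ext <;> simp

/-- The matrix of the involution `revT`. -/
def revM : Matrix (Fin 2) (Fin 2) ℝ := !![-1, 0; -1, 1]

variable {η : ℝ}

lemma revT_pt (y s : ℝ) : revT (pt y s) = pt s y := by
  unfold pt revT
  ext <;> simp only [Equiv.coe_fn_mk, AddCircle.coe_sub] <;> abel

lemma revT_revT (z : Torus) : revT (revT z) = z := revT.left_inv z

lemma mapH_inv_apply (η : ℝ) (z : Torus) : (mapH η)⁻¹ z = revT (mapH η (revT z)) := by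
  obtain ⟨y, s, rfl⟩ := exists_eq_pt z
  rw [revT_pt, mapH_pt, revT_pt, mapH_inv_pt]

lemma mapH_inv_eq_conj (η : ℝ) : (mapH η)⁻¹ = revT * mapH η * revT⁻¹ :=
  Equiv.ext (mapH_inv_apply η)

lemma mapH_inv_pow_apply (η : ℝ) (n : ℕ) (z : Torus) :
    ((mapH η)⁻¹ ^ n) z = revT ((mapH η ^ n) (revT z)) := by
  rw [mapH_inv_eq_conj, conj_pow]
  rfl

lemma zpow_mapH_revT (η : ℝ) (n : ℤ) (z : Torus) :
    (mapH η ^ n) (revT z) = revT ((mapH η ^ (-n)) z) := by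
  rw [zpow_neg, ← inv_zpow, mapH_inv_eq_conj, conj_zpow]
  change _ = revT (revT ((mapH η ^ n) (revT z)))
  rw [revT_revT]

lemma OffSingular.revT {z : Torus} (h : OffSingular η z) :
    OffSingular η (ToralShear.revT z) := by
  intro n hn
  rw [zpow_mapH_revT] at hn
  have hsnd : (ToralShear.revT ((mapH η ^ (-n)) z)).2 = ((mapH η ^ (-1 + -n)) z).2 := by
    rw [zpow_add, zpow_neg_one, Equiv.Perm.mul_apply, mapH_inv_snd]
    rfl
  refine h (-1 + -n) ?_
  rwa [singularSet, mem_ofPred_eq, ← hsnd]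

lemma revM_mulVec (v : Fin 2 → ℝ) : revM.mulVec v = ![-v 0, v 1 - v 0] := by
  ext i
  fin_cases i <;> simp [revM, Matrix.mulVec, dotProduct, Fin.sum_univ_two]
  ring

lemma revM_mulVec_revM (v : Fin 2 → ℝ) : revM.mulVec (revM.mulVec v) = v := by
  rw [revM_mulVec, revM_mulVec]
  ext i
  fin_cases i <;> simp

lemma revM_mulVec_ne_zero {v : Fin 2 → ℝ} (hv : v ≠ 0) : revM.mulVec v ≠ 0 := fun h =>
  hv (by rw [← revM_mulVec_revM v, h, Matrix.mulVec_zero])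

lemma norm_revM_mulVec_le (v : Fin 2 → ℝ) : ‖revM.mulVec v‖ ≤ 2 * ‖v‖ := by
  have hv₀ : |v 0| ≤ ‖v‖ := norm_le_pi_norm v 0
  have hv₁ : |v 1| ≤ ‖v‖ := norm_le_pi_norm v 1
  rw [norm_fin_two (revM.mulVec v), revM_mulVec]
  refine max_le ?_ ((abs_sub _ _).trans ?_)
  · rw [Matrix.cons_val_zero, abs_neg]
    linarith [norm_nonneg v]
  · linarith

lemma norm_le_revM_mulVec (v : Fin 2 → ℝ) : ‖v‖ ≤ 2 * ‖revM.mulVec v‖ := by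
  simpa only [revM_mulVec_revM] using norm_revM_mulVec_le (revM.mulVec v)

lemma jacHinv_mulVec (η : ℝ) (z : Torus) (v : Fin 2 → ℝ) :
    (jacHinv η z).mulVec v = revM.mulVec ((jacH η (revT z)).mulVec (revM.mulVec v)) := by
  have hsnd : ((mapH η)⁻¹ z).2 = (revT z).2 := mapH_inv_snd η z
  rw [jacHinv, jacH, jacH, hsnd, revM_mulVec v, revM_mulVec]
  split_ifs
  · rw [jacA_inv, jacA_eq]
    ext i
    fin_cases i <;> simp [Matrix.mulVec, dotProduct, Fin.sum_univ_two] <;> ring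
  · rw [jacB_inv, jacB_eq]
    ext i
    fin_cases i <;> simp [Matrix.mulVec, dotProduct, Fin.sum_univ_two] <;> ring

lemma cocycle_inv_mulVec (η : ℝ) (n : ℕ) (z : Torus) (v : Fin 2 → ℝ) :
    (cocycle (mapH η)⁻¹ (jacHinv η) n z).mulVec v =
      revM.mulVec ((cocycle (mapH η) (jacH η) n (revT z)).mulVec (revM.mulVec v)) := by
  induction n with
  | zero => simp only [cocycle, Matrix.one_mulVec, revM_mulVec_revM]
  | succ n ih =>
    rw [cocycle, cocycle, ← Matrix.mulVec_mulVec, ih, jacHinv_mulVec, mapH_inv_pow_apply, revT_revT,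
      revM_mulVec_revM, ← Matrix.mulVec_mulVec]

lemma lyapunov_inv (z : Torus) {v : Fin 2 → ℝ} (hv : v ≠ 0) :
    lyapunov (mapH η)⁻¹ (jacHinv η) z v =
      lyapunov (mapH η) (jacH η) (revT z) (revM.mulVec v) := by
  obtain ⟨M, hM⟩ := exists_unimodularBound_jacH η
  have hv' := revM_mulVec_ne_zero hv
  refine limsup_growthRate_congr two_pos (fun n => ?_) (hM.norm_cocycle_pos _ hv')
    (fun n => ?_) (fun n => ?_) (hM.isBoundedUnder_le_growthRate_cocycle _ hv')
    (hM.isBoundedUnder_ge_growthRate_cocycle _ hv') <;> rw [cocycle_inv_mulVec]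
  · exact norm_pos_iff.2 (revM_mulVec_ne_zero (hM.cocycle_mulVec_ne_zero n _ hv'))
  · exact norm_revM_mulVec_le _
  · exact norm_le_revM_mulVec _

lemma revT_add_proj (z : Torus) (v : Fin 2 → ℝ) :
    revT (z + proj v) = revT z + proj (revM.mulVec v) := by
  rw [revM_mulVec]
  unfold revT proj
  ext <;> simp <;> abel

lemma revT_image_seg (z : Torus) (v : Fin 2 → ℝ) (a b : ℝ) :
    revT '' seg z v a b = seg (revT z) (revM.mulVec v) a b := by
  simp only [seg, image_image, revT_add_proj, Matrix.mulVec_smul]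

end Reversibility

/-! ### Local stable and unstable manifolds -/

/-- The distance from `z` to the singular set, measured along the vertical circle. -/
noncomputable def singDist (η : ℝ) (z : Torus) : ℝ :=
  min ‖z.2‖ ‖z.2 - ((1 - η : ℝ) : UnitAddCircle)‖

/-- The forward orbit of `z` approaches the singular set at most at the exponential rate `ℓ`. -/
def SlowApproach (η ℓ : ℝ) (z : Torus) : Prop :=
  ∃ δ > 0, ∀ n : ℕ, δ * ℓ ^ n ≤ singDist η ((mapH η ^ n) z)

section LocalManifolds

variable {η ℓ : ℝ} {z : Torus} {u w : Fin 2 → ℝ}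

lemma singDist_pos (hz : z ∉ singularSet η) : 0 < singDist η z :=
  lt_min (norm_pos_iff.2 fun h => hz (Or.inl h))
    (norm_pos_iff.2 fun h => hz (Or.inr (sub_eq_zero.1 h)))

lemma norm_coe_le (y : ℝ) : ‖(y : UnitAddCircle)‖ ≤ |y| := QuotientAddGroup.norm_mk_le_norm

lemma dist_proj_le (u v : Fin 2 → ℝ) : dist (proj u) (proj v) ≤ ‖u - v‖ := by
  rw [Prod.dist_eq, dist_eq_norm, dist_eq_norm]
  exact max_le ((norm_coe_le (u 0 - v 0)).trans (norm_le_pi_norm (u - v) 0))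
    ((norm_coe_le (u 1 - v 1)).trans (norm_le_pi_norm (u - v) 1))

lemma singDist_le_of_nonneg {y : ℝ} (hy : z.2 = y) (hy₀ : 0 ≤ y) (hy₁ : y ≤ 1 - η) :
    singDist η z ≤ y ∧ singDist η z ≤ 1 - η - y := by
  rw [singDist, hy, ← AddCircle.coe_sub]
  refine ⟨(min_le_left _ _).trans ((norm_coe_le y).trans_eq (abs_of_nonneg hy₀)),
    (min_le_right _ _).trans ((norm_coe_le _).trans_eq ?_)⟩
  rw [abs_of_nonpos (by linarith), neg_sub]

lemma singDist_le_of_nonpos {y : ℝ} (hy : z.2 = y) (hy₀ : -η ≤ y) (hy₁ : y ≤ 0) :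
    singDist η z ≤ -y ∧ singDist η z ≤ y + η := by
  have hcoe : (y : UnitAddCircle) - ((1 - η : ℝ) : UnitAddCircle) = ((y + η : ℝ)) := by
    rw [← AddCircle.coe_sub, ← coe_add_int (y - (1 - η)) 1]
    congr 1; push_cast; ring
  rw [singDist, hy, hcoe]
  exact ⟨(min_le_left _ _).trans ((norm_coe_le y).trans_eq (abs_of_nonpos hy₁)),
    (min_le_right _ _).trans ((norm_coe_le _).trans_eq (abs_of_nonneg (by linarith)))⟩

lemma exists_affine_branch (hη : 0 < η) (hη₁ : η < 1) (hz : z ∉ singularSet η) :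
    ∃ y s b : ℝ, z = pt y s ∧ (∀ u, (jacH η z).mulVec u 1 = b * u 1 - (u 1 - u 0)) ∧
      ∀ y', |y' - y| ≤ singDist η z → ∀ s', mapH η (pt y' s') = pt (b * y' - s') y' := by
  by_cases hA : InA η z
  · obtain ⟨y, hy, hy₀, hy₁⟩ := hA.exists_lift hz
    obtain ⟨s, hs⟩ := exists_eq_pt_of_snd hy
    obtain ⟨hd, hd'⟩ := singDist_le_of_nonneg hy hy₀.le hy₁.le
    refine ⟨y, s, 2 + 1 / (1 - η), hs, jacH_mulVec_snd_of_inA hA, fun y' hy' s' => ?_⟩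
    obtain ⟨hl, hr⟩ := abs_le.1 hy'
    exact mapH_pt_of_nonneg hη (by linarith) (by linarith) s'
  · obtain ⟨y, hy, hy₀, hy₁⟩ := exists_lift_of_not_inA hA hz
    obtain ⟨s, hs⟩ := exists_eq_pt_of_snd hy
    obtain ⟨hd, hd'⟩ := singDist_le_of_nonpos hy hy₀.le hy₁.le
    refine ⟨y, s, -(1 / η - 2), hs, jacH_mulVec_snd_of_not_inA hA, fun y' hy' s' => ?_⟩
    obtain ⟨hl, hr⟩ := abs_le.1 hy'
    exact mapH_pt_of_nonpos hη hη₁ (by linarith) (by linarith) s'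

lemma mapH_add_proj (hη : 0 < η) (hη₁ : η < 1) (hz : z ∉ singularSet η)
    (hu : |u 1| ≤ singDist η z) :
    mapH η (z + proj u) = mapH η z + proj ((jacH η z).mulVec u) := by
  obtain ⟨y, s, b, hzy, hjac, hmap⟩ := exists_affine_branch hη hη₁ hz
  have hmap_z : mapH η z = pt (b * y - s) y := by
    rw [hzy]
    exact hmap y (by rw [sub_self, abs_zero]; exact (singDist_pos hz).le) s
  have hzu : z + proj u = pt (y + u 1) (s + (u 1 - u 0)) := by rw [hzy, pt_add_proj]
  rw [hzu, hmap _ (by rwa [add_sub_cancel_left]), hmap_z, pt_add_proj, jacH_mulVec_sub, hjac]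
  congr 1; ring

lemma mapH_pow_add_proj (hη : 0 < η) (hη₁ : η < 1) (hz : OffSingular η z)
    (hu : ∀ n, |(cocycle (mapH η) (jacH η) n z).mulVec u 1| ≤ singDist η ((mapH η ^ n) z))
    (n : ℕ) : (mapH η ^ n) (z + proj u) =
      (mapH η ^ n) z + proj ((cocycle (mapH η) (jacH η) n z).mulVec u) := by
  induction n with
  | zero => simp [cocycle]
  | succ n ih =>
    rw [pow_succ', Equiv.Perm.mul_apply, ih, mapH_add_proj hη hη₁ (hz.pow n).notMem (hu n), cocycle,
      ← Matrix.mulVec_mulVec, Equiv.Perm.mul_apply]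

lemma Contracts.exists_isStableManifold (h : Contracts (mapH η) (jacH η) ℓ z w) (hη : 0 < η)
    (hη₁ : η < 1) (hz : OffSingular η z) (hs : SlowApproach η ℓ z) (hℓ₀ : 0 < ℓ) (hℓ₁ : ℓ < 1)
    (hw : w ≠ 0) : ∃ γ, IsStableManifold η z γ := by
  obtain ⟨M, hM⟩ := exists_unimodularBound_jacH η
  have hneg := hM.lyapunov_neg z hw hℓ₀ hℓ₁ h
  obtain ⟨C, hC, hle⟩ := h
  obtain ⟨δ, hδ, hδ_le⟩ := hs
  refine ⟨seg z w (δ / C) (δ / C), ⟨w, _, _, hw, hneg, by positivity, by positivity, rfl⟩, ?_⟩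
  have haffine : ∀ t ∈ Icc (-(δ / C)) (δ / C), ∀ n : ℕ, (mapH η ^ n) (z + proj (t • w)) =
      (mapH η ^ n) z + proj (t • (cocycle (mapH η) (jacH η) n z).mulVec w) := by
    intro t ht n
    rw [← Matrix.mulVec_smul]
    refine mapH_pow_add_proj hη hη₁ hz (fun m => le_trans ?_ (hδ_le m)) n
    rw [Matrix.mulVec_smul, Pi.smul_apply, smul_eq_mul, abs_mul]
    calc |t| * |(cocycle (mapH η) (jacH η) m z).mulVec w 1| ≤ δ / C * (C * ℓ ^ m) :=
          mul_le_mul (abs_le.2 ht) ((norm_le_pi_norm _ 1).trans (hle m)) (abs_nonneg _)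
            (by positivity)
      _ = δ * ℓ ^ m := by field_simp
  rintro _ ⟨t, ht, rfl⟩ _ ⟨t', ht', rfl⟩
  have hlim : Tendsto (fun n : ℕ => |t - t'| * (C * ℓ ^ n)) atTop (𝓝 0) := by
    simpa only [mul_zero] using
      ((tendsto_pow_atTop_nhds_zero_of_lt_one hℓ₀.le hℓ₁).const_mul C).const_mul |t - t'|
  refine squeeze_zero (fun n => dist_nonneg) (fun n => ?_) hlim
  rw [haffine t ht n, haffine t' ht' n, dist_add_left]
  refine (dist_proj_le _ _).trans ?_
  rw [← sub_smul, norm_smul]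
  exact mul_le_mul_of_nonneg_left (hle n) (abs_nonneg _)

lemma dist_revT_le (p q : Torus) : dist (revT p) (revT q) ≤ 2 * dist p q := by
  have hfst : dist p.1 q.1 ≤ dist p q := le_max_left _ _
  have hsnd : dist p.2 q.2 ≤ dist p q := le_max_right _ _
  refine max_le ?_ ?_
  · change dist (-p.1) (-q.1) ≤ _
    rw [dist_neg_neg]
    linarith [dist_nonneg (x := p) (y := q)]
  · change dist (p.2 - p.1) (q.2 - q.1) ≤ _
    linarith [dist_sub_sub_le p.2 p.1 q.2 q.1]

lemma tendsto_dist_revT {p q : ℕ → Torus}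
    (h : Tendsto (fun n => dist (p n) (q n)) atTop (𝓝 0)) :
    Tendsto (fun n => dist (revT (p n)) (revT (q n))) atTop (𝓝 0) :=
  squeeze_zero (fun _ => dist_nonneg) (fun n => dist_revT_le (p n) (q n))
    (by simpa only [mul_zero] using h.const_mul 2)

lemma isUnstableManifold_iff {γ : Set Torus} :
    IsUnstableManifold η z γ ↔ IsStableManifold η (revT z) (revT '' γ) := by
  constructor
  · rintro ⟨⟨v, a, b, hv, hneg, ha, hb, rfl⟩, hlim⟩
    refine ⟨⟨revM.mulVec v, a, b, revM_mulVec_ne_zero hv, by rwa [← lyapunov_inv z hv], ha, hb,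
      revT_image_seg z v a b⟩, ?_⟩
    rintro _ ⟨ζ, hζ, rfl⟩ _ ⟨ζ', hζ', rfl⟩
    simpa only [mapH_inv_pow_apply, revT_revT] using tendsto_dist_revT (hlim ζ hζ ζ' hζ')
  · rintro ⟨⟨v, a, b, hv, hneg, ha, hb, hγ⟩, hlim⟩
    have hv' := revM_mulVec_ne_zero hv
    refine ⟨⟨revM.mulVec v, a, b, hv', by rwa [lyapunov_inv z hv', revM_mulVec_revM], ha, hb, ?_⟩,
      fun ζ hζ ζ' hζ' => ?_⟩
    · rw [← revT.injective.image_injective.eq_iff, hγ, revT_image_seg, revM_mulVec_revM]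
    · simpa only [mapH_inv_pow_apply] using
        tendsto_dist_revT (hlim _ (mem_image_of_mem revT hζ) _ (mem_image_of_mem revT hζ'))

namespace ConeData

variable (P : ConeData η)

lemma exists_isStableManifold (hz : OffSingular η z) (hs : SlowApproach η P.θ⁻¹ z) :
    ∃ γ, IsStableManifold η z γ := by
  obtain ⟨w, hw, hcontr⟩ := P.exists_contracts hz
  exact hcontr.exists_isStableManifold P.pos (by linarith [P.lt]) hz hs P.inv_θ_pos
    P.inv_θ_lt_one hw

lemma exists_isUnstableManifold (hz : OffSingular η z) (hs : SlowApproach η P.θ⁻¹ (revT z)) :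
    ∃ γ, IsUnstableManifold η z γ := by
  obtain ⟨γ, hγ⟩ := P.exists_isStableManifold hz.revT hs
  refine ⟨revT '' γ, isUnstableManifold_iff.2 ?_⟩
  simpa only [image_image, revT_revT, image_id'] using hγ

lemma mem_regularSet (hz : OffSingular η z) (hs : SlowApproach η P.θ⁻¹ z)
    (hs' : SlowApproach η P.θ⁻¹ (revT z)) : z ∈ regularSet η := by
  refine ⟨hz, fun v hv => ⟨P.lyapunov_ne_zero hz hv, ?_⟩, P.exists_isStableManifold hz hs,
    P.exists_isUnstableManifold hz hs'⟩
  rw [lyapunov_inv z hv]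
  exact P.lyapunov_ne_zero hz.revT (revM_mulVec_ne_zero hv)

end ConeData

end LocalManifolds

/-! ### Almost every point is regular -/

section MeasurePreserving

instance : IsProbabilityMeasure (volume : Measure UnitAddCircle) :=
  ⟨UnitAddCircle.measure_univ⟩

lemma measurable_rep : Measurable rep :=
  measurable_subtype_coe.comp (AddCircle.measurableEquivIco (1 : ℝ) 0).measurable

lemma measurable_profile (η : ℝ) : Measurable (profile η) :=
  Measurable.ite measurableSet_Iic (by fun_prop) (by fun_prop)

lemma measurePreserving_shearG : MeasurePreserving shearG :=
  measurePreserving_prod_add_right volume volume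

lemma measurePreserving_shearF (η : ℝ) : MeasurePreserving (shearF η) := by
  have hmeas : Measurable fun y : UnitAddCircle => (profile η (rep y) : UnitAddCircle) :=
    AddCircle.measurable_mk'.comp ((measurable_profile η).comp measurable_rep)
  have hskew :
      MeasurePreserving (fun p : Torus => (p.1, p.2 + (profile η (rep p.1) : UnitAddCircle)))
        (volume.prod volume) (volume.prod volume) :=
    MeasurePreserving.skew_product (g := fun y x => x + (profile η (rep y) : UnitAddCircle))
      (.id volume) (measurable_snd.add (hmeas.comp measurable_fst))
      (Eventually.of_forall fun x => (measurePreserving_add_right volume _).map_eq)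
  exact (Measure.measurePreserving_swap.comp hskew).comp Measure.measurePreserving_swap

lemma measurePreserving_mapH (η : ℝ) : MeasurePreserving (mapH η) :=
  measurePreserving_shearG.comp (measurePreserving_shearF η)

lemma measurePreserving_revT : MeasurePreserving revT :=
  ((Measure.measurePreserving_neg volume).prod (.id volume)).comp
    (measurePreserving_prod_sub volume volume)

lemma measurePreserving_mapH_inv (η : ℝ) :
    MeasurePreserving ((mapH η)⁻¹ : Equiv.Perm Torus) := by
  rw [mapH_inv_eq_conj]
  exact measurePreserving_revT.comp ((measurePreserving_mapH η).comp measurePreserving_revT)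

lemma measurePreserving_mapH_zpow (η : ℝ) (n : ℤ) :
    MeasurePreserving (mapH η ^ n : Equiv.Perm Torus) := by
  obtain ⟨k, rfl | rfl⟩ := Int.eq_nat_or_neg n
  · rw [zpow_natCast, Equiv.Perm.coe_pow]
    exact (measurePreserving_mapH η).iterate k
  · rw [zpow_neg, zpow_natCast, ← inv_pow, Equiv.Perm.coe_pow]
    exact (measurePreserving_mapH_inv η).iterate k

lemma measurePreserving_snd_mapH_zpow (η : ℝ) (n : ℤ) :
    MeasurePreserving fun z : Torus => ((mapH η ^ n) z).2 :=
  measurePreserving_snd.comp (measurePreserving_mapH_zpow η n)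

lemma volume_singleton_circle (c : UnitAddCircle) : volume ({c} : Set UnitAddCircle) = 0 := by
  rw [← Metric.closedBall_zero, AddCircle.volume_closedBall, mul_zero, min_eq_right zero_le_one,
    ENNReal.ofReal_zero]

lemma ae_offSingular (η : ℝ) : ∀ᵐ z : Torus, OffSingular η z := by
  refine ae_all_iff.2 fun n => (measurePreserving_snd_mapH_zpow η n).quasiMeasurePreserving.ae
    (p := fun c => ¬(c = 0 ∨ c = ((1 - η : ℝ) : UnitAddCircle))) ?_
  exact measure_eq_zero_iff_ae_notMem.1 <|
    measure_union_null (volume_singleton_circle 0) (volume_singleton_circle _)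

lemma exists_pos_mul_le_of_eventually_le {d e : ℕ → ℝ} (hd : ∀ n, 0 < d n) (he : ∀ n, 0 < e n)
    (h : ∀ᶠ n in atTop, e n ≤ d n) : ∃ δ > 0, ∀ n, δ * e n ≤ d n := by
  obtain ⟨N, hN⟩ := eventually_atTop.1 h
  obtain ⟨k, -, hk⟩ :=
    (Finset.range (N + 1)).exists_min_image (fun n => d n / e n) Finset.nonempty_range_add_one
  refine ⟨min 1 (d k / e k), lt_min one_pos (div_pos (hd k) (he k)), fun n => ?_⟩
  rw [← le_div_iff₀ (he n)]
  rcases le_or_gt N n with hn | hn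
  · exact (min_le_left _ _).trans ((one_le_div (he n)).2 (hN n hn))
  · exact (min_le_right _ _).trans (hk n (Finset.mem_range.2 (by omega)))

lemma ae_eventually_pow_lt_norm (η : ℝ) {ℓ : ℝ} (hℓ₀ : 0 < ℓ) (hℓ₁ : ℓ < 1) (c : UnitAddCircle) :
    ∀ᵐ z : Torus, ∀ᶠ n : ℕ in atTop, ℓ ^ n < ‖((mapH η ^ n) z).2 - c‖ := by
  have hvol : ∀ n : ℕ, volume ((fun z : Torus => ((mapH η ^ n) z).2) ⁻¹'
      Metric.closedBall c (ℓ ^ n)) ≤ ENNReal.ofReal (2 * ℓ ^ n) := by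
    intro n
    have hpres := measurePreserving_snd_mapH_zpow η n
    simp only [zpow_natCast] at hpres
    rw [hpres.measure_preimage Metric.isClosed_closedBall.nullMeasurableSet,
      AddCircle.volume_closedBall]
    exact ENNReal.ofReal_le_ofReal (min_le_right _ _)
  have hsum := ne_top_of_le_ne_top
    ((summable_geometric_of_lt_one hℓ₀.le hℓ₁).mul_left 2).tsum_ofReal_ne_top
    (ENNReal.tsum_le_tsum hvol)
  filter_upwards [ae_eventually_notMem hsum] with z hz
  refine hz.mono fun n hn => ?_
  rwa [mem_preimage, Metric.mem_closedBall, dist_eq_norm, not_le] at hn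

lemma ae_slowApproach (η : ℝ) {ℓ : ℝ} (hℓ₀ : 0 < ℓ) (hℓ₁ : ℓ < 1) :
    ∀ᵐ z : Torus, SlowApproach η ℓ z := by
  filter_upwards [ae_offSingular η, ae_eventually_pow_lt_norm η hℓ₀ hℓ₁ 0,
    ae_eventually_pow_lt_norm η hℓ₀ hℓ₁ ((1 - η : ℝ) : UnitAddCircle)] with z hz h₀ h₁
  refine exists_pos_mul_le_of_eventually_le (fun n => singDist_pos (hz.pow n).notMem)
    (fun n => pow_pos hℓ₀ n) ?_
  filter_upwards [h₀, h₁] with n hn₀ hn₁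
  rw [sub_zero] at hn₀
  exact le_min hn₀.le hn₁.le

end MeasurePreserving

lemma ConeData.volume_compl_regularSet {η : ℝ} (P : ConeData η) :
    volume (regularSet η)ᶜ = 0 := by
  have hslow := ae_slowApproach η P.inv_θ_pos P.inv_θ_lt_one
  rw [← mem_ae_iff]
  filter_upwards [ae_offSingular η, hslow, measurePreserving_revT.quasiMeasurePreserving.ae hslow]
    with z hz hs hs'
  exact P.mem_regularSet hz hs hs'

/-! ### Condition (M) -/

/-- Some backward image of `γ` contains a segment centred at `z` in the direction `v`. -/
def BackwardThrough (η : ℝ) (γ : Set Torus) (z : Torus) (v : Fin 2 → ℝ) : Prop :=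
  ∃ (n : ℕ) (ε : ℝ), 0 < ε ∧ seg z v ε ε ⊆ ((mapH η)⁻¹ ^ n : Equiv.Perm Torus) '' γ

section ConditionM

variable {η : ℝ} {γ : Set Torus} {z : Torus} {v w : Fin 2 → ℝ}

lemma seg_subset_seg {a b a' b' : ℝ} (ha : a ≤ a') (hb : b ≤ b') :
    seg z v a b ⊆ seg z v a' b' :=
  image_mono (Icc_subset_Icc (neg_le_neg ha) hb)

lemma backwardThrough_seg (η : ℝ) (z : Torus) (v : Fin 2 → ℝ) {a b : ℝ} (ha : 0 < a) (hb : 0 < b) :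
    BackwardThrough η (seg z v a b) z v := by
  refine ⟨0, min a b, lt_min ha hb, ?_⟩
  rw [pow_zero, Equiv.Perm.coe_one, image_id]
  exact seg_subset_seg (min_le_left a b) (min_le_right a b)

namespace BackwardThrough

lemma of_smul {c : ℝ} (hc : c ≠ 0) (h : BackwardThrough η γ z (c • v)) :
    BackwardThrough η γ z v := by
  obtain ⟨n, ε, hε, hsub⟩ := h
  have hc' : 0 < |c| := abs_pos.2 hc
  refine ⟨n, |c| * ε, by positivity, Subset.trans ?_ hsub⟩
  rintro _ ⟨t, ht, rfl⟩
  refine ⟨t / c, abs_le.1 ?_, ?_⟩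
  · rw [abs_div, div_le_iff₀' hc']
    exact abs_le.2 ht
  · beta_reduce
    rw [smul_smul, div_mul_cancel₀ _ hc]

lemma of_map (hη : 0 < η) (hη₁ : η < 1) (hz : z ∉ singularSet η)
    (h : BackwardThrough η γ (mapH η z) ((jacH η z).mulVec v)) : BackwardThrough η γ z v := by
  obtain ⟨n, ε, hε, hsub⟩ := h
  have hd := singDist_pos hz
  have hv : 0 < |v 1| + 1 := by positivity
  refine ⟨n + 1, min ε (singDist η z / (|v 1| + 1)), by positivity, ?_⟩
  rintro _ ⟨t, ht, rfl⟩
  obtain ⟨htε, htd⟩ := le_min_iff.1 (abs_le.2 ht)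
  have hsmall : |(t • v) 1| ≤ singDist η z := by
    rw [Pi.smul_apply, smul_eq_mul, abs_mul]
    calc |t| * |v 1| ≤ |t| * (|v 1| + 1) := by gcongr; linarith
      _ ≤ singDist η z := (le_div_iff₀ hv).1 htd
  have hmap := mapH_add_proj hη hη₁ hz hsmall
  rw [Matrix.mulVec_smul] at hmap
  obtain ⟨x, hx, hx_eq⟩ := hsub ⟨t, abs_le.1 htε, hmap.symm⟩
  refine ⟨x, hx, ?_⟩
  rw [pow_succ', Equiv.Perm.mul_apply, hx_eq]
  exact (mapH η).symm_apply_apply _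

lemma of_cocycle (hη : 0 < η) (hη₁ : η < 1) (hz : OffSingular η z) {j : ℕ}
    (h : BackwardThrough η γ ((mapH η ^ j) z) ((cocycle (mapH η) (jacH η) j z).mulVec v)) :
    BackwardThrough η γ z v := by
  induction j with
  | zero => simpa only [cocycle, pow_zero, Equiv.Perm.one_apply, Matrix.one_mulVec] using h
  | succ j ih =>
    refine ih (of_map hη hη₁ (hz.pow j).notMem ?_)
    rwa [pow_succ', Equiv.Perm.mul_apply, cocycle, ← Matrix.mulVec_mulVec] at h

lemma exists_hasLength (P : ConeData η) (hA : InA η z) (hz : z ∉ singularSet η) (hw : w ≠ 0)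
    (hcone : P.InCone w) (h : BackwardThrough η γ z w) :
    ∃ L > 0, HasLength P (InBackward η γ) L := by
  obtain ⟨n, ε, hε, hsub⟩ := h
  obtain ⟨y, hy, hy₀, hy₁⟩ := hA.exists_lift hz
  obtain ⟨s, rfl⟩ := exists_eq_pt_of_snd hy
  have hw₁ := hcone.snd_ne_zero hw
  obtain ⟨ρ, ⟨hμ, hr⟩, hslope⟩ := hcone
  have hw_pos : 0 < |w 1| := abs_pos.2 hw₁
  obtain ⟨d, hd, hdε, hdy, hdy'⟩ : ∃ d > 0, d ≤ ε * |w 1| ∧ d ≤ y ∧ d ≤ 1 - η - y := by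
    refine ⟨min (ε * |w 1|) (min y (1 - η - y)), lt_min (by positivity)
      (lt_min hy₀ (by linarith)), min_le_left _ _, ?_, ?_⟩
    · exact (min_le_right _ _).trans (min_le_left _ _)
    · exact (min_le_right _ _).trans (min_le_right _ _)
  refine ⟨(ρ - 1) * (2 * d), mul_pos (by linarith [P.one_lt_μ]) (by linarith), y - d, s - ρ * d,
    2 * d, ρ, ⟨by linarith, hμ, hr, by linarith, by linarith, n, Subset.trans ?_ hsub⟩, le_rfl⟩
  rintro _ ⟨u, hu, rfl⟩
  have ht : |(2 * u - 1) * d / w 1| ≤ ε := by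
    have hu' : |2 * u - 1| ≤ 1 := abs_le.2 ⟨by linarith [hu.1], by linarith [hu.2]⟩
    rw [abs_div, div_le_iff₀ hw_pos, abs_mul, abs_of_pos hd]
    exact (mul_le_of_le_one_left hd.le hu').trans hdε
  refine ⟨(2 * u - 1) * d / w 1, abs_le.1 ht, ?_⟩
  beta_reduce
  rw [pt_add_proj, Pi.smul_apply, Pi.smul_apply, ← smul_sub, hslope, smul_eq_mul, smul_eq_mul]
  congr 1 <;> field_simp <;> ring

end BackwardThrough

lemma exists_crossing {h y₀ y₁ s₀ s₁ : ℝ} (hh : 0 < h) (hy₀ : 0 ≤ y₀) (hy : y₀ ≤ y₁)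
    (hy₁ : y₁ ≤ h) (hs₀ : 0 ≤ s₀) (hs : s₀ ≤ s₁) (hs₁ : s₁ ≤ h) :
    ∃ u ∈ Icc (0 : ℝ) 1, ∃ w ∈ Icc (0 : ℝ) 1,
      y₀ + u * (y₁ - y₀) = w * h ∧ u * h = s₀ + w * (s₁ - s₀) := by
  have hbot : -s₀ - y₀ / h * (s₁ - s₀) ≤ 0 := by
    linarith [mul_nonneg (div_nonneg hy₀ hh.le) (sub_nonneg.2 hs)]
  have htop : 0 ≤ h - s₀ - y₁ / h * (s₁ - s₀) := by
    linarith [mul_le_of_le_one_left (sub_nonneg.2 hs) ((div_le_one hh).2 hy₁)]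
  obtain ⟨u, hu₀, hu₁, hu⟩ := exists_add_mul_sub_eq hbot htop
  refine ⟨u, ⟨hu₀, hu₁⟩, (y₀ + u * (y₁ - y₀)) / h, ⟨div_nonneg (by nlinarith) hh.le, ?_⟩,
    (div_mul_cancel₀ _ hh.ne').symm, ?_⟩
  · rw [div_le_one hh]
    nlinarith
  · linear_combination hu

namespace ExpandingCone

variable (P : ExpandingCone η)

include P

lemma crosses_of_isStableManifold (hz : OffSingular η z) (h : IsStableManifold η z γ) :
    Crosses η (InBackward η γ) := by
  obtain ⟨⟨v, a, b, hv, hneg, ha, hb, rfl⟩, -⟩ := h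
  obtain ⟨M, hM⟩ := exists_unimodularBound_jacH η
  obtain ⟨j, z', rfl, hA, hz'⟩ := hz.exists_inA P.pos (by linarith [P.lt])
  obtain ⟨w, hw, hcone, hcontr⟩ := P.exists_inCone_contracts hz' hA
  obtain ⟨c, rfl⟩ := hM.exists_eq_smul_of_lyapunov_neg _ (hM.cocycle_mulVec_ne_zero j z' hw)
    P.inv_θ_pos P.inv_θ_lt_one (hcontr.along_orbit P.inv_θ_pos j) hneg
  have hback : BackwardThrough η _ z' w :=
    .of_cocycle (j := j) P.pos (by linarith [P.lt]) hz' <|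
      (backwardThrough_seg η _ _ ha hb).of_smul (left_ne_zero_of_smul hv)
  obtain ⟨L, hL, hlen⟩ := hback.exists_hasLength P.toConeData hA hz'.notMem hw hcone
  exact hlen.crosses (segClosed_inBackward P.toConeData _) P.sum_lt_one hL

/- Time reversal exchanges `y` and `s`: the forward images of `γu` contain a segment crossing the
square from left to right, and the backward images of `γs` one crossing it from bottom to top. -/
lemma conditionM : ConditionM η := by
  rintro z ⟨hz, -⟩ z' ⟨hz', -⟩ γu γs hγu hγs
  obtain ⟨y₀, y₁, hy₀, hy, hy₁, n, hn⟩ := P.crosses_of_isStableManifold hz' hγs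
  obtain ⟨s₀, s₁, hs₀, hs, hs₁, m, hm⟩ :=
    P.crosses_of_isStableManifold (OffSingular.revT hz) (isUnstableManifold_iff.1 hγu)
  obtain ⟨u, hu, w, hw, huw, hwu⟩ :=
    exists_crossing (by linarith [P.lt]) hy₀ hy hy₁ hs₀ hs hs₁
  refine ⟨m, n, pt (y₀ + u * (y₁ - y₀)) (u * (1 - η)), ?_, hn ⟨u, hu, ?_⟩⟩
  · obtain ⟨_, ⟨x, hx, rfl⟩, hx_eq⟩ := hm ⟨w, hw, rfl⟩
    rw [mapH_inv_pow_apply, revT_revT] at hx_eq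
    refine ⟨x, hx, revT.injective ?_⟩
    rw [hx_eq, revT_pt, huw, hwu]
    beta_reduce
    rw [sub_zero, zero_add]
  · beta_reduce
    rw [sub_zero, zero_add]

end ExpandingCone

end ConditionM

end ToralShear

theorem mainTheorem1 :
    |ToralShear.eta1 - 0.324| < 0.0005 ∧
    ∀ η : ℝ, 0 < η → η < ToralShear.eta1 →
      MeasureTheory.volume (ToralShear.regularSet η)ᶜ = 0 ∧ ToralShear.ConditionM η := by
  obtain ⟨hlow, hhigh⟩ := ToralShear.eta1_bounds
  refine ⟨abs_lt.2 ⟨by linarith, by linarith⟩, fun η hη₀ hη => ?_⟩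
  obtain ⟨P⟩ := ToralShear.nonempty_expandingCone hη₀ hη
  exact ⟨P.volume_compl_regularSet, P.conditionM⟩
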